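/- Let $\Bbbk\subset\mathbb C$ be a subfield, $n\ge 1$, and let $f=\sum_{a\in\mathbb N^n}c_a x^a\in \Bbbk[x_1,\dots,x_n]$ be a non-constant polynomial with $f(0)=0$. Let $\Gamma_+(f)$ be its Newton polyhedron, the convex hull of $\bigcup_{c_a\ne0}(a+\mathbb R_{\ge0}^n)$, and assume that $f$ is non-degenerate: for every compact face $\varsigma$ of $\Gamma_+(f)$ the closed subscheme $V(f_\varsigma)\subset\mathbb A^n$, $f_\varsigma=\sum_{a\in\varsigma}c_ax^a$, is non-singular in the torus $\mathbf G_m^n$. A facet $\tau$ of $\Gamma_+(f)$ is a $B_1$-facet with base direction $i$ if it has a vertex $v$ with $v_i=1$, every other vertex $w$ of $\tau$ has $w_i=0$, and $\tau+\mathbb R_{\ge0}e_i\not\subset\tau$. Let $\mathfrak B$ be a set of $B_1$-facets of $\Gamma_+(f)$, none of which is contained in a translate $\{a_i=m\}$ of a coordinate hyperplane, with consistent base directions: one can choose a base direction $b(\tau)$ for each $\tau\in\mathfrak B$ such that $b(\tau_1)=b(\tau_2)$ whenever $\tau_1\cap\tau_2$ is a codimension-one face of both $\tau_1$ and $\tau_2$.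 For a facet $\tau$ let $u_\tau\in\mathbb N^n$ be its primitive normal vector and $N_\tau$ the value of $a\cdot u_\tau$ on $\tau$. Let $\Gamma_+^\dagger=\{a\in\mathbb R^n_{\ge0}: a\cdot u_\tau\ge N_\tau \text{ for all facets }\tau\notin\mathfrak B\}$ be the $\mathfrak B$-cut of $\Gamma_+(f)$, and $\Sigma^\dagger$ its normal fan. For each ray $\rho\in\Sigma^\dagger[1]$ let $u_\rho$ be its primitive generator and $N_\rho=\inf_{a\in\Gamma_+(f)}a\cdot u_\rho$. Let $\mathscr X_{\Sigma^\dagger}=[X_{\widehat\Sigma^\dagger}/\mathbb G_\beta]$ be the smooth toric Artin stack given by Cox's construction: $X_{\widehat\Sigma^\dagger}$ is the complement in $\operatorname{Spec}\Bbbk[x'_\rho:\rho\in\Sigma^\dagger[1]]$ of the zero set of the monomials $\prod_{\rho\not\subset\sigma}x'_\rho$, $\sigma\in\Sigma^\dagger$, and $\mathbb G_\beta=\ker(\mathbf G_m^{\Sigma^\dagger[1]}\to\mathbf G_m^n)$. Let $\Pi_{\Sigma^\dagger}:\mathscr X_{\Sigma^\dagger}\to\mathbb A^n$ be the multi-weighted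 blow-up, induced by $\Pi^\#(x_i)=\prod_\rho (x'_\rho)^{u_{\rho,i}}$. Let $f'=\sum_a c_a\prod_\rho (x'_\rho)^{a\cdot u_\rho-N_\rho}$ be the proper transform of $f$, so that $\Pi^\#(f)=f'\cdot\prod_\rho (x'_\rho)^{N_\rho}$ and $V(f')$ is a divisor on $\mathscr X_{\Sigma^\dagger}$. Then at all points of $\Pi_{\Sigma^\dagger}^{-1}(0)$ the divisor $V(f')\subset\mathscr X_{\Sigma^\dagger}$ is smooth and intersects the divisors $V(x'_\rho)$, $\rho\in\Sigma^\dagger[1]$ with $N_\rho>0$, transversally; in other words, $\Pi_{\Sigma^\dagger}^{-1}(V(f))$ is a simple normal crossings divisor (with multiplicities) at the points of $\Pi_{\Sigma^\dagger}^{-1}(0)$. -/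

import Mathlib

namespace BCut

open MvPolynomial

/-! ## Convex geometry: faces, facets, normal fans -/

section Convex

variable {n : ℕ}

/-- A lattice vector with natural coordinates, seen as a real vector. -/
def toReal (a : Fin n → ℕ) : Fin n → ℝ := fun i => (a i : ℝ)

/-- The pairing of `a` and `u`. -/
def pair (a u : Fin n → ℝ) : ℝ := ∑ i, a i * u i

/-- The dimension of (the affine span of) a nonempty set. -/
noncomputable def dim (P : Set (Fin n → ℝ)) : ℕ := Module.finrank ℝ (vectorSpan ℝ P)

/-- `F` is a (nonempty) face of the polyhedron `P`; the polyhedron itself is one of its faces. -/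
def IsFace (P F : Set (Fin n → ℝ)) : Prop := F.Nonempty ∧ IsExposed ℝ P F

/-- `F` is a codimension-one face of `P`. -/
def IsFacet (P F : Set (Fin n → ℝ)) : Prop := IsFace P F ∧ dim F + 1 = dim P

/-- Two facets are adjacent if they intersect in a common facet. -/
def Adjacent (F G : Set (Fin n → ℝ)) : Prop := IsFacet F (F ∩ G) ∧ IsFacet G (F ∩ G)

/-- The piecewise-linear function `φ(u) = inf_{a ∈ P} a · u` of a Newton polyhedron `P`. -/
noncomputable def supportFn (P : Set (Fin n → ℝ)) (u : Fin n → ℝ) : ℝ :=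
  sInf ((fun a => pair a u) '' P)

/-- The first meet locus of `u`: the face of `P` where `a · u` attains its infimum `φ(u)`. -/
def meetLocus (P : Set (Fin n → ℝ)) (u : Fin n → ℝ) : Set (Fin n → ℝ) :=
  {a | a ∈ P ∧ pair a u = supportFn P u}

/-- The cone `σ_a` of all `u ≥ 0` with `φ(u) = a · u`. -/
def normalCone (P : Set (Fin n → ℝ)) (a : Fin n → ℝ) : Set (Fin n → ℝ) :=
  {u | 0 ≤ u ∧ supportFn P u = pair a u}

/-- The normal fan of a Newton polyhedron, as a set of cones in the nonnegative orthant. -/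
def normalFan (P : Set (Fin n → ℝ)) : Set (Set (Fin n → ℝ)) := normalCone P '' P

/-- A lattice vector in the nonnegative orthant is primitive if its coordinates have gcd `1`. -/
def IsPrimitive (u : Fin n → ℕ) : Prop := Finset.univ.gcd u = 1

/-- The ray spanned by `u`. -/
def rayOf (u : Fin n → ℕ) : Set (Fin n → ℝ) := {v | ∃ t : ℝ, 0 ≤ t ∧ v = t • toReal u}

/-- The rays (one-dimensional cones) of the normal fan of `P`, each given by its primitive
generator. -/
def Ray (P : Set (Fin n → ℝ)) : Type := {u : Fin n → ℕ // IsPrimitive u ∧ rayOf u ∈ normalFan P}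

/-- The primitive generator of a ray. -/
def Ray.gen {P : Set (Fin n → ℝ)} (ρ : Ray P) : Fin n → ℕ := ρ.1

/-- The primitive normal vectors `u_τ` of the facets `τ` of `P` that are not in `B`. A facet is the
first meet locus of its primitive normal vector. -/
def keptNormals (P : Set (Fin n → ℝ)) (B : Set (Set (Fin n → ℝ))) : Set (Fin n → ℕ) :=
  {u | IsPrimitive u ∧ IsFacet P (meetLocus P (toReal u)) ∧ meetLocus P (toReal u) ∉ B}

/-- The `B`-cut of `P`: the intersection, in the nonnegative orthant, of the supporting half-spaces
`a · u_τ ≥ N_τ = φ(u_τ)` of all facets `τ` of `P` that are not in `B`. -/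
def cut (P : Set (Fin n → ℝ)) (B : Set (Set (Fin n → ℝ))) : Set (Fin n → ℝ) :=
  {a | 0 ≤ a ∧ ∀ u ∈ keptNormals P B, supportFn P (toReal u) ≤ pair a (toReal u)}

/-- The facet `τ` is a `B₁`-facet with apex `v` and base direction `i`: `v` is a vertex of `τ` with
`v_i = 1`, all other vertices have `i`-th coordinate `0`, and `τ` is compact in the `i`-th
coordinate. -/
def IsB1With (τ : Set (Fin n → ℝ)) (v : Fin n → ℝ) (i : Fin n) : Prop :=
  v ∈ τ.extremePoints ℝ ∧ v i = 1 ∧ (∀ w ∈ τ.extremePoints ℝ, w ≠ v → w i = 0) ∧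
    ¬ ∀ a ∈ τ, ∀ t : ℝ, 0 ≤ t → a + t • Pi.single i 1 ∈ τ

/-- `B` is a set of `B₁`-facets of `P` with consistent base directions: each `τ ∈ B` has a
distinguished base direction, the same for adjacent facets. -/
def IsConsistentB1 (P : Set (Fin n → ℝ)) (B : Set (Set (Fin n → ℝ))) : Prop :=
  (∀ τ ∈ B, IsFacet P τ) ∧
    ∃ b : Set (Fin n → ℝ) → Fin n, (∀ τ ∈ B, ∃ v, IsB1With τ v (b τ)) ∧
      ∀ τ₁ ∈ B, ∀ τ₂ ∈ B, Adjacent τ₁ τ₂ → b τ₁ = b τ₂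

end Convex

/-! ## Newton polyhedra and non-degeneracy -/

section Newton

variable {n : ℕ} {K : Type*} [Field K]

/-- The Newton polyhedron of `f`. -/
def newton (f : MvPolynomial (Fin n) K) : Set (Fin n → ℝ) :=
  convexHull ℝ (⋃ (a : Fin n →₀ ℕ) (_ : a ∈ f.support), {x | toReal a ≤ x})

open Classical in
/-- The part `f_F` of `f` supported on the face `F`. -/
noncomputable def facePart (f : MvPolynomial (Fin n) K) (F : Set (Fin n → ℝ)) :
    MvPolynomial (Fin n) K :=
  ∑ a ∈ f.support.filter (fun a : Fin n →₀ ℕ => toReal a ∈ F), monomial a (coeff a f)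

/-- `N_u = min {a · u : a ∈ supp f}` for a lattice vector `u` in the nonnegative orthant, which is
the infimum of `a · u` over the Newton polyhedron (see `ordAlong_eq_supportFn`). -/
noncomputable def ordAlong (f : MvPolynomial (Fin n) K) (u : Fin n → ℕ) : ℕ :=
  sInf ((fun a : Fin n →₀ ℕ => ∑ i, a i * u i) '' (f.support : Set (Fin n →₀ ℕ)))

end Newton

/-! ### Finiteness of the set of rays -/

section Finiteness

variable {n : ℕ} {K : Type*} [Field K]

theorem pair_add (a b u : Fin n → ℝ) : pair (a + b) u = pair a u + pair b u := by
  simp [pair, add_mul, Finset.sum_add_distrib]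

theorem pair_smul (t : ℝ) (a u : Fin n → ℝ) : pair (t • a) u = t * pair a u := by
  simp [pair, Finset.mul_sum, mul_assoc]

theorem pair_single (i : Fin n) (u : Fin n → ℝ) : pair (Pi.single i 1) u = u i := by
  simp [pair, Pi.single_apply]

theorem pair_mono {a b u : Fin n → ℝ} (hu : 0 ≤ u) (h : a ≤ b) : pair a u ≤ pair b u :=
  Finset.sum_le_sum fun i _ => mul_le_mul_of_nonneg_right (h i) (hu i)

theorem toReal_nonneg (u : Fin n → ℕ) : 0 ≤ toReal u := fun i => Nat.cast_nonneg _

theorem eq_of_cross {u v : Fin n → ℕ} (hu : IsPrimitive u) (hv : IsPrimitive v)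
    (h : ∀ i j, u i * v j = v i * u j) : u = v := by
  funext i
  have h1 : (Finset.univ.gcd fun j => u i * v j) = Finset.univ.gcd fun j => v i * u j := by
    simp only [h i]
  rw [Finset.gcd_mul_left, Finset.gcd_mul_left] at h1
  have hu' : (Finset.univ.gcd fun j => u j) = 1 := hu
  have hv' : (Finset.univ.gcd fun j => v j) = 1 := hv
  simpa [hu', hv'] using h1

theorem rayOf_injective {u v : Fin n → ℕ} (hu : IsPrimitive u) (hv : IsPrimitive v)
    (h : rayOf u = rayOf v) : u = v := by
  have : toReal u ∈ rayOf v := h ▸ ⟨1, zero_le_one, by simp⟩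
  obtain ⟨t, -, ht⟩ := this
  have ht' : ∀ i, (u i : ℝ) = t * v i := fun i => congrFun ht i
  refine eq_of_cross hu hv fun i j => ?_
  have : (u i : ℝ) * v j = v i * u j := by rw [ht' i, ht' j]; ring
  exact_mod_cast this

theorem newton_nonneg {f : MvPolynomial (Fin n) K} {a : Fin n → ℝ} (ha : a ∈ newton f) :
    0 ≤ a := by
  have : newton f ⊆ Set.Ici 0 := by
    refine convexHull_min ?_ (convex_Ici 0)
    intro x hx
    simp only [Set.mem_iUnion] at hx
    obtain ⟨s, -, hs⟩ := hx
    exact (toReal_nonneg _).trans hs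
  exact this ha

theorem newton_add {f : MvPolynomial (Fin n) K} {a r : Fin n → ℝ} (ha : a ∈ newton f)
    (hr : 0 ≤ r) : a + r ∈ newton f := by
  have : newton f ⊆ (fun x => x + r) ⁻¹' newton f := by
    refine convexHull_min ?_ ((convex_convexHull ℝ _).translate_preimage_left r)
    intro x hx
    refine subset_convexHull ℝ _ ?_
    simp only [Set.mem_iUnion] at hx ⊢
    obtain ⟨s, hs, hx⟩ := hx
    exact ⟨s, hs, le_add_of_le_of_nonneg hx hr⟩
  exact this ha

theorem supportFn_le {P : Set (Fin n → ℝ)} (hP : ∀ a ∈ P, 0 ≤ a) {u : Fin n → ℝ} (hu : 0 ≤ u)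
    {a : Fin n → ℝ} (ha : a ∈ P) : supportFn P u ≤ pair a u := by
  refine csInf_le ⟨0, ?_⟩ ⟨a, ha, rfl⟩
  rintro _ ⟨b, hb, rfl⟩
  exact Finset.sum_nonneg fun i _ => mul_nonneg (hP b hb i) (hu i)

/-- `N_u` is the infimum of `a · u` over the Newton polyhedron. -/
theorem ordAlong_eq_supportFn {f : MvPolynomial (Fin n) K} (hf : f ≠ 0) (u : Fin n → ℕ) :
    (ordAlong f u : ℝ) = supportFn (newton f) (toReal u) := by
  have hcast : ∀ a : Fin n →₀ ℕ, pair (toReal a) (toReal u) = ((∑ i, a i * u i : ℕ) : ℝ) := by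
    intro a; simp [pair, toReal]
  have hne : ((fun a : Fin n →₀ ℕ => ∑ i, a i * u i) ''
      (f.support : Set (Fin n →₀ ℕ))).Nonempty :=
    (Finset.coe_nonempty.2 (by simpa using hf)).image _
  obtain ⟨a, ha, hau⟩ := Nat.sInf_mem hne
  have hmem : toReal a ∈ newton f := by
    refine subset_convexHull ℝ _ ?_
    simp only [Set.mem_iUnion]
    exact ⟨a, ha, le_refl (toReal a)⟩
  have hau' : pair (toReal a) (toReal u) = (ordAlong f u : ℝ) := by
    rw [hcast]; exact congrArg Nat.cast hau
  apply le_antisymm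
  · refine le_csInf ⟨_, ⟨_, hmem, rfl⟩⟩ ?_
    rintro _ ⟨b, hb, rfl⟩
    have : newton f ⊆ {x | (ordAlong f u : ℝ) ≤ pair x (toReal u)} := by
      refine convexHull_min ?_ ?_
      · intro x hx
        simp only [Set.mem_iUnion] at hx
        obtain ⟨s, hs, hx⟩ := hx
        refine le_trans ?_ (pair_mono (toReal_nonneg u) hx)
        rw [hcast]
        exact Nat.cast_le.2 (Nat.sInf_le ⟨s, hs, rfl⟩)
      · exact convex_halfSpace_ge ⟨fun a b => pair_add a b _, fun t a => pair_smul t a _⟩ _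
    exact this hb
  · rw [← hau']
    exact supportFn_le (fun _ => newton_nonneg) (toReal_nonneg u) hmem

theorem dim_newton {f : MvPolynomial (Fin n) K} (hf : (newton f).Nonempty) :
    dim (newton f) = n := by
  obtain ⟨a, ha⟩ := hf
  have : vectorSpan ℝ (newton f) = ⊤ := by
    rw [eq_top_iff, ← (Pi.basisFun ℝ (Fin n)).span_eq, Submodule.span_le]
    rintro _ ⟨i, rfl⟩
    have h : a + Pi.single i (1 : ℝ) ∈ newton f :=
      newton_add ha (by rw [Pi.single_nonneg]; exact zero_le_one)
    have := vsub_mem_vectorSpan ℝ h ha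
    simpa using this
  rw [dim, this, finrank_top, Module.finrank_fin_fun]

theorem finite_faces (f : MvPolynomial (Fin n) K) : {F | IsFace (newton f) F}.Finite := by
  classical
  let D : Set (Fin n → ℝ) → Finset (Fin n →₀ ℕ) × Finset (Fin n) := fun F =>
    (f.support.filter fun s => toReal s ∈ F,
      Finset.univ.filter fun i => ∀ a ∈ F, a + Pi.single i 1 ∈ F)
  have hD : ∀ F G, IsFace (newton f) F → IsFace (newton f) G → D F = D G → F ⊆ G := by
    intro F G hF hG h
    simp only [D, Prod.mk.injEq] at h
    have hGc : Convex ℝ G := hG.2.convex (convex_convexHull ℝ _)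
    obtain ⟨l, hl⟩ := hF.2 hF.1
    obtain ⟨l', hl'⟩ := hG.2 hG.1
    obtain ⟨x₀, hx₀⟩ := hF.1
    obtain ⟨y₀, hy₀⟩ := hG.1
    have hx₀' := hx₀
    have hy₀' := hy₀
    rw [hl] at hx₀'
    rw [hl'] at hy₀'
    have hpos : ∀ i, (0 : Fin n → ℝ) ≤ Pi.single i 1 := fun i => by
      rw [Pi.single_nonneg]; exact zero_le_one
    have memF : ∀ x ∈ newton f, l x₀ ≤ l x → x ∈ F := fun x hx h => by
      rw [hl]; exact ⟨hx, fun y hy => (hx₀'.2 y hy).trans h⟩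
    have memG : ∀ x ∈ newton f, l' y₀ ≤ l' x → x ∈ G := fun x hx h => by
      rw [hl']; exact ⟨hx, fun y hy => (hy₀'.2 y hy).trans h⟩
    have hle : ∀ i, l (Pi.single i 1) ≤ 0 := fun i => by
      have := hx₀'.2 _ (newton_add hx₀'.1 (hpos i))
      rw [map_add] at this; linarith
    have hdir : ∀ i, l (Pi.single i 1) = 0 → l' (Pi.single i 1) = 0 := fun i hi => by
      have h1 : i ∈ Finset.univ.filter fun i => ∀ a ∈ F, a + Pi.single i 1 ∈ F := by
        simp only [Finset.mem_filter, Finset.mem_univ, true_and]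
        intro a ha
        rw [hl] at ha
        refine memF _ (newton_add ha.1 (hpos i)) ?_
        rw [map_add, hi, add_zero]; exact ha.2 _ hx₀'.1
      rw [h.2] at h1
      simp only [Finset.mem_filter, Finset.mem_univ, true_and] at h1
      have h2 := h1 y₀ hy₀
      rw [hl'] at h2
      have h3 := h2.2 _ hy₀'.1
      have h4 := hy₀'.2 _ h2.1
      rw [map_add] at h3 h4
      linarith
    have key : newton f ⊆ {x | l x ≤ l x₀ ∧ (l x = l x₀ → x ∈ G)} := by
      refine convexHull_min ?_ ?_
      · intro x hx
        have hxN : x ∈ newton f := subset_convexHull ℝ _ hx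
        refine ⟨hx₀'.2 x hxN, fun hlx => ?_⟩
        simp only [Set.mem_iUnion] at hx
        obtain ⟨s, hs, hsx⟩ := hx
        have hsN : toReal s ∈ newton f := by
          refine subset_convexHull ℝ _ ?_
          simp only [Set.mem_iUnion]
          exact ⟨s, hs, le_refl (toReal s)⟩
        have hexp : ∀ m : StrongDual ℝ (Fin n → ℝ),
            m x = m (toReal s) + ∑ i, (x i - toReal s i) * m (Pi.single i 1) := fun m => by
          have h1 : x = toReal s + ∑ i, (x i - toReal s i) • (Pi.single i 1 : Fin n → ℝ) := by
            ext j
            simp [Finset.sum_apply, Pi.single_apply]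
          conv_lhs => rw [h1]
          simp [map_add, map_sum]
        have hterm : ∀ i ∈ Finset.univ, (x i - toReal s i) * l (Pi.single i 1) ≤ 0 :=
          fun i _ => mul_nonpos_of_nonneg_of_nonpos (sub_nonneg.2 (hsx i)) (hle i)
        have h1 := hexp l
        have h2 := hx₀'.2 _ hsN
        have h3 := Finset.sum_nonpos hterm
        have h4 : ∑ i, (x i - toReal s i) * l (Pi.single i 1) = 0 := by linarith
        have h5 := (Finset.sum_eq_zero_iff_of_nonpos hterm).1 h4
        have hsF : s ∈ f.support.filter fun s : Fin n →₀ ℕ => toReal s ∈ F :=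
          Finset.mem_filter.2 ⟨hs, memF _ hsN (by linarith)⟩
        rw [h.1] at hsF
        have hsG := (Finset.mem_filter.1 hsF).2
        rw [hl'] at hsG
        refine memG x hxN ?_
        have h6 : ∑ i, (x i - toReal s i) * l' (Pi.single i 1) = 0 := by
          refine Finset.sum_eq_zero fun i hi => ?_
          rcases mul_eq_zero.1 (h5 i hi) with h | h
          · rw [h, zero_mul]
          · rw [hdir i h, mul_zero]
        rw [hexp l', h6, add_zero]
        exact hsG.2 _ hy₀'.1
      · rintro x ⟨hx, hx'⟩ y ⟨hy, hy'⟩ a b ha hb hab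
        have hb' : b = 1 - a := by linarith
        simp only [Set.mem_ofPred_eq, map_add, map_smul, smul_eq_mul]
        refine ⟨by subst hb'; nlinarith, fun he => ?_⟩
        rcases ha.eq_or_lt with h0 | h0
        · have : b = 1 := by linarith
          subst h0; subst this
          simp only [zero_smul, one_smul, zero_add, zero_mul, one_mul] at he ⊢
          exact hy' he
        rcases hb.eq_or_lt with h1 | h1
        · have : a = 1 := by linarith
          subst h1; subst this
          simp only [zero_smul, one_smul, add_zero, zero_mul, one_mul] at he ⊢
          exact hx' he
        have e1 : l x = l x₀ := by
          refine le_antisymm hx ?_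
          subst hb'; nlinarith
        have e2 : l y = l x₀ := by
          refine le_antisymm hy ?_
          have : a = 1 - b := by linarith
          subst this; nlinarith
        exact hGc (hx' e1) (hy' e2) ha hb hab
    intro a ha
    rw [hl] at ha
    exact (key ha.1).2 (le_antisymm (hx₀'.2 _ ha.1) (ha.2 _ hx₀'.1))
  refine Set.Finite.of_finite_image (f := D) ?_ ?_
  · refine ((f.support.powerset ×ˢ Finset.univ.powerset : Finset _).finite_toSet).subset ?_
    rintro _ ⟨F, -, rfl⟩
    simp only [D, Finset.coe_product, Set.mem_prod, Finset.mem_coe, Finset.mem_powerset]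
    exact ⟨Finset.filter_subset _ _, Finset.filter_subset _ _⟩
  · intro F hF G hG h
    exact (hD F G hF hG h).antisymm (hD G F hG hF h.symm)

theorem keptNormals_finite (f : MvPolynomial (Fin n) K) (B : Set (Set (Fin n → ℝ))) :
    (keptNormals (newton f) B).Finite := by
  refine Set.Finite.of_finite_image (f := fun u => meetLocus (newton f) (toReal u)) ?_ ?_
  · refine (finite_faces f).subset ?_
    rintro _ ⟨u, hu, rfl⟩
    exact hu.2.1.1
  · rintro u hu v hv (h : meetLocus _ _ = meetLocus _ _)
    let L : (Fin n → ℕ) → (Fin n → ℝ) →ₗ[ℝ] ℝ := fun w =>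
      { toFun := fun a => pair a (toReal w)
        map_add' := fun a b => pair_add a b _
        map_smul' := fun t a => pair_smul t a _ }
    have hspan : ∀ w, vectorSpan ℝ (meetLocus (newton f) (toReal w)) ≤ LinearMap.ker (L w) := by
      intro w
      rw [vectorSpan, Submodule.span_le]
      rintro _ ⟨a, ha, b, hb, rfl⟩
      change L w (a - b) = 0
      rw [map_sub]
      exact sub_eq_zero.2 (ha.2.trans hb.2.symm)
    have hker : LinearMap.ker (L u) ≠ ⊤ := by
      intro htop
      have hz : ∀ i, u i = 0 := fun i => by
        have h1 : (Pi.single i 1 : Fin n → ℝ) ∈ LinearMap.ker (L u) := htop ▸ Submodule.mem_top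
        have h2 : pair (Pi.single i 1) (toReal u) = 0 := h1
        rw [pair_single] at h2
        exact Nat.cast_eq_zero.1 h2
      have h1 : Finset.univ.gcd u = 1 := hu.1
      have h2 : Finset.univ.gcd u = 0 := Finset.gcd_eq_zero_iff.2 fun i _ => hz i
      omega
    have hlt := Submodule.finrank_lt (lt_top_iff_ne_top.2 hker).ne
    rw [Module.finrank_fin_fun] at hlt
    have hdim := hu.2.1.2
    rw [dim_newton (hu.2.1.1.1.mono fun a ha => ha.1)] at hdim
    have heq := Submodule.eq_of_le_of_finrank_le (hspan u) (by unfold dim at hdim; omega)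
    have hle : LinearMap.ker (L u) ≤ LinearMap.ker (L v) := by
      rw [← heq, h]; exact hspan v
    refine eq_of_cross hu.1 hv.1 fun i j => ?_
    have hmem : ((u j : ℝ) • Pi.single i 1 - (u i : ℝ) • Pi.single j 1 : Fin n → ℝ) ∈
        LinearMap.ker (L u) := by
      rw [LinearMap.mem_ker, map_sub, map_smul, map_smul]
      change (u j : ℝ) * pair _ _ - (u i : ℝ) * pair _ _ = 0
      rw [pair_single, pair_single]
      simp only [toReal]
      ring
    have hmem' := hle hmem
    rw [LinearMap.mem_ker, map_sub, map_smul, map_smul] at hmem'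
    change (u j : ℝ) * pair _ _ - (u i : ℝ) * pair _ _ = 0 at hmem'
    rw [pair_single, pair_single] at hmem'
    simp only [toReal] at hmem'
    have : (u i : ℝ) * v j = v i * u j := by linarith
    exact_mod_cast this

theorem cut_normalFan_finite (P : Set (Fin n → ℝ)) (B : Set (Set (Fin n → ℝ)))
    (h : (keptNormals P B).Finite) : (normalFan (cut P B)).Finite := by
  classical
  let D : (Fin n → ℝ) → Set (Fin n → ℕ) × Finset (Fin n) := fun a =>
    ({u | u ∈ keptNormals P B ∧ supportFn P (toReal u) = pair a (toReal u)},
      Finset.univ.filter fun i => a i = 0)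
  have hD : ∀ a ∈ cut P B, ∀ a' ∈ cut P B, D a = D a' →
      normalCone (cut P B) a ⊆ normalCone (cut P B) a' := by
    rintro a ha a' ha' hDD u ⟨hu0, hu⟩
    simp only [D, Prod.mk.injEq] at hDD
    refine ⟨hu0, ?_⟩
    have hcont : ∀ c c' : ℝ,
        Filter.Tendsto (fun e : ℝ => c + e * (c - c')) (nhdsWithin 0 (Set.Ioi 0)) (nhds c) := by
      intro c c'
      have : Continuous fun e : ℝ => c + e * (c - c') := by fun_prop
      have h2 := this.tendsto 0
      simp only [zero_mul, add_zero] at h2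
      exact h2.mono_left nhdsWithin_le_nhds
    have hpair : ∀ (e : ℝ) (w : Fin n → ℝ),
        pair (a + e • (a - a')) w = pair a w + e * (pair a w - pair a' w) := by
      intro e w
      have : a - a' = a + (-1 : ℝ) • a' := by simp [sub_eq_add_neg]
      rw [this, pair_add, pair_smul, pair_add, pair_smul]
      ring
    have hstep : ∀ c c' m : ℝ, m ≤ c → m ≤ c' → (m = c → m = c') →
        ∀ᶠ e : ℝ in nhdsWithin 0 (Set.Ioi 0), m ≤ c + e * (c - c') := by
      intro c c' m hc hc' himp
      rcases hc.eq_or_lt with h0 | h0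
      · filter_upwards with e
        rw [← h0, ← himp h0]; simp
      · filter_upwards [(hcont c c').eventually_const_lt h0] with e he using he.le
    have h1 : ∀ᶠ e : ℝ in nhdsWithin 0 (Set.Ioi 0), ∀ w ∈ keptNormals P B,
        supportFn P (toReal w) ≤ pair (a + e • (a - a')) (toReal w) := by
      rw [Filter.eventually_all_finite h]
      intro w hw
      simp only [hpair]
      refine hstep _ _ _ (ha.2 w hw) (ha'.2 w hw) fun he => ?_
      have : w ∈ {u | u ∈ keptNormals P B ∧ supportFn P (toReal u) = pair a (toReal u)} :=
        ⟨hw, he⟩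
      rw [hDD.1] at this
      exact this.2
    have h2 : ∀ᶠ e : ℝ in nhdsWithin 0 (Set.Ioi 0), ∀ i, 0 ≤ a i + e * (a i - a' i) := by
      rw [Filter.eventually_all]
      intro i
      refine hstep _ _ _ (ha.1 i) (ha'.1 i) fun he => ?_
      have : i ∈ Finset.univ.filter fun i => a i = 0 := by simp [← he]
      rw [hDD.2] at this
      simpa [eq_comm] using this
    obtain ⟨e, ⟨he1, he2⟩, he⟩ := ((h1.and h2).and self_mem_nhdsWithin).exists
    have hb : a + e • (a - a') ∈ cut P B := ⟨fun i => he2 i, he1⟩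
    have h3 := supportFn_le (fun _ hx => hx.1) hu0 hb
    have h4 := supportFn_le (fun _ hx => hx.1) hu0 ha'
    rw [hpair, hu] at h3
    rw [hu] at h4 ⊢
    have he' : (0 : ℝ) < e := he
    refine le_antisymm h4 ?_
    by_contra hlt
    push Not at hlt
    nlinarith
  have hfin : (D '' cut P B).Finite := by
    refine ((h.finite_subsets.prod (Set.finite_univ (α := Finset (Fin n))))).subset ?_
    rintro _ ⟨a, -, rfl⟩
    exact ⟨fun u hu => hu.1, Set.mem_univ _⟩
  have hg : ∀ a ∈ cut P B, ∀ a' ∈ cut P B, D a = D a' →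
      normalCone (cut P B) a = normalCone (cut P B) a' := fun a ha a' ha' he =>
    (hD a ha a' ha' he).antisymm (hD a' ha' a ha he.symm)
  refine (hfin.image fun d => if hd : ∃ a ∈ cut P B, D a = d then
    normalCone (cut P B) hd.choose else ∅).subset ?_
  rintro _ ⟨a, ha, rfl⟩
  refine ⟨D a, ⟨a, ha, rfl⟩, ?_⟩
  have hd : ∃ b ∈ cut P B, D b = D a := ⟨a, ha, rfl⟩
  simp only [hd, dite_true]
  exact hg _ hd.choose_spec.1 _ ha hd.choose_spec.2

instance ray_finite (f : MvPolynomial (Fin n) K) (B : Set (Set (Fin n → ℝ))) :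
    Finite (Ray (cut (newton f) B)) := by
  have := (cut_normalFan_finite _ B (keptNormals_finite f B)).to_subtype
  refine Finite.of_injective (β := normalFan (cut (newton f) B)) (fun ρ => ⟨_, ρ.2.2⟩) ?_
  intro ρ ρ' h
  exact Subtype.ext (rayOf_injective ρ.2.1 ρ'.2.1 (congrArg Subtype.val h))

noncomputable instance ray_fintype (f : MvPolynomial (Fin n) K) (B : Set (Set (Fin n → ℝ))) :
    Fintype (Ray (cut (newton f) B)) := Fintype.ofFinite _

end Finiteness

/-! ## Smoothness and transversality of hypersurfaces in an affine space -/

section Smooth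

variable {K : Type*} [Field K] {ι : Type*}

/-- The hypersurface `V(g)` in the affine space with coordinates indexed by `ι` is smooth over the
base field at the point `p`. The condition is empty if `p` is not on `V(g)`; otherwise the point
`q` of `V(g)` below is unique. -/
def SmoothAt (g : MvPolynomial ι K) (p : PrimeSpectrum (MvPolynomial ι K)) : Prop :=
  ∀ q : PrimeSpectrum (MvPolynomial ι K ⧸ Ideal.span {g}),
    q.comap (Ideal.Quotient.mk (Ideal.span {g})) = p →
      q ∈ Algebra.smoothLocus K (MvPolynomial ι K ⧸ Ideal.span {g})

/-- The class of `g ∈ p` in the cotangent space `m/m²` of the local ring at `p`. -/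
noncomputable def cotangentClass (p : PrimeSpectrum (MvPolynomial ι K)) (g : MvPolynomial ι K)
    (hg : g ∈ p.asIdeal) : IsLocalRing.CotangentSpace (Localization.AtPrime p.asIdeal) :=
  (IsLocalRing.maximalIdeal (Localization.AtPrime p.asIdeal)).toCotangent
    ⟨algebraMap _ _ g,
      (IsLocalization.AtPrime.to_map_mem_maximal_iff _ p.asIdeal g).mpr hg⟩

/-- Those of the hypersurfaces `V(g_j)` that pass through `p` intersect transversally there: the
classes of their equations in the cotangent space at `p` are linearly independent over the residue
field of `p`. -/
def TransverseAt {κ : Type*} (g : κ → MvPolynomial ι K)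
    (p : PrimeSpectrum (MvPolynomial ι K)) : Prop :=
  LinearIndependent (IsLocalRing.ResidueField (Localization.AtPrime p.asIdeal))
    (fun j : {j : κ // g j ∈ p.asIdeal} => cotangentClass p (g j) j.2)

end Smooth

section NonDegenerate

variable {n : ℕ} {K : Type*} [Field K]

/-- `f` is non-degenerate: for every compact face `F` of the Newton polyhedron, the closed subscheme
`V(f_F)` is non-singular in the torus. -/
def IsNondegenerate (f : MvPolynomial (Fin n) K) : Prop :=
  ∀ F, IsFace (newton f) F → IsCompact F →
    ∀ p : PrimeSpectrum (MvPolynomial (Fin n) K), (∀ i, X i ∉ p.asIdeal) →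
      SmoothAt (facePart f F) p

end NonDegenerate

/-! ## The stack `[X̂ / G]` of a fan (Cox construction), and the multi-weighted blow-up

A fan is given by the set `Σ` of its cones and by the primitive generators `u : ι → ℕⁿ` of its rays.
The stack is presented by the groupoid `G × X̂ ⇉ X̂`; its points are the points of the smooth atlas
`X̂` modulo this groupoid, and smoothness and transversality are checked on the atlas. -/

section Stack

variable {n : ℕ} {K : Type*} [Field K] {ι : Type} [Fintype ι]

/-- The ring map `x_i ↦ ∏_ρ (x'_ρ) ^ u_{ρ,i}` which induces the multi-weighted blow-up. -/
noncomputable def blowHom (K : Type*) [Field K] (u : ι → Fin n → ℕ) :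
    MvPolynomial (Fin n) K →ₐ[K] MvPolynomial ι K :=
  aeval fun i => ∏ ρ, X ρ ^ u ρ i

open Classical in
/-- The irrelevant ideal, generated by the monomials `x'_σ = ∏_{ρ ∉ σ[1]} x'_ρ` for the cones `σ` of
the fan. -/
noncomputable def irrelevant (K : Type*) [Field K] (S : Set (Set (Fin n → ℝ)))
    (u : ι → Fin n → ℕ) : Ideal (MvPolynomial ι K) :=
  Ideal.span {m | ∃ σ ∈ S, m = ∏ ρ ∈ Finset.univ.filter (fun ρ => toReal (u ρ) ∉ σ), X ρ}

/-- The dual `β^∨ : ℤⁿ → ℤ^ι` of the map `β` sending `e_ρ` to `u_ρ`. -/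
def betaDual (u : ι → Fin n → ℕ) : (Fin n → ℤ) →+ (ι → ℤ) where
  toFun m ρ := ∑ i, m i * (u ρ i : ℤ)
  map_zero' := by ext; simp
  map_add' := by intro a b; ext ρ; simp [add_mul, Finset.sum_add_distrib]

/-- The character group `Coker(β^∨)` of the diagonalizable group `G = G_β`. -/
abbrev CharGroup (u : ι → Fin n → ℕ) : Type := (ι → ℤ) ⧸ (betaDual u).range

open Classical in
/-- The class in `Coker(β^∨)` of the basis vector `e_ρ`: the weight of `x'_ρ`. -/
noncomputable def weight (u : ι → Fin n → ℕ) (ρ : ι) : CharGroup u :=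
  QuotientAddGroup.mk (Pi.single ρ 1)

/-- The action `G × 𝔸^ι → 𝔸^ι` on coordinate rings; `G × 𝔸^ι` is the spectrum of the group algebra
of the character group over the coordinate ring of `𝔸^ι`. -/
noncomputable def coaction (K : Type*) [Field K] (u : ι → Fin n → ℕ) :
    MvPolynomial ι K →ₐ[K] AddMonoidAlgebra (MvPolynomial ι K) (CharGroup u) :=
  aeval fun ρ => AddMonoidAlgebra.single (weight u ρ) (X ρ)

/-- The points of the atlas `X̂ = 𝔸^ι ∖ V(J)`. -/
def AtlasPoint (K : Type*) [Field K] (S : Set (Set (Fin n → ℝ))) (u : ι → Fin n → ℕ) : Type _ :=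
  {p : PrimeSpectrum (MvPolynomial ι K) // ¬ irrelevant K S u ≤ p.asIdeal}

/-- Two points of the atlas are identified if they are the projection and the action image of one
point of `G × X̂`. -/
def atlasRel (S : Set (Set (Fin n → ℝ))) (u : ι → Fin n → ℕ) (p q : AtlasPoint K S u) : Prop :=
  ∃ z : PrimeSpectrum (AddMonoidAlgebra (MvPolynomial ι K) (CharGroup u)),
    z.comap (algebraMap (MvPolynomial ι K) _) = p.1 ∧ z.comap (coaction K u).toRingHom = q.1

/-- The points of the quotient stack `[X̂ / G]`. -/
def StackPoint (K : Type*) [Field K] (S : Set (Set (Fin n → ℝ))) (u : ι → Fin n → ℕ) : Type _ :=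
  Quot (atlasRel (K := K) S u)

theorem coaction_blowHom (u : ι → Fin n → ℕ) (g : MvPolynomial (Fin n) K) :
    coaction K u (blowHom K u g) = algebraMap (MvPolynomial ι K) _ (blowHom K u g) := by
  have key : (coaction K u).comp (blowHom K u) =
      (IsScalarTower.toAlgHom K (MvPolynomial ι K)
        (AddMonoidAlgebra (MvPolynomial ι K) (CharGroup u))).comp (blowHom K u) := by
    apply MvPolynomial.algHom_ext
    intro i
    have hw : ∑ ρ, u ρ i • weight u ρ = 0 := by
      classical
      have : ∑ ρ, u ρ i • weight u ρ =
          QuotientAddGroup.mk' (betaDual u).range (∑ ρ, u ρ i • (Pi.single ρ 1 : ι → ℤ)) := by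
        rw [map_sum]
        refine Finset.sum_congr rfl fun ρ _ => ?_
        rw [map_nsmul]
        congr 1
      rw [this, QuotientAddGroup.mk'_apply, QuotientAddGroup.eq_zero_iff]
      refine ⟨Pi.single i 1, ?_⟩
      ext ρ
      simp [betaDual, Finset.sum_apply, Pi.single_apply]
    simp only [AlgHom.comp_apply, blowHom, aeval_X, map_prod, map_pow, coaction,
      AddMonoidAlgebra.single_pow, AddMonoidAlgebra.prod_single, hw]
    simp [AddMonoidAlgebra.coe_algebraMap, AddMonoidAlgebra.single_pow,
      AddMonoidAlgebra.prod_single]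
  exact DFunLike.congr_fun key g

/-- The multi-weighted blow-up `[X̂ / G] → 𝔸ⁿ` on points. -/
noncomputable def blowDown (K : Type*) [Field K] (S : Set (Set (Fin n → ℝ)))
    (u : ι → Fin n → ℕ) : StackPoint K S u → PrimeSpectrum (MvPolynomial (Fin n) K) :=
  Quot.lift (fun p => p.1.comap (blowHom K u).toRingHom) (by
    rintro p q ⟨z, hp, hq⟩
    rw [← hp, ← hq]
    ext g
    simp only [PrimeSpectrum.comap_asIdeal, Ideal.mem_comap]
    change algebraMap (MvPolynomial ι K) _ (blowHom K u g) ∈ _ ↔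
      coaction K u (blowHom K u g) ∈ _
    rw [coaction_blowHom])

/-- The origin of `𝔸ⁿ`. -/
noncomputable def origin (K : Type*) [Field K] (n : ℕ) :
    PrimeSpectrum (MvPolynomial (Fin n) K) :=
  ⟨RingHom.ker (constantCoeff : MvPolynomial (Fin n) K →+* K), RingHom.ker_isPrime _⟩

/-- `g` is a nonzero `G`-semi-invariant, so that `V(g)` is an effective Cartier divisor on the
stack. -/
def IsDivisorEq (u : ι → Fin n → ℕ) (g : MvPolynomial ι K) : Prop :=
  g ≠ 0 ∧ ∃ c : CharGroup u, coaction K u g = AddMonoidAlgebra.single c g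

/-- The divisor `V(g)` on the stack is smooth at the point `P`. -/
def StackSmoothAt {S : Set (Set (Fin n → ℝ))} {u : ι → Fin n → ℕ} (g : MvPolynomial ι K)
    (P : StackPoint K S u) : Prop :=
  ∀ p : AtlasPoint K S u, Quot.mk _ p = P → SmoothAt g p.1

/-- Those of the divisors `V(g_j)` on the stack that pass through `P` are transverse at `P`. -/
def StackTransverseAt {S : Set (Set (Fin n → ℝ))} {u : ι → Fin n → ℕ} {κ : Type*}
    (g : κ → MvPolynomial ι K) (P : StackPoint K S u) : Prop :=
  ∀ p : AtlasPoint K S u, Quot.mk _ p = P → TransverseAt g p.1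

/-- The divisor `F = 0` on the stack is a simple normal crossings divisor (with multiplicities) at
the point `P`: near `P` it is `∑ e_j V(g_j)` for divisors `V(g_j)` on the stack that are smooth and
meet transversally at `P`. -/
def IsSNCAt {S : Set (Set (Fin n → ℝ))} {u : ι → Fin n → ℕ} (F : MvPolynomial ι K)
    (P : StackPoint K S u) : Prop :=
  ∃ (κ : Type) (_ : Fintype κ) (g : κ → MvPolynomial ι K) (e : κ → ℕ),
    (∀ j, IsDivisorEq u (g j) ∧ 0 < e j ∧ StackSmoothAt (g j) P) ∧ StackTransverseAt g P ∧
      ∀ p : AtlasPoint K S u, Quot.mk _ p = P →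
        ∃ w : (Localization.AtPrime p.1.asIdeal)ˣ,
          algebraMap _ (Localization.AtPrime p.1.asIdeal) F =
            w * algebraMap _ (Localization.AtPrime p.1.asIdeal) (∏ j, g j ^ e j)

/-- The proper transform `f' = ∑_a c_a ∏_ρ (x'_ρ) ^ (a · u_ρ - N_ρ)`; the exponents are
nonnegative. -/
noncomputable def properTransform (u : ι → Fin n → ℕ) (f : MvPolynomial (Fin n) K) :
    MvPolynomial ι K :=
  ∑ a ∈ f.support, monomial
    (Finsupp.equivFunOnFinite.symm fun ρ => ∑ i, a i * u ρ i - ordAlong f (u ρ)) (coeff a f)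

end Stack

end BCut

/-!
The assertion is local on the atlas, an open set of affine space with one coordinate `x'_ρ` for each
ray `ρ` of the normal fan of the cut `Γ†`, so it suffices to find, at each point `p` of `V(f')` over
the origin, a partial derivative `∂_ρ f'` that does not vanish at `p` and for which `V(x'_ρ)` is not
one of the divisors through `p` with `N_ρ > 0`. Smoothness then follows from the Jacobian criterion
(`smoothAt_of_pderiv_notMem`), and transversality because a linear relation in the cotangent space is
one between partial derivatives (`transverseAt_option_elim`).

Let `I` be the set of generators `u_ρ` of the rays with `x'_ρ(p) = 0`. They are normal vectors of
facets that are kept (`Ray.gen_mem_keptNormals`), they are tight at a common point `a` of the cut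
because `p` lies outside the irrelevant locus (`AtlasPoint.exists_tight`), and their sum has positive
coordinates because `p` lies over the origin. By `tight_dichotomy` there are two cases.

* The elements of `I` are tight at a common point of the Newton polyhedron `Γ`. The points of `Γ`
  where they are tight form a compact face, the first meet locus of their sum. Modulo the coordinates
  vanishing at `p`, the proper transform is, up to a unit, the pull-back of the face polynomial. The
  coordinate vectors are among the generators of the rays, so the Euler derivations `x_i ∂_i` of the
  face polynomial are restrictions of `x'_ρ ∂_ρ`, and non-degeneracy yields a derivative with
  `x'_ρ(p) ≠ 0` (`exists_pderiv_notMem_of_face`).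

* Otherwise `a` lies outside `Γ`, and all facets of `Γ` it violates are in `𝔅`. The facets visible
  from `a` are connected through adjacency (`visible_induction`). A facet adjacent to a `B₁`-facet
  contains its apex, unless it is the coordinate hyperplane of its base direction
  (`IsB1With.adjacent`); as adjacent facets in `𝔅` have the same base direction, all visible facets
  are pyramids with the same apex `s` and base direction `i` (`cut_violating`). This forces `a_i = 0`,
  `e_i ∈ I` with `N_{e_i} = 0`, and the tightness of the other elements of `I` at `s`, while no other
  exponent `t` of `f` with `t_i ≤ 1` has the last property. Hence the monomial of `s` is the only one
  that contributes to the derivative of `f'` in the direction of the ray of `e_i` at `p`, and it is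
  linear in that coordinate (`pderiv_notMem_of_apex`).
-/

namespace BCut

open MvPolynomial

/-! ### The Jacobian criterion for hypersurfaces in affine space -/

section Jacobian

variable {K : Type*} [Field K] {ι : Type*}

/-- First-order Taylor expansion along increments whose pairwise products vanish. -/
theorem aeval_add_of_mul_eq_zero [Fintype ι] {C : Type*} [CommRing C] [Algebra K C] (c h : ι → C)
    (hh : ∀ i j, h i * h j = 0) (g : MvPolynomial ι K) :
    aeval (c + h) g = aeval c g + ∑ i, aeval c (pderiv i g) * h i := by
  classical
  induction g using MvPolynomial.induction_on with
  | C a => simp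
  | add p q hp hq =>
    rw [map_add, hp, hq]
    simp only [map_add, add_mul, Finset.sum_add_distrib]
    ring
  | mul_X p j hp =>
    have h0 : (∑ i, aeval c (pderiv i p) * h i) * h j = 0 := by
      rw [Finset.sum_mul]
      exact Finset.sum_eq_zero fun i _ => by rw [mul_assoc, hh, mul_zero]
    have h1 : ∑ i, aeval c (pderiv i (p * X j)) * h i =
        aeval c p * h j + (∑ i, aeval c (pderiv i p) * h i) * c j := by
      simp only [Derivation.leibniz, pderiv_X, smul_eq_mul, map_add, map_mul, aeval_X, add_mul,
        Finset.sum_add_distrib, Finset.sum_mul]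
      congr 1
      · rw [Finset.sum_eq_single j] <;> simp +contextual [eq_comm]
      · exact Finset.sum_congr rfl fun i _ => by ring
    rw [map_mul, hp, h1, map_mul, aeval_X, aeval_X, Pi.add_apply]
    linear_combination h0

/-- A hypersurface is smooth at a point where some partial derivative of its equation does not
vanish: a lift of the coordinates to a square-zero thickening can be corrected by Newton's
method in the direction of that derivative. -/
theorem smoothAt_of_pderiv_notMem [Fintype ι] {g : MvPolynomial ι K}
    {p : PrimeSpectrum (MvPolynomial ι K)} {i : ι} (hi : pderiv i g ∉ p.asIdeal) :
    SmoothAt g p := by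
  classical
  rintro q rfl
  change Algebra.FormallySmooth K (Localization.AtPrime q.asIdeal)
  refine Algebra.FormallySmooth.of_comp_surjective fun D _ _ I hI φ => ?_
  let π : MvPolynomial ι K →ₐ[K] Localization.AtPrime q.asIdeal :=
    (IsScalarTower.toAlgHom K (MvPolynomial ι K ⧸ Ideal.span {g}) _).comp (Ideal.Quotient.mkₐ K (Ideal.span {g}))
  choose c hc using fun j => Ideal.Quotient.mk_surjective (I := I) (φ (π (X j)))
  have hlift : ∀ c' : ι → D, (∀ j, Ideal.Quotient.mk I (c' j) = φ (π (X j))) →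
      ∀ a : MvPolynomial ι K, Ideal.Quotient.mk I (aeval c' a) = φ (π a) := by
    intro c' hc' a
    have : (Ideal.Quotient.mkₐ K I).comp (aeval c') = φ.comp π :=
      MvPolynomial.algHom_ext fun j => by simpa using hc' j
    exact DFunLike.congr_fun this a
  have hunit : ∀ c' : ι → D, (∀ j, Ideal.Quotient.mk I (c' j) = φ (π (X j))) →
      ∀ a : MvPolynomial ι K, Ideal.Quotient.mk _ a ∉ q.asIdeal → IsUnit (aeval c' a) := by
    intro c' hc' a ha
    refine (IsNilpotent.isUnit_quotient_mk_iff (I := I) ⟨2, hI⟩).mp ?_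
    rw [hlift c' hc']
    exact (IsLocalization.map_units (Localization.AtPrime q.asIdeal)
      (⟨_, ha⟩ : q.asIdeal.primeCompl)).map φ
  have hsq : ∀ x ∈ I, ∀ y ∈ I, x * y = 0 := fun x hx y hy => by
    have : x * y ∈ I ^ 2 := by rw [pow_two]; exact Ideal.mul_mem_mul hx hy
    rwa [hI] at this
  obtain ⟨d, hd⟩ := hunit c hc _ hi
  have hgI : aeval c g ∈ I := by
    rw [← Ideal.Quotient.eq_zero_iff_mem, hlift c hc]
    have : π g = 0 := by
      change algebraMap (MvPolynomial ι K ⧸ Ideal.span {g}) _ (Ideal.Quotient.mk _ g) = 0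
      rw [Ideal.Quotient.eq_zero_iff_mem.2 (Ideal.mem_span_singleton_self g), map_zero]
    rw [this, map_zero]
  -- the Newton step, exact because `I ^ 2 = 0`
  let h : ι → D := Pi.single i (-(↑d⁻¹ * aeval c g))
  have hhI : ∀ j, h j ∈ I := by
    intro j
    by_cases hj : j = i
    · subst hj; simpa only [h, Pi.single_eq_same] using I.neg_mem (I.mul_mem_left _ hgI)
    · simp [h, hj]
  have hc' : ∀ j, Ideal.Quotient.mk I ((c + h) j) = φ (π (X j)) := by
    intro j
    rw [Pi.add_apply, map_add, hc, Ideal.Quotient.eq_zero_iff_mem.2 (hhI j), add_zero]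
  have hg0 : aeval (c + h) g = 0 := by
    rw [aeval_add_of_mul_eq_zero c h fun j k => hsq _ (hhI j) _ (hhI k),
      Finset.sum_eq_single i (fun j _ hj => by simp [h, hj]) (by simp), ← hd]
    simp [h]
  let ψ₀ : (MvPolynomial ι K ⧸ Ideal.span {g}) →ₐ[K] D := Ideal.Quotient.liftₐ (Ideal.span {g}) (aeval (c + h)) (by
    intro a ha
    obtain ⟨b, rfl⟩ := Ideal.mem_span_singleton'.1 ha
    rw [map_mul, hg0, mul_zero])
  have hψ₀ : ∀ a : MvPolynomial ι K, ψ₀ (Ideal.Quotient.mk _ a) = aeval (c + h) a := fun a => rfl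
  let ψ : Localization.AtPrime q.asIdeal →ₐ[K] D :=
    IsLocalization.liftAlgHom (M := q.asIdeal.primeCompl) (f := ψ₀) (by
      rintro ⟨y, hy⟩
      obtain ⟨a, rfl⟩ := Ideal.Quotient.mk_surjective y
      rw [hψ₀]
      exact hunit _ hc' _ hy)
  refine ⟨ψ, ?_⟩
  refine IsLocalization.algHom_ext q.asIdeal.primeCompl ?_
  ext a
  obtain ⟨a, rfl⟩ := Ideal.Quotient.mk_surjective a
  have h1 : ψ (algebraMap (MvPolynomial ι K ⧸ Ideal.span {g}) _ (Ideal.Quotient.mk _ a)) = aeval (c + h) a :=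
    (IsLocalization.lift_eq _ _).trans (hψ₀ a)
  change Ideal.Quotient.mk I (ψ (algebraMap (MvPolynomial ι K ⧸ Ideal.span {g}) _ (Ideal.Quotient.mk _ a))) = φ (π a)
  rw [h1, hlift _ hc']

/-- At a smooth point of a hypersurface `V(g)`, a homomorphism to a square-zero thickening which maps
`V(g)` into the closed subscheme can be corrected so as to map `V(g)` into the thickening. -/
theorem exists_increment_of_smoothAt [Fintype ι] {g : MvPolynomial ι K}
    {p : PrimeSpectrum (MvPolynomial ι K)} (hgp : g ∈ p.asIdeal) (hs : SmoothAt g p)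
    {D : Type*} [CommRing D] [Algebra K D] {I : Ideal D} (hI : I ^ 2 = ⊥)
    (τ : MvPolynomial ι K →ₐ[K] D) (hτg : τ g ∈ I) (hτp : ∀ a ∉ p.asIdeal, IsUnit (τ a)) :
    ∃ h : ι → D, (∀ i, h i ∈ I) ∧ τ g + ∑ i, τ (pderiv i g) * h i = 0 := by
  have hker : RingHom.ker (Ideal.Quotient.mk (Ideal.span {g})) ≤ p.asIdeal := by
    rw [Ideal.mk_ker, Ideal.span_singleton_le_iff_mem]; exact hgp
  have hprime : (p.asIdeal.map (Ideal.Quotient.mk (Ideal.span {g}))).IsPrime :=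
    Ideal.map_isPrime_of_surjective Ideal.Quotient.mk_surjective hker
  let q : PrimeSpectrum (MvPolynomial ι K ⧸ Ideal.span {g}) := ⟨_, hprime⟩
  have hq : q.comap (Ideal.Quotient.mk (Ideal.span {g})) = p := by
    ext1
    change Ideal.comap _ (Ideal.map _ _) = _
    rw [Ideal.comap_map_of_surjective' _ Ideal.Quotient.mk_surjective, sup_eq_left]
    exact hker
  have hmemq : ∀ a, Ideal.Quotient.mk (Ideal.span {g}) a ∈ q.asIdeal ↔ a ∈ p.asIdeal := by
    intro a
    rw [← hq]; rfl
  have hsm : Algebra.FormallySmooth K (Localization.AtPrime q.asIdeal) := hs q hq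
  let φ₀ : (MvPolynomial ι K ⧸ Ideal.span {g}) →ₐ[K] D ⧸ I := Ideal.Quotient.liftₐ (Ideal.span {g})
    ((Ideal.Quotient.mkₐ K I).comp τ) (by
      intro a ha
      obtain ⟨b, rfl⟩ := Ideal.mem_span_singleton'.1 ha
      rw [map_mul]
      have : ((Ideal.Quotient.mkₐ K I).comp τ) g = 0 := Ideal.Quotient.eq_zero_iff_mem.2 hτg
      rw [this, mul_zero])
  have hφ₀ : ∀ a, φ₀ (Ideal.Quotient.mk _ a) = Ideal.Quotient.mk I (τ a) := fun a => rfl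
  let φ : Localization.AtPrime q.asIdeal →ₐ[K] D ⧸ I :=
    IsLocalization.liftAlgHom (M := q.asIdeal.primeCompl) (f := φ₀) (by
      rintro ⟨y, hy⟩
      obtain ⟨a, rfl⟩ := Ideal.Quotient.mk_surjective y
      rw [hφ₀]
      exact (hτp a fun h => hy ((hmemq a).2 h)).map (Ideal.Quotient.mk I))
  obtain ⟨ψ, hψ⟩ := Algebra.FormallySmooth.comp_surjective K (Localization.AtPrime q.asIdeal) I hI φ
  let π : MvPolynomial ι K →ₐ[K] Localization.AtPrime q.asIdeal :=
    (IsScalarTower.toAlgHom K (MvPolynomial ι K ⧸ Ideal.span {g}) _).comp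
      (Ideal.Quotient.mkₐ K (Ideal.span {g}))
  have hψπ : ∀ a, Ideal.Quotient.mk I (ψ (π a)) = Ideal.Quotient.mk I (τ a) := by
    intro a
    have h1 := DFunLike.congr_fun hψ (π a)
    have h2 : φ (π a) = φ₀ (Ideal.Quotient.mk _ a) := IsLocalization.lift_eq _ _
    exact (h1.trans h2).trans (hφ₀ a)
  have hh : ∀ j, ψ (π (X j)) - τ (X j) ∈ I := fun j => Ideal.Quotient.eq.1 (hψπ (X j))
  refine ⟨fun j => ψ (π (X j)) - τ (X j), hh, ?_⟩
  have hτ : ∀ a, aeval (fun j => τ (X j)) a = τ a := fun a =>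
    DFunLike.congr_fun (MvPolynomial.aeval_unique τ).symm a
  have hψX : ψ.comp π = aeval ((fun j => τ (X j)) + fun j => ψ (π (X j)) - τ (X j)) :=
    MvPolynomial.algHom_ext fun j => by simp
  have hπg : π g = 0 := by
    change algebraMap (MvPolynomial ι K ⧸ Ideal.span {g}) _ (Ideal.Quotient.mk _ g) = 0
    rw [Ideal.Quotient.eq_zero_iff_mem.2 (Ideal.mem_span_singleton_self g), map_zero]
  have hg0 : aeval ((fun j => τ (X j)) + fun j => ψ (π (X j)) - τ (X j)) g = 0 := by
    rw [← hψX, AlgHom.comp_apply, hπg, map_zero]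
  rw [aeval_add_of_mul_eq_zero _ _ fun i j => ?_] at hg0
  · simpa only [hτ] using hg0
  · have : (ψ (π (X i)) - τ (X i)) * (ψ (π (X j)) - τ (X j)) ∈ I ^ 2 := by
      rw [pow_two]; exact Ideal.mul_mem_mul (hh i) (hh j)
    rwa [hI] at this

/-- In a local ring, a non-unit whose product with a unit is a multiple of its square is zero. -/
theorem eq_zero_of_sq_dvd_mul {R : Type*} [CommRing R] [IsLocalRing R] {x m : R}
    (hx : x ∈ IsLocalRing.maximalIdeal R) (hm : m ∈ IsLocalRing.maximalIdeal R)
    (h : x ^ 2 ∣ x * (1 + m)) : x = 0 := by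
  obtain ⟨y, hy⟩ := h
  have hu : IsUnit (1 + (m - x * y)) := by
    by_contra hn
    have := Ideal.sub_mem _ ((IsLocalRing.mem_maximalIdeal _).2 hn)
      (Ideal.sub_mem _ hm (Ideal.mul_mem_right y _ hx))
    rw [add_sub_cancel_right] at this
    exact (IsLocalRing.maximalIdeal.isMaximal _).ne_top ((Ideal.eq_top_iff_one _).2 this)
  have h3 : x * (1 + (m - x * y)) = 0 := by linear_combination hy
  rwa [hu.mul_left_eq_zero] at h3

/-- At a smooth point of a hypersurface `V(g)` where all partial derivatives of `g` vanish, `g` is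
zero in the local ring: lifting the identity to the first infinitesimal neighbourhood of `V(g)`
shows that `g` is a multiple of its square. -/
theorem map_eq_zero_of_smoothAt [Fintype ι] {g : MvPolynomial ι K}
    {p : PrimeSpectrum (MvPolynomial ι K)} (hgp : g ∈ p.asIdeal) (hs : SmoothAt g p)
    (hall : ∀ i, pderiv i g ∈ p.asIdeal) {R : Type*} [CommRing R] [IsLocalRing R] [Algebra K R]
    (φ : MvPolynomial ι K →ₐ[K] R) (hφ : ∀ a ∈ p.asIdeal, φ a ∈ IsLocalRing.maximalIdeal R)
    (hφ' : ∀ a ∉ p.asIdeal, IsUnit (φ a)) : φ g = 0 := by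
  let mk := Ideal.Quotient.mkₐ K (Ideal.span {φ g ^ 2})
  obtain ⟨h, hh, h1⟩ := exists_increment_of_smoothAt hgp hs (I := Ideal.span {mk (φ g)})
    (by
      rw [Ideal.span_singleton_pow, Ideal.span_singleton_eq_bot]
      refine (map_pow mk (φ g) 2).symm.trans ?_
      exact Ideal.Quotient.eq_zero_iff_mem.2 (Ideal.mem_span_singleton_self _))
    (mk.comp φ) (Ideal.mem_span_singleton_self _) (fun a ha => (hφ' a ha).map mk)
  have he : ∀ i, ∃ e, h i = mk (φ g * e) := by
    intro i
    obtain ⟨e, he⟩ := Ideal.mem_span_singleton.1 (hh i)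
    obtain ⟨e, rfl⟩ := Ideal.Quotient.mk_surjective e
    exact ⟨e, he.trans (map_mul mk (φ g) e).symm⟩
  choose e he using he
  have h2 : mk (φ g * (1 + ∑ i, φ (pderiv i g) * e i)) = 0 := by
    rw [← h1, mul_add, map_add, mul_one, Finset.mul_sum, map_sum]
    congr 1
    refine Finset.sum_congr rfl fun i _ => ?_
    rw [he, AlgHom.comp_apply, ← map_mul]
    congr 1
    ring
  have h3 : φ g ^ 2 ∣ φ g * (1 + ∑ i, φ (pderiv i g) * e i) :=
    Ideal.mem_span_singleton.1 (Ideal.Quotient.eq_zero_iff_mem.1 h2)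
  exact eq_zero_of_sq_dvd_mul (hφ g hgp)
    (Ideal.sum_mem _ fun i _ => Ideal.mul_mem_right _ _ (hφ _ (hall i))) h3

/-- The Jacobian criterion at a smooth point of a hypersurface. -/
theorem exists_pderiv_notMem_of_smoothAt [Fintype ι] {g : MvPolynomial ι K} (hg : g ≠ 0)
    {p : PrimeSpectrum (MvPolynomial ι K)} (hgp : g ∈ p.asIdeal) (hs : SmoothAt g p) :
    ∃ i, pderiv i g ∉ p.asIdeal := by
  by_contra! hall
  have h := map_eq_zero_of_smoothAt hgp hs hall
    (IsScalarTower.toAlgHom K (MvPolynomial ι K) (Localization.AtPrime p.asIdeal))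
    (fun a ha => (IsLocalization.AtPrime.to_map_mem_maximal_iff _ p.asIdeal a).mpr ha)
    (fun a ha => IsLocalization.map_units (Localization.AtPrime p.asIdeal)
        (⟨a, ha⟩ : p.asIdeal.primeCompl))
  exact hg ((IsLocalization.to_map_eq_zero_iff _
    (Ideal.primeCompl_le_nonZeroDivisors p.asIdeal)).1 h)

end Jacobian

/-! ### Transversality from partial derivatives -/

section Transverse

variable {K : Type*} [Field K] {ι : Type*}

open IsLocalRing in
/-- A linear relation between the classes in the cotangent space at `p` of functions vanishing at
`p` is a linear relation between the values at `p` of their partial derivatives: the point `p` moved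
by a first-order increment in the direction `i` is a point with values in the dual numbers over the
residue field. -/
theorem sum_mul_residue_pderiv_eq_zero [Fintype ι] {κ : Type*} {g : κ → MvPolynomial ι K}
    {p : PrimeSpectrum (MvPolynomial ι K)} (s : Finset {j : κ // g j ∈ p.asIdeal})
    (c : {j : κ // g j ∈ p.asIdeal} → ResidueField (Localization.AtPrime p.asIdeal))
    (h : ∑ j ∈ s, c j • cotangentClass p (g j) j.2 = 0) (i : ι) :
    ∑ j ∈ s, c j * residue _ (algebraMap _ (Localization.AtPrime p.asIdeal) (pderiv i (g j))) =
      0 := by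
  classical
  let F := ResidueField (Localization.AtPrime p.asIdeal)
  let res : MvPolynomial ι K →ₐ[K] F :=
    IsScalarTower.toAlgHom K (MvPolynomial ι K) F
  have hres : ∀ a, res a = residue _ (algebraMap _ (Localization.AtPrime p.asIdeal) a) :=
    fun a => rfl
  let inl : F →ₐ[K] DualNumber F := TrivSqZeroExt.inlAlgHom K F F
  let x : ι → DualNumber F := fun j => inl (res (X j))
  let e : ι → DualNumber F := Pi.single i DualNumber.eps
  have he : ∀ j k, e j * e k = 0 := by
    intro j k
    by_cases hj : j = i
    · by_cases hk : k = i
      · subst hj; subst hk; simp [e]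
      · simp [e, hk]
    · simp [e, hj]
  have hx : ∀ a, aeval x a = inl (res a) := fun a =>
    DFunLike.congr_fun (MvPolynomial.aeval_unique (inl.comp res)).symm a
  have hT : ∀ a, aeval (x + e) a = inl (res a) + inl (res (pderiv i a)) * DualNumber.eps := by
    intro a
    rw [aeval_add_of_mul_eq_zero x e he, hx, Finset.sum_eq_single i (fun j _ hj => by simp [e, hj])
      (by simp), hx]
    simp [e]
  have hfst : ∀ a, TrivSqZeroExt.fst (aeval (x + e) a) = res a := by
    intro a; rw [hT]; simp [inl]
  have hsnd : ∀ a, TrivSqZeroExt.snd (aeval (x + e) a) = res (pderiv i a) := by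
    intro a; rw [hT]; simp [inl]
  have hu : ∀ y : p.asIdeal.primeCompl, IsUnit ((aeval (x + e) : MvPolynomial ι K →ₐ[K] _) y) := by
    intro y
    rw [TrivSqZeroExt.isUnit_iff_isUnit_fst, hfst, hres]
    exact (IsLocalization.map_units (Localization.AtPrime p.asIdeal) y).map _
  let Φ : Localization.AtPrime p.asIdeal →+* DualNumber F :=
    IsLocalization.lift (M := p.asIdeal.primeCompl)
      (g := (aeval (x + e) : MvPolynomial ι K →ₐ[K] DualNumber F).toRingHom) hu
  have hΦ : ∀ a, Φ (algebraMap _ _ a) = aeval (x + e) a := fun a => IsLocalization.lift_eq _ a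
  have hΦfst : ∀ r, TrivSqZeroExt.fst (Φ r) = residue _ r := by
    have : (TrivSqZeroExt.fstHom K F F).toRingHom.comp Φ = residue _ := by
      refine IsLocalization.ringHom_ext p.asIdeal.primeCompl ?_
      refine RingHom.ext fun a => ?_
      change TrivSqZeroExt.fst (Φ (algebraMap _ _ a)) = _
      rw [hΦ]
      exact hfst a
    exact fun r => DFunLike.congr_fun this r
  have hm0 : ∀ r ∈ maximalIdeal (Localization.AtPrime p.asIdeal),
      TrivSqZeroExt.fst (Φ r) = 0 := fun r hr => by
    rw [hΦfst]; exact (residue_eq_zero_iff r).2 hr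
  have hm2 : ∀ r ∈ (maximalIdeal (Localization.AtPrime p.asIdeal)) ^ 2, Φ r = 0 := by
    intro r hr
    rw [pow_two] at hr
    refine Submodule.mul_induction_on hr (fun a ha b hb => ?_) (fun a b ha hb => ?_)
    · rw [map_mul]
      ext
      · simp [hm0 a ha]
      · simp [hm0 a ha, hm0 b hb]
    · rw [map_add, ha, hb, add_zero]
  choose r hr using fun j => residue_surjective (R := Localization.AtPrime p.asIdeal) (c j)
  have h1 : (maximalIdeal (Localization.AtPrime p.asIdeal)).toCotangent
      (∑ j ∈ s, r j • ⟨algebraMap _ _ (g j),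
        (IsLocalization.AtPrime.to_map_mem_maximal_iff _ p.asIdeal (g j)).mpr j.2⟩) = 0 := by
    rw [map_sum, ← h]
    refine Finset.sum_congr rfl fun j _ => ?_
    rw [map_smul, ← hr]
    rfl
  rw [Ideal.toCotangent_eq_zero] at h1
  have h2 := congrArg TrivSqZeroExt.snd (hm2 _ h1)
  simp only [Submodule.coe_sum, Submodule.coe_smul, smul_eq_mul, map_sum, map_mul, hΦ,
    TrivSqZeroExt.snd_sum, TrivSqZeroExt.snd_mul, hsnd, hfst, hΦfst, hr,
    TrivSqZeroExt.snd_zero] at h2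
  rw [← h2]
  refine Finset.sum_congr rfl fun j _ => ?_
  have : res (g j) = 0 := by
    rw [hres, residue_eq_zero_iff]
    exact (IsLocalization.AtPrime.to_map_mem_maximal_iff _ p.asIdeal (g j)).mpr j.2
  rw [this, ← hres]
  simp

/-- A hypersurface `V(g)` is transverse to coordinate hyperplanes `x_ρ = 0` if some partial
derivative of `g` in a direction other than these `ρ` does not vanish. -/
theorem transverseAt_option_elim [Fintype ι] {g : MvPolynomial ι K}
    {p : PrimeSpectrum (MvPolynomial ι K)} {Q : ι → Prop}
    (h : g ∈ p.asIdeal → ∃ i, pderiv i g ∉ p.asIdeal ∧ (X i ∈ p.asIdeal → ¬ Q i)) :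
    TransverseAt (fun j : Option {i // Q i} => j.elim g fun i => X i.1) p := by
  classical
  have hres : ∀ a, IsLocalRing.residue _ (algebraMap _ (Localization.AtPrime p.asIdeal) a) = 0 ↔
      a ∈ p.asIdeal := fun a => by
    rw [IsLocalRing.residue_eq_zero_iff]
    exact IsLocalization.AtPrime.to_map_mem_maximal_iff _ p.asIdeal a
  refine linearIndependent_iff'.2 fun s c hc => ?_
  have key := sum_mul_residue_pderiv_eq_zero s c hc
  have hnone : ∀ hn, ⟨none, hn⟩ ∈ s → c ⟨none, hn⟩ = 0 := by
    intro hn hs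
    obtain ⟨i, hi, hi'⟩ := h hn
    have hk := key i
    rw [Finset.sum_eq_single ⟨none, hn⟩] at hk
    · exact (mul_eq_zero.1 hk).resolve_right fun h0 => hi ((hres _).1 h0)
    · rintro ⟨_ | ρ, hj⟩ - hne
      · exact absurd rfl hne
      · have hρ : i ≠ ρ.1 := by
          rintro rfl
          exact hi' hj ρ.2
        have : pderiv i (X ρ.1 : MvPolynomial ι K) = 0 := pderiv_X_of_ne hρ.symm
        simp [this]
    · exact fun h => absurd hs h
  rintro ⟨_ | ρ, hj⟩ hjs
  · exact hnone hj hjs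
  · have hk := key ρ.1
    rw [Finset.sum_eq_single ⟨some ρ, hj⟩] at hk
    · simpa using hk
    · rintro ⟨_ | ρ', hj'⟩ hs' hne
      · rw [hnone hj' hs', zero_mul]
      · have hρ : ρ'.1 ≠ ρ.1 := by
          intro h
          apply hne
          congr 2
          exact Subtype.ext h
        have : pderiv ρ.1 (X ρ'.1 : MvPolynomial ι K) = 0 := pderiv_X_of_ne hρ
        simp [this]
    · exact fun h => absurd hjs h

theorem smoothAt_X [Fintype ι] (i : ι) (p : PrimeSpectrum (MvPolynomial ι K)) :
    SmoothAt (X i) p := by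
  refine smoothAt_of_pderiv_notMem (i := i) ?_
  rw [pderiv_X_self]
  exact fun h => p.2.ne_top ((Ideal.eq_top_iff_one _).2 h)

end Transverse

/-! ### Newton polyhedra: vertices, supporting functionals, faces -/

section NewtonBasics

variable {n : ℕ}

/-- The pairing with `u` as a linear form. -/
def pairL (u : Fin n → ℝ) : (Fin n → ℝ) →ₗ[ℝ] ℝ where
  toFun a := pair a u
  map_add' a b := pair_add a b u
  map_smul' t a := pair_smul t a u

@[simp] theorem pairL_apply (u a : Fin n → ℝ) : pairL u a = pair a u := rfl

theorem pair_comm (a u : Fin n → ℝ) : pair a u = pair u a := by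
  simp [pair, mul_comm]

theorem pair_sub (a b u : Fin n → ℝ) : pair (a - b) u = pair a u - pair b u :=
  map_sub (pairL u) a b

theorem pair_sum {κ : Type*} (s : Finset κ) (a : κ → Fin n → ℝ) (u : Fin n → ℝ) :
    pair (∑ j ∈ s, a j) u = ∑ j ∈ s, pair (a j) u :=
  map_sum (pairL u) a s

theorem pair_sum_right {κ : Type*} (s : Finset κ) (a : Fin n → ℝ) (u : κ → Fin n → ℝ) :
    pair a (∑ j ∈ s, u j) = ∑ j ∈ s, pair a (u j) := by
  simp only [pair_comm a, pair_sum]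

theorem pair_add_right (a u v : Fin n → ℝ) : pair a (u + v) = pair a u + pair a v := by
  simp only [pair_comm a, pair_add]

theorem pair_smul_right (t : ℝ) (a u : Fin n → ℝ) : pair a (t • u) = t * pair a u := by
  simp only [pair_comm a, pair_smul]

theorem pair_nonneg {a u : Fin n → ℝ} (ha : 0 ≤ a) (hu : 0 ≤ u) : 0 ≤ pair a u :=
  Finset.sum_nonneg fun i _ => mul_nonneg (ha i) (hu i)

theorem pair_single_right (a : Fin n → ℝ) (i : Fin n) : pair a (Pi.single i 1) = a i := by
  rw [pair_comm, pair_single]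

theorem toReal_single (i : Fin n) : toReal (Pi.single i 1) = Pi.single i 1 := by
  ext j; by_cases h : j = i
  · subst h; simp [toReal]
  · simp [toReal, h]

theorem pair_toReal (a u : Fin n → ℕ) : pair (toReal a) (toReal u) = ((∑ i, a i * u i : ℕ) : ℝ) := by
  simp [pair, toReal]

/-- The convex hull of the union of the orthants `s + ℝ^n_{≥0}`, `s ∈ S`. -/
def upHull (S : Finset (Fin n →₀ ℕ)) : Set (Fin n → ℝ) :=
  {a | ∃ c : (Fin n →₀ ℕ) → ℝ, (∀ s ∈ S, 0 ≤ c s) ∧ ∑ s ∈ S, c s = 1 ∧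
    ∑ s ∈ S, c s • toReal s ≤ a}

theorem upHull_subset {S : Finset (Fin n →₀ ℕ)} {A : Set (Fin n → ℝ)} (hA : Convex ℝ A)
    (hup : ∀ a ∈ A, ∀ b, a ≤ b → b ∈ A) (hS : ∀ s ∈ S, toReal s ∈ A) : upHull S ⊆ A := by
  rintro a ⟨c, hc0, hc1, hc⟩
  exact hup _ (hA.sum_mem hc0 hc1 hS) _ hc

theorem convex_upHull (S : Finset (Fin n →₀ ℕ)) : Convex ℝ (upHull S) := by
  rintro a ⟨c, hc0, hc1, hc⟩ b ⟨d, hd0, hd1, hd⟩ x y hx hy hxy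
  refine ⟨fun s => x * c s + y * d s, fun s hs => by
    have := hc0 s hs; have := hd0 s hs; positivity, ?_, ?_⟩
  · rw [Finset.sum_add_distrib, ← Finset.mul_sum, ← Finset.mul_sum, hc1, hd1]; simpa using hxy
  · simp only [add_smul, mul_smul, Finset.sum_add_distrib, ← Finset.smul_sum]
    exact add_le_add (smul_le_smul_of_nonneg_left hc hx) (smul_le_smul_of_nonneg_left hd hy)

theorem upHull_mono_right {S : Finset (Fin n →₀ ℕ)} {a b : Fin n → ℝ} (ha : a ∈ upHull S)
    (hab : a ≤ b) : b ∈ upHull S := by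
  obtain ⟨c, hc0, hc1, hc⟩ := ha
  exact ⟨c, hc0, hc1, hc.trans hab⟩

theorem mem_upHull {S : Finset (Fin n →₀ ℕ)} {s : Fin n →₀ ℕ} (hs : s ∈ S) :
    toReal s ∈ upHull S := by
  classical
  refine ⟨Pi.single s 1, fun t _ => ?_, ?_, ?_⟩
  · by_cases h : t = s <;> simp [h]
  · simp [hs]
  · rw [Finset.sum_eq_single s (fun t _ ht => by simp [ht]) (fun h => absurd hs h)]
    simp

/-- Every point `s` of a minimal generating set of an upper polyhedron is one of its vertices: in a
segment through `s` with endpoints in the polyhedron, the generator `s` has total weight `1`, since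
it would otherwise be redundant. -/
theorem exists_upHull_eq_extreme (S : Finset (Fin n →₀ ℕ)) :
    ∃ T ⊆ S, upHull T = upHull S ∧ ∀ s ∈ T, toReal s ∈ (upHull S).extremePoints ℝ := by
  classical
  obtain ⟨T, ⟨hTS, hT⟩, hmin⟩ := Finset.exists_minimal
    (s := S.powerset.filter fun T => upHull T = upHull S) ⟨S, by simp⟩ |>.imp fun T h => by
      simpa [Minimal] using h
  refine ⟨T, hTS, hT, fun s hs => ?_⟩
  rw [← hT] at hmin ⊢
  have hred : toReal s ∉ upHull (T.erase s) := by
    intro hmem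
    have heq : upHull (T.erase s) = upHull T := by
      refine Set.Subset.antisymm ?_ ?_
      · exact upHull_subset (convex_upHull _) (fun a ha b hab => upHull_mono_right ha hab)
          fun t ht => mem_upHull (Finset.mem_of_mem_erase ht)
      · refine upHull_subset (convex_upHull _) (fun a ha b hab => upHull_mono_right ha hab)
          fun t ht => ?_
        by_cases h : t = s
        · rwa [h]
        · exact mem_upHull (Finset.mem_erase.2 ⟨h, ht⟩)
    have := hmin ((Finset.erase_subset s T).trans hTS) heq (Finset.erase_subset _ _) hs
    simp at this
  refine mem_extremePoints.2 ⟨mem_upHull hs, ?_⟩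
  rintro x ⟨c, hc0, hc1, hc⟩ y ⟨d, hd0, hd1, hd⟩ ⟨α, β, hα, hβ, hαβ, hs'⟩
  have hle : ∀ e : (Fin n →₀ ℕ) → ℝ, (∀ s ∈ T, 0 ≤ e s) → ∑ s ∈ T, e s = 1 → e s ≤ 1 :=
    fun e he0 he1 => he1 ▸ Finset.single_le_sum he0 hs
  have hcs := hle c hc0 hc1
  have hds := hle d hd0 hd1
  let ν : (Fin n →₀ ℕ) → ℝ := fun t => α * c t + β * d t
  have hν0 : ∀ t ∈ T, 0 ≤ ν t := fun t ht => by
    have := hc0 t ht; have := hd0 t ht; positivity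
  have hν1 : ∑ t ∈ T, ν t = 1 := by
    simp only [ν]
    rw [Finset.sum_add_distrib, ← Finset.mul_sum, ← Finset.mul_sum, hc1, hd1]; simpa using hαβ
  have hνs : ∑ t ∈ T, ν t • toReal t ≤ toReal s := by
    rw [← hs']
    simp only [ν, add_smul, mul_smul, Finset.sum_add_distrib, ← Finset.smul_sum]
    exact add_le_add (smul_le_smul_of_nonneg_left hc hα.le) (smul_le_smul_of_nonneg_left hd hβ.le)
  have hνeq : ν s = 1 := by
    by_contra hne
    have hlt : ν s < 1 := lt_of_le_of_ne (hle ν hν0 hν1) hne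
    apply hred
    have hsum := Finset.add_sum_erase T ν hs
    have hsum' := Finset.add_sum_erase T (fun t => ν t • toReal (n := n) t) hs
    refine ⟨fun t => (1 - ν s)⁻¹ * ν t, fun t ht => mul_nonneg (inv_nonneg.2 (by linarith))
      (hν0 t (Finset.mem_of_mem_erase ht)), ?_, ?_⟩
    · rw [← Finset.mul_sum, inv_mul_eq_one₀ (by linarith)]; linarith
    · simp only [mul_smul]
      rw [← Finset.smul_sum, inv_smul_le_iff_of_pos (by linarith), sub_smul, one_smul,
        le_sub_iff_add_le, add_comm, hsum']
      exact hνs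
  have hc1' : c s = 1 := by
    by_contra hne
    have : c s < 1 := lt_of_le_of_ne hcs hne
    simp only [ν] at hνeq
    nlinarith
  have hd1' : d s = 1 := by
    simp only [ν, hc1', mul_one] at hνeq
    have : β * (d s - 1) = 0 := by linarith
    rcases mul_eq_zero.1 this with h | h <;> linarith
  have hge : ∀ e : (Fin n →₀ ℕ) → ℝ, (∀ s ∈ T, 0 ≤ e s) → e s = 1 →
      toReal s ≤ ∑ t ∈ T, e t • toReal (n := n) t := by
    intro e he0 he
    have h1 := Finset.single_le_sum (f := fun t => e t • toReal (n := n) t)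
      (fun t ht => smul_nonneg (he0 t ht) (toReal_nonneg _)) hs
    simpa [he] using h1
  have hx := (hge c hc0 hc1').trans hc
  have hy := (hge d hd0 hd1').trans hd
  have hcoord : ∀ i, x i = toReal s i ∧ y i = toReal s i := by
    intro i
    have h1 : α * x i + β * y i = toReal s i := congrFun hs' i
    have h2 := hx i
    have h3 := hy i
    have h4 : α * (x i - toReal s i) + β * (y i - toReal s i) = 0 := by
      have : α = 1 - β := by linarith
      subst this; linarith
    have h5 : 0 ≤ α * (x i - toReal s i) := mul_nonneg hα.le (by linarith)
    have h6 : 0 ≤ β * (y i - toReal s i) := mul_nonneg hβ.le (by linarith)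
    constructor
    · have : α * (x i - toReal s i) = 0 := by linarith
      rcases mul_eq_zero.1 this with h | h <;> linarith
    · have : β * (y i - toReal s i) = 0 := by linarith
      rcases mul_eq_zero.1 this with h | h <;> linarith
  exact ⟨funext fun i => (hcoord i).1, funext fun i => (hcoord i).2⟩

variable {K : Type*} [Field K] {f : MvPolynomial (Fin n) K}

theorem newton_eq_upHull (f : MvPolynomial (Fin n) K) : newton f = upHull f.support := by
  have hsub : ∀ s ∈ f.support, toReal s ∈ newton f := fun s hs => by
    refine subset_convexHull ℝ _ ?_
    simp only [Set.mem_iUnion]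
    exact ⟨s, hs, le_refl (toReal s)⟩
  refine Set.Subset.antisymm (convexHull_min ?_ (convex_upHull _)) ?_
  · intro x hx
    simp only [Set.mem_iUnion] at hx
    obtain ⟨s, hs, hsx⟩ := hx
    exact upHull_mono_right (mem_upHull hs) hsx
  · refine upHull_subset (convex_convexHull ℝ _) (fun a ha b hab => ?_) hsub
    have := newton_add ha (sub_nonneg.2 hab)
    rwa [add_sub_cancel] at this

theorem convex_newton (f : MvPolynomial (Fin n) K) : Convex ℝ (newton f) :=
  convex_convexHull ℝ _

theorem mem_newton_of_le {a b : Fin n → ℝ} (ha : a ∈ newton f) (hab : a ≤ b) : b ∈ newton f := by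
  have := newton_add ha (sub_nonneg.2 hab)
  rwa [add_sub_cancel] at this

theorem toReal_mem_newton {s : Fin n →₀ ℕ} (hs : s ∈ f.support) : toReal s ∈ newton f := by
  rw [newton_eq_upHull]; exact mem_upHull hs

theorem supportFn_newton_le {a u : Fin n → ℝ} (hu : 0 ≤ u) (ha : a ∈ newton f) :
    supportFn (newton f) u ≤ pair a u :=
  supportFn_le (fun _ => newton_nonneg) hu ha

theorem exists_mem_meetLocus (hf : f ≠ 0) {u : Fin n → ℝ} (hu : 0 ≤ u) :
    ∃ s ∈ f.support, toReal s ∈ meetLocus (newton f) u := by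
  obtain ⟨s, hs, hmin⟩ := Finset.exists_min_image f.support (fun s => pair (toReal s) u)
    (by simpa [Finset.nonempty_iff_ne_empty] using hf)
  refine ⟨s, hs, toReal_mem_newton hs, le_antisymm ?_ (supportFn_newton_le hu (toReal_mem_newton hs))⟩
  refine le_csInf ⟨_, _, toReal_mem_newton hs, rfl⟩ ?_
  rintro _ ⟨a, ha, rfl⟩
  rw [newton_eq_upHull] at ha
  have : upHull f.support ⊆ {a | pair (toReal s) u ≤ pair a u} :=
    upHull_subset (convex_halfSpace_ge (pairL u).isLinear _)
      (fun a (ha : _ ≤ _) b hab => ha.trans (pair_mono hu hab)) hmin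
  exact this ha

theorem isExposed_meetLocus {P : Set (Fin n → ℝ)} (hP : ∀ a ∈ P, 0 ≤ a) {u : Fin n → ℝ}
    (hu : 0 ≤ u) : IsExposed ℝ P (meetLocus P u) := by
  rintro ⟨b, hb⟩
  refine ⟨LinearMap.toContinuousLinearMap (-(pairL u)), ?_⟩
  ext a
  simp only [meetLocus, Set.mem_ofPred_eq, LinearMap.coe_toContinuousLinearMap', LinearMap.neg_apply,
    pairL_apply, neg_le_neg_iff]
  refine and_congr_right fun ha => ⟨fun h y hy => h ▸ supportFn_le hP hu hy, fun h => ?_⟩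
  exact le_antisymm (hb.2 ▸ h b hb.1) (supportFn_le hP hu ha)

theorem isFace_meetLocus (hf : f ≠ 0) {u : Fin n → ℝ} (hu : 0 ≤ u) :
    IsFace (newton f) (meetLocus (newton f) u) := by
  obtain ⟨s, -, hs⟩ := exists_mem_meetLocus hf hu
  exact ⟨⟨_, hs⟩, isExposed_meetLocus (fun _ => newton_nonneg) hu⟩

theorem convex_meetLocus {u : Fin n → ℝ} (hu : 0 ≤ u) : Convex ℝ (meetLocus (newton f) u) :=
  (isExposed_meetLocus (fun _ => newton_nonneg) hu).convex (convex_newton f)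

/-- The generators with positive weight in a point of a first meet locus lie in it. -/
theorem mem_meetLocus_of_sum_le {u : Fin n → ℝ} (hu : 0 ≤ u) {S : Finset (Fin n →₀ ℕ)}
    (hS : ∀ s ∈ S, toReal s ∈ newton f) {c : (Fin n →₀ ℕ) → ℝ} (hc0 : ∀ s ∈ S, 0 ≤ c s)
    (hc1 : ∑ s ∈ S, c s = 1) {a : Fin n → ℝ} (ha : a ∈ meetLocus (newton f) u)
    (hc : ∑ s ∈ S, c s • toReal s ≤ a) :
    (∀ s ∈ S, c s ≠ 0 → toReal s ∈ meetLocus (newton f) u) ∧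
      pair (∑ s ∈ S, c s • toReal s) u = supportFn (newton f) u := by
  have h1 := pair_mono hu hc
  rw [ha.2] at h1
  have h2 := supportFn_newton_le hu ((convex_newton f).sum_mem hc0 hc1 hS)
  have h3 := le_antisymm h1 h2
  refine ⟨fun s hs hcs => ⟨hS s hs, ?_⟩, h3⟩
  have h4 : ∑ s ∈ S, c s * (pair (toReal s) u - supportFn (newton f) u) = 0 := by
    simp only [mul_sub, Finset.sum_sub_distrib, ← Finset.sum_mul, hc1]
    rw [pair_sum] at h3
    simp only [pair_smul] at h3
    linarith
  rw [Finset.sum_eq_zero_iff_of_nonneg fun s hs => mul_nonneg (hc0 s hs)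
    (sub_nonneg.2 (supportFn_newton_le hu (hS s hs)))] at h4
  have := (mul_eq_zero.1 (h4 s hs)).resolve_left hcs
  linarith

/-- The vertices of the Newton polyhedron are exponents of `f`. -/
theorem extremePoints_newton_subset {x : Fin n → ℝ} (hx : x ∈ (newton f).extremePoints ℝ) :
    ∃ s ∈ f.support, x = toReal s := by
  have hxP := hx.1
  rw [newton_eq_upHull] at hxP
  obtain ⟨c, hc0, hc1, hc⟩ := hxP
  have hS : ∀ s ∈ f.support, toReal s ∈ newton f := fun s hs => toReal_mem_newton hs
  have hyP := (convex_newton f).sum_mem hc0 hc1 hS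
  have hxy : ∑ s ∈ f.support, c s • toReal s = x := by
    refine ((mem_extremePoints.1 hx).2 _ hyP (x + (x - ∑ s ∈ f.support, c s • toReal s))
      (newton_add hx.1 (sub_nonneg.2 hc)) ⟨1/2, 1/2, by norm_num, by norm_num, by norm_num, ?_⟩).1
    ext i
    simp only [Pi.add_apply, Pi.smul_apply, Pi.sub_apply, smul_eq_mul]
    ring
  have hxc : x ∈ convexHull ℝ ((fun s : Fin n →₀ ℕ => toReal (n := n) s) '' f.support) := by
    rw [← hxy]
    exact (convex_convexHull ℝ _).sum_mem hc0 hc1 fun s hs => subset_convexHull ℝ _ ⟨s, hs, rfl⟩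
  have hsub : convexHull ℝ ((fun s : Fin n →₀ ℕ => toReal (n := n) s) '' f.support) ⊆ newton f :=
    convexHull_min (by rintro _ ⟨s, hs, rfl⟩; exact hS s hs) (convex_newton f)
  have := extremePoints_convexHull_subset
    (inter_extremePoints_subset_extremePoints_of_subset hsub ⟨hxc, hx⟩)
  obtain ⟨s, hs, rfl⟩ := this
  exact ⟨s, hs, rfl⟩

/-- A first meet locus consists of the points which dominate a convex combination of its
vertices. -/
theorem exists_vertices_sum_le {u : Fin n → ℝ} (hu : 0 ≤ u) {a : Fin n → ℝ}
    (ha : a ∈ meetLocus (newton f) u) :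
    ∃ (T : Finset (Fin n →₀ ℕ)) (c : (Fin n →₀ ℕ) → ℝ),
      (∀ s ∈ T, toReal s ∈ (meetLocus (newton f) u).extremePoints ℝ) ∧ (∀ s ∈ T, 0 ≤ c s) ∧
      ∑ s ∈ T, c s = 1 ∧ ∑ s ∈ T, c s • toReal s ≤ a := by
  classical
  obtain ⟨T, hTS, hT, hext⟩ := exists_upHull_eq_extreme f.support
  rw [← newton_eq_upHull] at hT hext
  have haT := ha.1
  rw [← hT] at haT
  obtain ⟨c, hc0, hc1, hc⟩ := haT
  have hmem := (mem_meetLocus_of_sum_le hu (fun s hs => toReal_mem_newton (hTS hs)) hc0 hc1 ha hc).1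
  refine ⟨T.filter fun s => c s ≠ 0, c, fun s hs => ?_, fun s hs => hc0 s (Finset.mem_filter.1 hs).1,
    ?_, ?_⟩
  · rw [Finset.mem_filter] at hs
    exact inter_extremePoints_subset_extremePoints_of_subset (fun a ha => ha.1)
      ⟨hmem s hs.1 hs.2, hext s hs.1⟩
  · rw [Finset.sum_filter_ne_zero, hc1]
  · rw [Finset.sum_filter_of_ne]
    · exact hc
    · intro s _ h h0
      exact h (by rw [h0, zero_smul])

/-- A first meet locus of a strictly positive vector is compact. -/
theorem isCompact_meetLocus {u : Fin n → ℝ} (hu : ∀ i, 0 < u i) :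
    IsCompact (meetLocus (newton f) u) := by
  have hu0 : 0 ≤ u := fun i => (hu i).le
  have : meetLocus (newton f) u = convexHull ℝ ((fun s : Fin n →₀ ℕ => toReal (n := n) s) ''
      {s | s ∈ f.support ∧ toReal s ∈ meetLocus (newton f) u}) := by
    refine Set.Subset.antisymm ?_ (convexHull_min ?_ (convex_meetLocus hu0))
    · intro a ha
      obtain ⟨T, c, hT, hc0, hc1, hc⟩ := exists_vertices_sum_le hu0 ha
      have hTP : ∀ s ∈ T, toReal s ∈ newton f := fun s hs => (hT s hs).1.1
      have h2 := (mem_meetLocus_of_sum_le hu0 hTP hc0 hc1 ha hc).2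
      have h3 : pair (a - ∑ s ∈ T, c s • toReal s) u = 0 := by rw [pair_sub, ha.2, h2, sub_self]
      have h3 := (Finset.sum_eq_zero_iff_of_nonneg fun i _ =>
        mul_nonneg (sub_nonneg.2 (hc i)) (hu0 i)).1 h3
      have h4 : a = ∑ s ∈ T, c s • toReal s := by
        ext i
        have := (mul_eq_zero.1 (h3 i (Finset.mem_univ i))).resolve_right (hu i).ne'
        exact sub_eq_zero.1 this
      rw [h4]
      refine (convex_convexHull ℝ _).sum_mem hc0 hc1 fun s hs => subset_convexHull ℝ _ ?_
      refine ⟨s, ⟨?_, (hT s hs).1⟩, rfl⟩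
      have hext := ((isExposed_meetLocus (fun _ => newton_nonneg) hu0).isExtreme
        (A := newton f)).extremePoints_subset_extremePoints (hT s hs)
      obtain ⟨t, ht, hst⟩ := extremePoints_newton_subset hext
      have : s = t := by
        ext i
        have := congrFun hst i
        simpa [toReal] using this
      rwa [this]
    · rintro _ ⟨s, hs, rfl⟩
      exact hs.2
  rw [this]
  exact ((f.support.finite_toSet.subset fun s hs => hs.1).image _).isCompact_convexHull ℝ

end NewtonBasics

/-! ### Facets of Newton polyhedra and their primitive normal vectors -/

section Facets

variable {n : ℕ}

theorem exists_pairL_eq (l : (Fin n → ℝ) →ₗ[ℝ] ℝ) : ∃ d : Fin n → ℝ, pairL d = l := by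
  refine ⟨fun i => l (Pi.single i 1), LinearMap.pi_ext' fun i => LinearMap.ext_ring ?_⟩
  simp [pair_single]

theorem pairL_ne_zero {u : Fin n → ℝ} (hu : u ≠ 0) : pairL u ≠ 0 := by
  intro h
  apply hu
  ext i
  rw [← pair_single i u, ← pairL_apply, h]
  simp

theorem finrank_ker_pairL {u : Fin n → ℝ} (hu : u ≠ 0) :
    Module.finrank ℝ (LinearMap.ker (pairL u)) + 1 = n := by
  have := Module.Dual.finrank_ker_add_one_of_ne_zero (K := ℝ) (f := pairL u) (pairL_ne_zero hu)
  rwa [Module.finrank_fin_fun] at this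

theorem vectorSpan_meetLocus_le (P : Set (Fin n → ℝ)) (u : Fin n → ℝ) :
    vectorSpan ℝ (meetLocus P u) ≤ LinearMap.ker (pairL u) := by
  rw [vectorSpan, Submodule.span_le]
  rintro _ ⟨a, ha, b, hb, rfl⟩
  simp only [vsub_eq_sub, SetLike.mem_coe, LinearMap.mem_ker, pairL_apply, pair_sub, ha.2, hb.2,
    sub_self]

/-- Two linear forms which are constant on a set spanning a hyperplane are proportional. -/
theorem exists_eq_smul_of_vectorSpan_le {F : Set (Fin n → ℝ)} (hF : dim F + 1 = n)
    {u d : Fin n → ℝ} (hu : u ≠ 0) (h : vectorSpan ℝ F ≤ LinearMap.ker (pairL u))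
    (h' : vectorSpan ℝ F ≤ LinearMap.ker (pairL d)) : ∃ t : ℝ, d = t • u := by
  have heq := Submodule.eq_of_le_of_finrank_le h (by
    have := finrank_ker_pairL hu; unfold dim at hF; omega)
  rw [heq] at h'
  obtain ⟨j, hj⟩ := Function.ne_iff.1 hu
  refine ⟨d j / u j, funext fun i => ?_⟩
  have hmem : (u j • Pi.single i 1 - u i • Pi.single j 1 : Fin n → ℝ) ∈
      LinearMap.ker (pairL u) := by
    rw [LinearMap.mem_ker, pairL_apply, pair_sub, pair_smul, pair_smul, pair_single, pair_single]
    ring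
  have h1 := h' hmem
  rw [LinearMap.mem_ker, pairL_apply, pair_sub, pair_smul, pair_smul, pair_single,
    pair_single] at h1
  have hj' : u j ≠ 0 := hj
  simp only [Pi.smul_apply, smul_eq_mul]
  field_simp
  linarith

variable {K : Type*} [Field K] {f : MvPolynomial (Fin n) K}

theorem mem_meetLocus_iff (hf : f ≠ 0) {u a : Fin n → ℝ} (hu : 0 ≤ u) :
    a ∈ meetLocus (newton f) u ↔ a ∈ newton f ∧ ∀ b ∈ newton f, pair a u ≤ pair b u := by
  refine and_congr_right fun ha => ⟨fun h b hb => h ▸ supportFn_newton_le hu hb, fun h => ?_⟩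
  obtain ⟨s, -, hs⟩ := exists_mem_meetLocus hf hu
  exact le_antisymm (hs.2 ▸ h _ hs.1) (supportFn_newton_le hu ha)

theorem meetLocus_smul (hf : f ≠ 0) {u : Fin n → ℝ} (hu : 0 ≤ u) {t : ℝ} (ht : 0 < t) :
    meetLocus (newton f) (t • u) = meetLocus (newton f) u := by
  ext a
  rw [mem_meetLocus_iff hf hu, mem_meetLocus_iff hf (smul_nonneg ht.le hu)]
  simp only [pair_smul_right, mul_le_mul_iff_right₀ ht]

theorem IsPrimitive.ne_zero {u : Fin n → ℕ} (hu : IsPrimitive u) : toReal u ≠ 0 := by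
  intro h
  have h1 : Finset.univ.gcd u = 1 := hu
  have h2 : Finset.univ.gcd u = 0 := Finset.gcd_eq_zero_iff.2 fun i _ => by
    have := congrFun h i
    exact Nat.cast_eq_zero.1 this
  omega

/-- The primitive normal vectors of the facets of the Newton polyhedron of `f`. -/
def facetNormals (f : MvPolynomial (Fin n) K) : Set (Fin n → ℕ) :=
  {u | IsPrimitive u ∧ IsFacet (newton f) (meetLocus (newton f) (toReal u))}

theorem facetNormals_finite (f : MvPolynomial (Fin n) K) : (facetNormals f).Finite :=
  (keptNormals_finite f ∅).subset fun _ hu => ⟨hu.1, hu.2, Set.notMem_empty _⟩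

theorem dim_facet (hf : f ≠ 0) {F : Set (Fin n → ℝ)} (hF : IsFacet (newton f) F) :
    dim F + 1 = n := by
  obtain ⟨s, hs⟩ := Finset.nonempty_iff_ne_empty.2 (by simpa using hf : f.support ≠ ∅)
  rw [hF.2, dim_newton ⟨_, toReal_mem_newton hs⟩]

theorem isFacet_meetLocus (hf : f ≠ 0) {u : Fin n → ℝ} (hu : 0 ≤ u)
    (h : dim (meetLocus (newton f) u) + 1 = n) :
    IsFacet (newton f) (meetLocus (newton f) u) := by
  refine ⟨isFace_meetLocus hf hu, ?_⟩
  rw [h, dim_newton ((isFace_meetLocus hf hu).1.mono fun a ha => ha.1)]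

theorem exists_primitive_smul {d : Fin n → ℚ} (hd : 0 ≤ d) (hd0 : d ≠ 0) :
    ∃ u : Fin n → ℕ, IsPrimitive u ∧ ∃ t : ℝ, 0 < t ∧ toReal u = t • fun i => (d i : ℝ) := by
  let N : ℕ := ∏ i, (d i).den
  have hN : 0 < N := Finset.prod_pos fun i _ => (d i).pos
  have h1 : ∀ i, ∃ m : ℕ, (m : ℚ) = N * d i := by
    intro i
    obtain ⟨k, hk⟩ : (d i).den ∣ N := Finset.dvd_prod_of_mem _ (Finset.mem_univ i)
    refine ⟨k * (d i).num.toNat, ?_⟩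
    have h2 : (((d i).num.toNat : ℤ) : ℚ) = (d i).num := by
      rw [Int.toNat_of_nonneg (Rat.num_nonneg.2 (hd i))]
    have h3 : ((d i).num : ℚ) = d i * (d i).den := (Rat.mul_den_eq_num _).symm
    have h4 : (((d i).num.toNat : ℕ) : ℚ) = d i * (d i).den := by
      rw [← h3, ← h2, Int.cast_natCast]
    push_cast
    rw [h4, hk]
    push_cast
    ring
  choose m hm using h1
  obtain ⟨j, hj⟩ := Function.ne_iff.1 hd0
  obtain ⟨g, hg, hg1⟩ := Finset.extract_gcd m ⟨j, Finset.mem_univ j⟩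
  have hG : Finset.univ.gcd m ≠ 0 := by
    intro h0
    have h2 : m j = 0 := Finset.gcd_eq_zero_iff.1 h0 j (Finset.mem_univ j)
    have h3 := hm j
    rw [h2, Nat.cast_zero, eq_comm, mul_eq_zero] at h3
    rcases h3 with h3 | h3
    · have : N = 0 := by exact_mod_cast h3
      omega
    · exact hj h3
  have hGpos : (0 : ℝ) < (Finset.univ.gcd m : ℕ) := by exact_mod_cast Nat.pos_of_ne_zero hG
  refine ⟨g, hg1, (N : ℝ) / (Finset.univ.gcd m : ℕ), div_pos (by exact_mod_cast hN) hGpos,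
    funext fun i => ?_⟩
  have h2 : ((m i : ℚ) : ℝ) = ((N * d i : ℚ) : ℝ) := by rw [hm i]
  have h3 : (m i : ℝ) = (Finset.univ.gcd m : ℕ) * (g i : ℝ) := by
    have := hg i (Finset.mem_univ i)
    exact_mod_cast this
  push_cast at h2
  simp only [toReal, Pi.smul_apply, smul_eq_mul]
  rw [div_mul_eq_mul_div, eq_div_iff hGpos.ne', ← h2, h3]
  ring

/-- A real normal vector of a facet is proportional to a lattice vector: applying a `ℚ`-linear form
`ℝ → ℚ` to its coordinates gives a rational vector which is also constant on the facet. -/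
theorem exists_primitive_normal (hf : f ≠ 0) {w : Fin n → ℝ} (hw : 0 ≤ w) (hw0 : w ≠ 0)
    (hdim : dim (meetLocus (newton f) w) + 1 = n) :
    ∃ u ∈ facetNormals f, ∃ t : ℝ, 0 < t ∧ toReal u = t • w := by
  obtain ⟨j, hj⟩ := Function.ne_iff.1 hw0
  have hj' : w j ≠ 0 := hj
  obtain ⟨L, hL⟩ : ∃ L : ℝ →ₗ[ℚ] ℚ, L (w j) = 1 := by
    have := mt (Module.forall_dual_apply_eq_zero_iff ℚ (w j)).1 hj'
    push Not at this
    obtain ⟨φ, hφ⟩ := this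
    exact ⟨(φ (w j))⁻¹ • φ, by simp [hφ]⟩
  let d : Fin n → ℚ := fun i => L (w i)
  let d' : Fin n → ℝ := fun i => (d i : ℝ)
  have hconst : ∀ a ∈ meetLocus (newton f) w,
      pair a d' = (L (supportFn (newton f) w) : ℝ) := by
    intro a ha
    obtain ⟨T, c, hT, hc0, hc1, hc⟩ := exists_vertices_sum_le hw ha
    have hTP : ∀ s ∈ T, toReal s ∈ newton f := fun s hs => (hT s hs).1.1
    have h2 := (mem_meetLocus_of_sum_le hw hTP hc0 hc1 ha hc).2
    have h3 : pair (a - ∑ s ∈ T, c s • toReal s) w = 0 := by rw [pair_sub, ha.2, h2, sub_self]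
    have h3 := (Finset.sum_eq_zero_iff_of_nonneg fun i _ =>
        mul_nonneg (sub_nonneg.2 (hc i)) (hw i)).1 h3
    have h4 : pair (a - ∑ s ∈ T, c s • toReal s) d' = 0 := by
      refine Finset.sum_eq_zero fun i hi => ?_
      rcases mul_eq_zero.1 (h3 i hi) with h | h
      · have h' : (a - ∑ s ∈ T, c s • toReal s) i = 0 := h
        rw [h', zero_mul]
      · simp [d', d, h]
    have h5 : ∀ s ∈ T, pair (toReal s) d' = (L (supportFn (newton f) w) : ℝ) := by
      intro s hs
      rw [← (hT s hs).1.2]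
      have : pair (toReal s) w = ∑ i, (s i : ℚ) • w i := by
        simp [pair, toReal, Rat.smul_def]
      rw [this, map_sum]
      simp [pair, toReal, d', d]
    rw [pair_sub, pair_sum, sub_eq_zero] at h4
    rw [h4]
    simp only [pair_smul]
    rw [Finset.sum_congr rfl fun s hs => by rw [h5 s hs], ← Finset.sum_mul, hc1, one_mul]
  have hle : vectorSpan ℝ (meetLocus (newton f) w) ≤ LinearMap.ker (pairL d') := by
    rw [vectorSpan, Submodule.span_le]
    rintro _ ⟨a, ha, b, hb, rfl⟩
    simp only [vsub_eq_sub, SetLike.mem_coe, LinearMap.mem_ker, pairL_apply, pair_sub,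
      hconst a ha, hconst b hb, sub_self]
  obtain ⟨t, ht⟩ := exists_eq_smul_of_vectorSpan_le hdim hw0 (vectorSpan_meetLocus_le _ _) hle
  have htj : (1 : ℝ) = t * w j := by
    have := congrFun ht j
    simpa [d', d, hL] using this
  have hwj : 0 < w j := lt_of_le_of_ne (hw j) hj'.symm
  have htpos : 0 < t := by
    by_contra hneg
    push Not at hneg
    nlinarith
  have hd : 0 ≤ d := fun i => by
    have h1 : (d i : ℝ) = t * w i := congrFun ht i
    have h2 : (0 : ℝ) ≤ (d i : ℝ) := h1 ▸ mul_nonneg htpos.le (hw i)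
    exact_mod_cast h2
  have hd0 : d ≠ 0 := fun h => by
    have h1 : d j = 0 := congrFun h j
    simp [d, hL] at h1
  obtain ⟨u, hu, r, hr, hur⟩ := exists_primitive_smul hd hd0
  have hur' : toReal u = (r * t) • w := by
    rw [hur, mul_smul, ← ht]
  have hpos : 0 < r * t := mul_pos hr htpos
  refine ⟨u, ⟨hu, ?_⟩, _, hpos, hur'⟩
  rw [hur', meetLocus_smul hf hw hpos]
  exact isFacet_meetLocus hf hw hdim

theorem eq_of_vectorSpan_le (hf : f ≠ 0) {u v : Fin n → ℕ} (hu : u ∈ facetNormals f)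
    (hv : IsPrimitive v)
    (h : vectorSpan ℝ (meetLocus (newton f) (toReal u)) ≤ LinearMap.ker (pairL (toReal v))) :
    u = v := by
  obtain ⟨t, ht⟩ := exists_eq_smul_of_vectorSpan_le (dim_facet hf hu.2) hu.1.ne_zero
    (vectorSpan_meetLocus_le _ _) h
  refine eq_of_cross hu.1 hv fun i j => ?_
  have h1 : ∀ i, (v i : ℝ) = t * u i := fun i => congrFun ht i
  have : (u i : ℝ) * v j = v i * u j := by rw [h1, h1]; ring
  exact_mod_cast this

theorem single_mem_facetNormals (hf : f ≠ 0) (i : Fin n) :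
    (Pi.single i 1 : Fin n → ℕ) ∈ facetNormals f := by
  have hprim : IsPrimitive (Pi.single i 1 : Fin n → ℕ) := by
    refine Nat.dvd_one.1 ?_
    have := Finset.gcd_dvd (f := (Pi.single i 1 : Fin n → ℕ)) (Finset.mem_univ i)
    simpa using this
  refine ⟨hprim, isFacet_meetLocus hf (toReal_nonneg _) ?_⟩
  have hne := hprim.ne_zero
  have hker : LinearMap.ker (pairL (toReal (Pi.single i 1 : Fin n → ℕ))) ≤
      vectorSpan ℝ (meetLocus (newton f) (toReal (Pi.single i 1 : Fin n → ℕ))) := by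
    intro x hx
    rw [LinearMap.mem_ker, pairL_apply, toReal_single, pair_single_right] at hx
    rw [← (Pi.basisFun ℝ (Fin n)).sum_repr x]
    refine Submodule.sum_mem _ fun j _ => ?_
    by_cases hj : j = i
    · subst hj; simp [hx]
    · refine Submodule.smul_mem _ _ ?_
      obtain ⟨s, -, hs⟩ := exists_mem_meetLocus hf (toReal_nonneg (Pi.single i 1 : Fin n → ℕ))
      have h1 : toReal s + Pi.single j (1 : ℝ) ∈
          meetLocus (newton f) (toReal (Pi.single i 1 : Fin n → ℕ)) := by
        refine ⟨newton_add hs.1 (by rw [Pi.single_nonneg]; exact zero_le_one), ?_⟩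
        rw [pair_add, hs.2, pair_single]
        simp [toReal, hj]
      have := vsub_mem_vectorSpan ℝ h1 hs
      simpa using this
  have := Submodule.finrank_mono hker
  have h2 := Submodule.finrank_mono (vectorSpan_meetLocus_le (newton f)
    (toReal (Pi.single i 1 : Fin n → ℕ)))
  have h3 := finrank_ker_pairL hne
  unfold dim
  omega

/-- Every facet contains a point which lies on no other facet. -/
theorem exists_relint (hf : f ≠ 0) {u : Fin n → ℕ} (hu : u ∈ facetNormals f) :
    ∃ p ∈ meetLocus (newton f) (toReal u), ∀ v ∈ facetNormals f, v ≠ u →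
      supportFn (newton f) (toReal v) < pair p (toReal v) := by
  have key : ∀ T : Finset (Fin n → ℕ), (∀ v ∈ T, v ∈ facetNormals f ∧ v ≠ u) →
      ∃ p ∈ meetLocus (newton f) (toReal u), ∀ v ∈ T,
        supportFn (newton f) (toReal v) < pair p (toReal v) := by
    intro T
    classical
    induction T using Finset.induction_on with
    | empty =>
      obtain ⟨s, -, hs⟩ := exists_mem_meetLocus hf (toReal_nonneg u)
      exact fun _ => ⟨_, hs, by simp⟩
    | insert v T hv ih =>
      intro hT
      obtain ⟨p, hp, hpT⟩ := ih fun w hw => hT w (Finset.mem_insert_of_mem hw)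
      have hvu := hT v (Finset.mem_insert_self _ _)
      obtain ⟨q, hq, hqv⟩ : ∃ q ∈ meetLocus (newton f) (toReal u),
          supportFn (newton f) (toReal v) < pair q (toReal v) := by
        by_contra! hcon
        have heq : ∀ q ∈ meetLocus (newton f) (toReal u),
            pair q (toReal v) = supportFn (newton f) (toReal v) := fun q hq =>
          le_antisymm (hcon q hq) (supportFn_newton_le (toReal_nonneg _) hq.1)
        refine hvu.2 (eq_of_vectorSpan_le hf hu hvu.1.1 ?_).symm
        rw [vectorSpan, Submodule.span_le]
        rintro _ ⟨a, ha, b, hb, rfl⟩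
        simp only [vsub_eq_sub, SetLike.mem_coe, LinearMap.mem_ker, pairL_apply, pair_sub,
          heq a ha, heq b hb, sub_self]
      refine ⟨(1 / 2 : ℝ) • p + (1 / 2 : ℝ) • q, convex_meetLocus (toReal_nonneg _) hp hq
        (by norm_num) (by norm_num) (by norm_num), fun w hw => ?_⟩
      rw [pair_add, pair_smul, pair_smul]
      have h1 := supportFn_newton_le (toReal_nonneg w) hp.1
      have h2 := supportFn_newton_le (toReal_nonneg w) hq.1
      rcases Finset.mem_insert.1 hw with rfl | hw
      · linarith
      · linarith [hpT w hw]
  classical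
  obtain ⟨p, hp, h⟩ := key ((facetNormals_finite f).toFinset.erase u) fun v hv => by
    rw [Finset.mem_erase, Set.Finite.mem_toFinset] at hv
    exact ⟨hv.2, hv.1⟩
  exact ⟨p, hp, fun v hv hvu => h v (by simp [hv, hvu])⟩

end Facets

/-! ### A Newton polyhedron is the intersection of its facet half-spaces -/

section HalfSpaces

variable {n : ℕ} {K : Type*} [Field K] {f : MvPolynomial (Fin n) K}

open scoped Pointwise in
theorem isClosed_newton (f : MvPolynomial (Fin n) K) : IsClosed (newton f) := by
  have : newton f = convexHull ℝ ((fun s : Fin n →₀ ℕ => toReal (n := n) s) '' f.support) +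
      Set.Ici (0 : Fin n → ℝ) := by
    refine Set.Subset.antisymm ?_ ?_
    · intro a ha
      rw [newton_eq_upHull] at ha
      obtain ⟨c, hc0, hc1, hc⟩ := ha
      exact Set.mem_add.2 ⟨_, (convex_convexHull ℝ _).sum_mem hc0 hc1 fun s hs =>
        subset_convexHull ℝ _ ⟨s, hs, rfl⟩, a - ∑ s ∈ f.support, c s • toReal s, sub_nonneg.2 hc,
        by abel⟩
    · rintro _ ⟨a, ha, r, hr, rfl⟩
      refine newton_add ?_ hr
      exact convexHull_min (by rintro _ ⟨s, hs, rfl⟩; exact toReal_mem_newton hs)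
        (convex_newton f) ha
  rw [this]
  exact isClosed_Ici.add_left_of_isCompact ((f.support.finite_toSet.image _).isCompact_convexHull ℝ)

theorem continuous_pair (a : Fin n → ℝ) : Continuous fun w : Fin n → ℝ => pair a w := by
  unfold pair
  fun_prop

/-- A point outside a Newton polyhedron is separated from it by a vector of the orthant. -/
theorem exists_separating {x : Fin n → ℝ} (hf : f ≠ 0) (hx : x ∉ newton f) :
    ∃ w ∈ stdSimplex ℝ (Fin n), ∀ s ∈ f.support, 0 < pair (toReal s - x) w := by
  obtain ⟨l, r, hlx, hl⟩ := geometric_hahn_banach_point_closed (convex_newton f)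
    (isClosed_newton f) hx
  obtain ⟨w, hw⟩ := exists_pairL_eq (l : (Fin n → ℝ) →ₗ[ℝ] ℝ)
  have hwl : ∀ a, pair a w = l a := fun a => by rw [← pairL_apply, hw]; rfl
  obtain ⟨s, hs⟩ := Finset.nonempty_iff_ne_empty.2 (by simpa using hf : f.support ≠ ∅)
  have hsP := toReal_mem_newton (n := n) hs
  have hw0 : ∀ i, 0 ≤ w i := by
    intro i
    by_contra! hneg
    have hb := hl _ (newton_add hsP (r := ((l (toReal s) - r) / (-(w i))) • Pi.single i 1)
      (smul_nonneg (div_nonneg (by linarith [hl _ hsP]) (by linarith))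
        (by rw [Pi.single_nonneg]; exact zero_le_one)))
    rw [map_add, map_smul, ← hwl (Pi.single i 1), pair_single, smul_eq_mul, div_mul_eq_mul_div,
      mul_comm, ← div_mul_eq_mul_div, div_neg, div_self hneg.ne] at hb
    linarith
  have hne : ∃ i, w i ≠ 0 := by
    by_contra! hz
    have h0 : w = 0 := funext hz
    have h1 := hl _ hsP
    rw [← hwl] at h1 hlx
    rw [h0] at h1 hlx
    simp only [pair, Pi.zero_apply, mul_zero, Finset.sum_const_zero] at h1 hlx
    linarith
  obtain ⟨j, hj⟩ := hne
  have hS : 0 < ∑ i, w i := Finset.sum_pos' (fun i _ => hw0 i)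
    ⟨j, Finset.mem_univ j, lt_of_le_of_ne (hw0 j) hj.symm⟩
  refine ⟨(∑ i, w i)⁻¹ • w, ⟨fun i => mul_nonneg (inv_nonneg.2 hS.le) (hw0 i), ?_⟩, fun t ht => ?_⟩
  · simp only [Pi.smul_apply, smul_eq_mul, ← Finset.mul_sum]
    exact inv_mul_cancel₀ hS.ne'
  · rw [pair_smul_right, pair_sub, hwl, hwl]
    exact mul_pos (inv_pos.2 hS) (by linarith [hl _ (toReal_mem_newton (n := n) ht)])

/-- A point outside a Newton polyhedron violates the inequality of one of its facets. The margin
`φ(w) - w · x` is maximised over the vectors `w` of the standard simplex; an extreme point of the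
set of maximisers is normal to a facet, as it could otherwise be moved in two opposite directions
along which the margin remains maximal. -/
theorem exists_facetNormal_pair_lt {x : Fin n → ℝ} (hf : f ≠ 0) (hx : x ∉ newton f) :
    ∃ u ∈ facetNormals f, pair x (toReal u) < supportFn (newton f) (toReal u) := by
  have hne : f.support.Nonempty := Finset.nonempty_iff_ne_empty.2 (by simpa using hf)
  obtain ⟨w₁, hw₁, hsep⟩ := exists_separating hf hx
  let g : (Fin n → ℝ) → ℝ := fun w => f.support.inf' hne fun s => pair (toReal s - x) w
  have hg : Continuous g := by
    exact Continuous.finset_inf'_apply hne fun s _ => continuous_pair _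
  obtain ⟨w₀, hw₀, hmax⟩ := (isCompact_stdSimplex ℝ (Fin n)).exists_isMaxOn ⟨w₁, hw₁⟩
    hg.continuousOn
  let t₀ := g w₀
  have hmax' : ∀ w ∈ stdSimplex ℝ (Fin n), g w ≤ t₀ := fun w hw => hmax hw
  have ht₀ : 0 < t₀ := lt_of_lt_of_le ((Finset.lt_inf'_iff hne).2 hsep) (hmax' w₁ hw₁)
  let M : Set (Fin n → ℝ) := stdSimplex ℝ (Fin n) ∩
    ⋂ s ∈ f.support, {w | t₀ ≤ pair (toReal s - x) w}
  have hMmem : ∀ w, w ∈ M ↔ w ∈ stdSimplex ℝ (Fin n) ∧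
      ∀ s ∈ f.support, t₀ ≤ pair (toReal s - x) w := by
    intro w; simp [M]
  have hM : IsCompact M := (isCompact_stdSimplex ℝ (Fin n)).inter_right
    (isClosed_biInter fun s _ => isClosed_le continuous_const (continuous_pair _))
  obtain ⟨w, hw⟩ := hM.extremePoints_nonempty
    ⟨w₀, (hMmem _).2 ⟨hw₀, fun s hs => Finset.inf'_le (fun s : Fin n →₀ ℕ => pair (toReal s - x) w₀) hs⟩⟩
  obtain ⟨⟨hwM0, hwM1⟩, hwM⟩ := (hMmem w).1 hw.1
  have hw0 : 0 ≤ w := hwM0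
  have hwne : w ≠ 0 := by
    rintro rfl
    simp at hwM1
  obtain ⟨s₀, hs₀, hs₀w⟩ := exists_mem_meetLocus hf hw0
  have hφ : pair (toReal s₀ - x) w = t₀ := by
    refine le_antisymm ?_ (hwM s₀ hs₀)
    refine le_trans ?_ (hmax' w ⟨hwM0, hwM1⟩)
    refine Finset.le_inf' hne _ fun s hs => ?_
    rw [pair_sub, pair_sub, hs₀w.2]
    linarith [supportFn_newton_le hw0 (toReal_mem_newton (n := n) hs)]
  have hdim : dim (meetLocus (newton f) w) + 1 = n := by
    by_contra hdim
    have hlt : dim (meetLocus (newton f) w) + 1 < n := by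
      have h1 := Submodule.finrank_mono (vectorSpan_meetLocus_le (newton f) w)
      have h2 := finrank_ker_pairL hwne
      unfold dim at hdim ⊢
      omega
    have hV : vectorSpan ℝ (meetLocus (newton f) w) ⊔ Submodule.span ℝ {(1 : Fin n → ℝ)} < ⊤ := by
      refine lt_top_iff_ne_top.2 fun htop => ?_
      have h1 := Submodule.finrank_add_le_finrank_add_finrank
        (vectorSpan ℝ (meetLocus (newton f) w)) (Submodule.span ℝ {(1 : Fin n → ℝ)})
      have h2 := finrank_span_le_card (R := ℝ) {(1 : Fin n → ℝ)}
      rw [htop, finrank_top, Module.finrank_fin_fun] at h1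
      simp only [Set.toFinset_singleton, Finset.card_singleton] at h2
      unfold dim at hlt
      omega
    obtain ⟨l, hl0, hl⟩ := Submodule.exists_le_ker_of_lt_top _ hV
    obtain ⟨d, rfl⟩ := exists_pairL_eq l
    have hd0 : d ≠ 0 := by
      rintro rfl
      apply hl0
      ext; simp [pair]
    have hd1 : ∑ i, d i = 0 := by
      have : (1 : Fin n → ℝ) ∈ LinearMap.ker (pairL d) :=
        hl (Submodule.mem_sup_right (Submodule.mem_span_singleton_self _))
      simpa [pair] using this
    have hdF : ∀ a ∈ meetLocus (newton f) w, ∀ b ∈ meetLocus (newton f) w,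
        pair a d = pair b d := by
      intro a ha b hb
      have : a - b ∈ LinearMap.ker (pairL d) :=
        hl (Submodule.mem_sup_left (vsub_mem_vectorSpan ℝ ha hb))
      rw [LinearMap.mem_ker, pairL_apply, pair_sub] at this
      linarith
    have hdw : ∀ i, w i = 0 → d i = 0 := by
      intro i hi
      have h1 : toReal s₀ + Pi.single i (1 : ℝ) ∈ meetLocus (newton f) w := by
        refine ⟨newton_add hs₀w.1 (by rw [Pi.single_nonneg]; exact zero_le_one), ?_⟩
        rw [pair_add, hs₀w.2, pair_single, hi, add_zero]
      have h2 := hdF _ h1 _ hs₀w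
      rw [pair_add, pair_single] at h2
      linarith
    let δ := pair (toReal s₀ - x) d
    have hev1 : ∀ᶠ ε : ℝ in nhds 0, ∀ i, 0 ≤ w i + ε * d i := by
      rw [Filter.eventually_all]
      intro i
      rcases (hw0 i).eq_or_lt with h | h
      · have h' : w i = 0 := h.symm
        simp [h', hdw i h']
      · have : Continuous fun ε : ℝ => w i + ε * d i := by fun_prop
        have h2 := this.tendsto 0
        simp only [zero_mul, add_zero] at h2
        filter_upwards [h2.eventually_const_lt h] with ε hε using le_of_lt hε
    have hev2 : ∀ᶠ ε : ℝ in nhds 0, ∀ s ∈ f.support,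
        t₀ + ε * δ ≤ pair (toReal s - x) w + ε * pair (toReal s - x) d := by
      rw [Filter.eventually_all_finset]
      intro s hs
      rcases (hwM s hs).eq_or_lt with h | h
      · have hsF : toReal s ∈ meetLocus (newton f) w := by
          refine ⟨toReal_mem_newton hs, ?_⟩
          rw [← hs₀w.2]
          rw [← hφ, pair_sub, pair_sub] at h
          linarith
        have h2 : pair (toReal s - x) d = δ := by
          simp only [δ, pair_sub, hdF _ hsF _ hs₀w]
        rw [← h, h2]
        simp
      · have h1 : Continuous fun ε : ℝ =>
            pair (toReal s - x) w + ε * pair (toReal s - x) d - (t₀ + ε * δ) := by fun_prop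
        have h2 := h1.tendsto 0
        simp only [zero_mul, add_zero] at h2
        filter_upwards [h2.eventually_const_lt (sub_pos.2 h)] with ε hε
        linarith
    obtain ⟨r, hr, hball⟩ := Metric.eventually_nhds_iff.1 (hev1.and hev2)
    have hsimp : ∀ ε : ℝ, |ε| < r → w + ε • d ∈ stdSimplex ℝ (Fin n) := by
      intro ε hε
      have hε' := (hball (y := ε) (by simpa [Real.dist_eq] using hε)).1
      refine ⟨fun i => hε' i, ?_⟩
      simp only [Pi.add_apply, Pi.smul_apply, smul_eq_mul, Finset.sum_add_distrib,
        ← Finset.mul_sum, hd1, hwM1]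
      ring
    have hval : ∀ ε : ℝ, |ε| < r → ∀ s ∈ f.support,
        t₀ + ε * δ ≤ pair (toReal s - x) (w + ε • d) := by
      intro ε hε s hs
      rw [pair_add_right, pair_smul_right]
      exact (hball (y := ε) (by simpa [Real.dist_eq] using hε)).2 s hs
    have hle : ∀ ε : ℝ, |ε| < r → ε * δ ≤ 0 := by
      intro ε hε
      have h1 := hmax' _ (hsimp ε hε)
      have h2 : t₀ + ε * δ ≤ g (w + ε • d) := Finset.le_inf' hne _ (hval ε hε)
      linarith
    have hr2 : |r / 2| < r := by rw [abs_of_pos (by linarith)]; linarith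
    have hr2' : |-(r / 2)| < r := by rwa [abs_neg]
    have hδ : δ = 0 := by
      have h1 := hle _ hr2
      have h2 := hle _ hr2'
      have : r / 2 * δ = 0 := by linarith
      rcases mul_eq_zero.1 this with h | h
      · linarith
      · exact h
    have hmem : ∀ ε : ℝ, |ε| < r → w + ε • d ∈ M := fun ε hε =>
      (hMmem _).2 ⟨hsimp ε hε, fun s hs => by
        have := hval ε hε s hs
        rwa [hδ, mul_zero, add_zero] at this⟩
    have := ((mem_extremePoints.1 hw).2 _ (hmem _ hr2) _ (hmem _ hr2')
      ⟨1/2, 1/2, by norm_num, by norm_num, by norm_num, by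
        ext i
        simp only [Pi.add_apply, Pi.smul_apply, smul_eq_mul]
        ring⟩).1
    rw [add_eq_left, smul_eq_zero] at this
    rcases this with h | h
    · linarith
    · exact hd0 h
  obtain ⟨u, hu, c, hc, huc⟩ := exists_primitive_normal hf hw0 hwne hdim
  refine ⟨u, hu, ?_⟩
  have hs₀u : toReal s₀ ∈ meetLocus (newton f) (toReal u) := by
    rw [huc, meetLocus_smul hf hw0 hc]; exact hs₀w
  rw [← hs₀u.2, huc, pair_smul_right, pair_smul_right]
  rw [pair_sub] at hφ
  exact mul_lt_mul_of_pos_left (by linarith) hc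

theorem mem_newton_iff (hf : f ≠ 0) {x : Fin n → ℝ} :
    x ∈ newton f ↔ ∀ u ∈ facetNormals f, supportFn (newton f) (toReal u) ≤ pair x (toReal u) := by
  refine ⟨fun hx u _ => supportFn_newton_le (toReal_nonneg u) hx, fun h => ?_⟩
  by_contra hx
  obtain ⟨u, hu, hlt⟩ := exists_facetNormal_pair_lt hf hx
  exact absurd (h u hu) (not_le.2 hlt)

end HalfSpaces

/-! ### Ridges, and connectivity of the facets visible from a point -/

section Visible

variable {n : ℕ} {K : Type*} [Field K] {f : MvPolynomial (Fin n) K}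

theorem Adjacent.symm {F G : Set (Fin n → ℝ)} (h : Adjacent F G) : Adjacent G F := by
  unfold Adjacent at h ⊢
  rw [Set.inter_comm]
  exact ⟨h.2, h.1⟩

theorem isExposed_meetLocus_inter (u : Fin n → ℝ) {v : Fin n → ℝ} (hv : 0 ≤ v) :
    IsExposed ℝ (meetLocus (newton f) u) (meetLocus (newton f) u ∩ meetLocus (newton f) v) := by
  rintro ⟨b, hbu, hbv⟩
  refine ⟨LinearMap.toContinuousLinearMap (-(pairL v)), ?_⟩
  ext a
  simp only [Set.mem_inter_iff, Set.mem_ofPred_eq, LinearMap.coe_toContinuousLinearMap',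
    LinearMap.neg_apply, pairL_apply, neg_le_neg_iff]
  refine and_congr_right fun ha =>
    ⟨fun h y hy => h.2 ▸ supportFn_newton_le hv hy.1, fun h => ⟨ha.1, ?_⟩⟩
  exact le_antisymm (hbv.2 ▸ h b hbu) (supportFn_newton_le hv ha.1)

theorem finrank_ker_inf_ker (hf : f ≠ 0) {u v : Fin n → ℕ} (hu : u ∈ facetNormals f)
    (hv : v ∈ facetNormals f) (huv : u ≠ v) :
    Module.finrank ℝ (LinearMap.ker (pairL (toReal u)) ⊓ LinearMap.ker (pairL (toReal v)) :
      Submodule ℝ (Fin n → ℝ)) + 2 = n := by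
  have hu1 := finrank_ker_pairL hu.1.ne_zero
  have hv1 := finrank_ker_pairL hv.1.ne_zero
  have hadd := Submodule.finrank_sup_add_finrank_inf_eq (LinearMap.ker (pairL (toReal u)))
    (LinearMap.ker (pairL (toReal v)))
  have hle := Submodule.finrank_le (LinearMap.ker (pairL (toReal u)) ⊔
    LinearMap.ker (pairL (toReal v)))
  rw [Module.finrank_fin_fun] at hle
  have hne : Module.finrank ℝ (LinearMap.ker (pairL (toReal u)) ⊔
      LinearMap.ker (pairL (toReal v)) : Submodule ℝ (Fin n → ℝ)) + 1 ≠ n := by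
    intro h
    have h1 := Submodule.eq_of_le_of_finrank_eq
      (le_sup_left : LinearMap.ker (pairL (toReal u)) ≤ _ ⊔ LinearMap.ker (pairL (toReal v)))
      (by omega)
    have h2 : LinearMap.ker (pairL (toReal v)) ≤ LinearMap.ker (pairL (toReal u)) := by
      rw [h1]; exact le_sup_right
    exact huv (eq_of_vectorSpan_le hf hv hu.1 ((vectorSpan_meetLocus_le _ _).trans h2)).symm
  have hge := Submodule.finrank_mono
    (le_sup_left : LinearMap.ker (pairL (toReal u)) ≤ _ ⊔ LinearMap.ker (pairL (toReal v)))
  omega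

/-- Two facets are adjacent if their intersection spans the intersection of their hyperplanes. -/
theorem adjacent_of_ker_inf_le (hf : f ≠ 0) {u v : Fin n → ℕ} (hu : u ∈ facetNormals f)
    (hv : v ∈ facetNormals f) (huv : u ≠ v)
    (hne : (meetLocus (newton f) (toReal u) ∩ meetLocus (newton f) (toReal v)).Nonempty)
    (hle : LinearMap.ker (pairL (toReal u)) ⊓ LinearMap.ker (pairL (toReal v)) ≤
      vectorSpan ℝ (meetLocus (newton f) (toReal u) ∩ meetLocus (newton f) (toReal v))) :
    Adjacent (meetLocus (newton f) (toReal u)) (meetLocus (newton f) (toReal v)) := by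
  have h1 := finrank_ker_inf_ker hf hu hv huv
  have h2 : vectorSpan ℝ (meetLocus (newton f) (toReal u) ∩ meetLocus (newton f) (toReal v)) ≤
      LinearMap.ker (pairL (toReal u)) ⊓ LinearMap.ker (pairL (toReal v)) :=
    le_inf ((vectorSpan_mono ℝ Set.inter_subset_left).trans (vectorSpan_meetLocus_le _ _))
      ((vectorSpan_mono ℝ Set.inter_subset_right).trans (vectorSpan_meetLocus_le _ _))
  have h3 : dim (meetLocus (newton f) (toReal u) ∩ meetLocus (newton f) (toReal v)) + 2 = n := by
    rw [dim, le_antisymm h2 hle]; exact h1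
  have h4 := dim_facet hf hu.2
  have h5 := dim_facet hf hv.2
  refine ⟨⟨⟨hne, isExposed_meetLocus_inter _ (toReal_nonneg v)⟩, by omega⟩, ⟨⟨hne, ?_⟩, by omega⟩⟩
  rw [Set.inter_comm]
  exact isExposed_meetLocus_inter _ (toReal_nonneg u)

/-- Conversely, the intersection of adjacent facets spans the intersection of their hyperplanes. -/
theorem vectorSpan_inter_of_adjacent (hf : f ≠ 0) {u v : Fin n → ℕ} (hu : u ∈ facetNormals f)
    (hv : v ∈ facetNormals f)
    (h : Adjacent (meetLocus (newton f) (toReal u)) (meetLocus (newton f) (toReal v))) :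
    u ≠ v ∧ vectorSpan ℝ (meetLocus (newton f) (toReal u) ∩ meetLocus (newton f) (toReal v)) =
      LinearMap.ker (pairL (toReal u)) ⊓ LinearMap.ker (pairL (toReal v)) := by
  have h1 := h.1.2
  have h2 := dim_facet hf hu.2
  have huv : u ≠ v := by
    rintro rfl
    rw [Set.inter_self] at h1
    omega
  refine ⟨huv, Submodule.eq_of_le_of_finrank_eq
    (le_inf ((vectorSpan_mono ℝ Set.inter_subset_left).trans (vectorSpan_meetLocus_le _ _))
      ((vectorSpan_mono ℝ Set.inter_subset_right).trans (vectorSpan_meetLocus_le _ _))) ?_⟩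
  have h3 := finrank_ker_inf_ker hf hu hv huv
  unfold dim at h1 h2
  omega

/-- Within the hyperplane of a facet, a point outside the Newton polyhedron violates the inequality
of an adjacent facet. Among the sets of inequalities which cut out the facet in its hyperplane, a
minimal one consists of inequalities of adjacent facets. -/
theorem exists_adjacent_pair_lt (hf : f ≠ 0) {u : Fin n → ℕ} (hu : u ∈ facetNormals f)
    {y : Fin n → ℝ} (hyu : pair y (toReal u) = supportFn (newton f) (toReal u))
    (hy : y ∉ newton f) :
    ∃ v ∈ facetNormals f,
      Adjacent (meetLocus (newton f) (toReal u)) (meetLocus (newton f) (toReal v)) ∧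
      pair y (toReal v) < supportFn (newton f) (toReal v) := by
  classical
  let Q : Finset (Fin n → ℕ) → Prop := fun R => ∀ y : Fin n → ℝ,
    pair y (toReal u) = supportFn (newton f) (toReal u) →
    (∀ v ∈ R, supportFn (newton f) (toReal v) ≤ pair y (toReal v)) → y ∈ newton f
  let R₀ := (facetNormals_finite f).toFinset.erase u
  have hR₀ : ∀ v, v ∈ R₀ ↔ v ≠ u ∧ v ∈ facetNormals f := fun v => by simp [R₀]
  have hQ₀ : Q R₀ := by
    intro y hyu hy
    refine (mem_newton_iff hf).2 fun v hv => ?_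
    by_cases hvu : v = u
    · rw [hvu, hyu]
    · exact hy v ((hR₀ v).2 ⟨hvu, hv⟩)
  obtain ⟨R, hRmem, hmin⟩ := Finset.exists_minimal (s := R₀.powerset.filter Q)
    ⟨R₀, by simp [hQ₀]⟩
  simp only [Finset.mem_filter, Finset.mem_powerset] at hRmem hmin
  obtain ⟨hRR₀, hQR⟩ := hRmem
  obtain ⟨v, hvR, hvy⟩ : ∃ v ∈ R, pair y (toReal v) < supportFn (newton f) (toReal v) := by
    by_contra! h
    exact hy (hQR y hyu h)
  have hnQ : ¬ Q (R.erase v) := fun hQ => by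
    have := hmin ⟨(Finset.erase_subset v R).trans hRR₀, hQ⟩ (Finset.erase_subset v R) hvR
    simp at this
  simp only [Q] at hnQ
  push Not at hnQ
  obtain ⟨y₂, hy₂u, hy₂R, hy₂⟩ := hnQ
  have hy₂v : pair y₂ (toReal v) < supportFn (newton f) (toReal v) := by
    by_contra! h
    refine hy₂ (hQR y₂ hy₂u fun w hw => ?_)
    by_cases hwv : w = v
    · rwa [hwv]
    · exact hy₂R w (Finset.mem_erase.2 ⟨hwv, hw⟩)
  have hv := (hR₀ v).1 (hRR₀ hvR)
  obtain ⟨p, hp, hpr⟩ := exists_relint hf hu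
  have hpv := hpr v hv.2 hv.1
  -- the point of the segment from `p` to `y₂` on the hyperplane of `v`
  have hden : 0 < pair p (toReal v) - pair y₂ (toReal v) := by linarith
  let θ := (pair p (toReal v) - supportFn (newton f) (toReal v)) /
    (pair p (toReal v) - pair y₂ (toReal v))
  have hθ0 : 0 < θ := div_pos (by linarith) hden
  have hθ1 : θ < 1 := (div_lt_one hden).2 (by linarith)
  have hθ : θ * (pair p (toReal v) - pair y₂ (toReal v)) =
      pair p (toReal v) - supportFn (newton f) (toReal v) := div_mul_cancel₀ _ hden.ne'
  let c := (1 - θ) • p + θ • y₂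
  have hc : ∀ w, pair c w = (1 - θ) * pair p w + θ * pair y₂ w := fun w => by
    rw [pair_add, pair_smul, pair_smul]
  have hcu : pair c (toReal u) = supportFn (newton f) (toReal u) := by
    rw [hc, hp.2, hy₂u]; ring
  have hcv : pair c (toReal v) = supportFn (newton f) (toReal v) := by
    rw [hc]; linarith
  have hcR : ∀ w ∈ R, w ≠ v → supportFn (newton f) (toReal w) < pair c (toReal w) := by
    intro w hw hwv
    have hw' := (hR₀ w).1 (hRR₀ hw)
    have h1 := hpr w hw'.2 hw'.1
    have h2 := hy₂R w (Finset.mem_erase.2 ⟨hwv, hw⟩)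
    rw [hc]
    nlinarith
  have hcP : c ∈ newton f := hQR c hcu fun w hw => by
    by_cases hwv : w = v
    · rw [hwv, hcv]
    · exact (hcR w hw hwv).le
  refine ⟨v, hv.2, adjacent_of_ker_inf_le hf hu hv.2 hv.1.symm ⟨c, ⟨hcP, hcu⟩, ⟨hcP, hcv⟩⟩ ?_, hvy⟩
  intro d hd
  rw [Submodule.mem_inf, LinearMap.mem_ker, LinearMap.mem_ker, pairL_apply, pairL_apply] at hd
  have hev : ∀ᶠ ε : ℝ in nhdsWithin 0 (Set.Ioi 0), ∀ w ∈ R,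
      supportFn (newton f) (toReal w) ≤ pair (c + ε • d) (toReal w) := by
    rw [Filter.eventually_all_finset]
    intro w hw
    by_cases hwv : w = v
    · refine Filter.Eventually.of_forall fun ε => ?_
      rw [hwv, pair_add, pair_smul, hd.2, hcv, mul_zero, add_zero]
    · have h1 : Continuous fun ε : ℝ => pair c (toReal w) + ε * pair d (toReal w) := by fun_prop
      have h2 := h1.tendsto 0
      simp only [zero_mul, add_zero] at h2
      filter_upwards [(h2.mono_left nhdsWithin_le_nhds).eventually_const_lt (hcR w hw hwv)]
        with ε hε
      rw [pair_add, pair_smul]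
      exact le_of_lt hε
  obtain ⟨ε, hε, hε0⟩ := (hev.and self_mem_nhdsWithin).exists
  have hε0' : (0 : ℝ) < ε := hε0
  have heu : pair (c + ε • d) (toReal u) = supportFn (newton f) (toReal u) := by
    rw [pair_add, pair_smul, hd.1, hcu, mul_zero, add_zero]
  have hev' : pair (c + ε • d) (toReal v) = supportFn (newton f) (toReal v) := by
    rw [pair_add, pair_smul, hd.2, hcv, mul_zero, add_zero]
  have heP := hQR _ heu hε
  have := vsub_mem_vectorSpan ℝ (s := meetLocus (newton f) (toReal u) ∩
    meetLocus (newton f) (toReal v)) ⟨⟨heP, heu⟩, ⟨heP, hev'⟩⟩ ⟨⟨hcP, hcu⟩, ⟨hcP, hcv⟩⟩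
  rw [vsub_eq_sub, add_sub_cancel_left] at this
  have h2 := Submodule.smul_mem _ ε⁻¹ this
  rwa [smul_smul, inv_mul_cancel₀ hε0'.ne', one_smul] at h2

/-- The facets visible from a point `x` are connected through adjacency: a property of one visible
facet which passes to adjacent visible facets holds for all of them. Let `z` be a point inside the
polyhedron such that the ray from `z` to `x` leaves the polyhedron through the interior of the
given facet. Where this ray crosses the hyperplane of any other visible facet, it has already
crossed the hyperplane of an adjacent one. -/
theorem visible_induction (hf : f ≠ 0) {x : Fin n → ℝ} {u₀ : Fin n → ℕ}
    (hu₀ : u₀ ∈ facetNormals f) (hx₀ : pair x (toReal u₀) < supportFn (newton f) (toReal u₀))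
    (Q : (Fin n → ℕ) → Prop) (hQ₀ : Q u₀)
    (hstep : ∀ u ∈ facetNormals f, pair x (toReal u) < supportFn (newton f) (toReal u) →
      ∀ v ∈ facetNormals f, pair x (toReal v) < supportFn (newton f) (toReal v) →
      Adjacent (meetLocus (newton f) (toReal u)) (meetLocus (newton f) (toReal v)) → Q u → Q v) :
    ∀ u ∈ facetNormals f, pair x (toReal u) < supportFn (newton f) (toReal u) → Q u := by
  obtain ⟨p, hp, hpr⟩ := exists_relint hf hu₀
  have hev : ∀ᶠ ε : ℝ in nhdsWithin 0 (Set.Ioi 0), ∀ v ∈ facetNormals f,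
      supportFn (newton f) (toReal v) < pair (p + ε • (p - x)) (toReal v) := by
    rw [Filter.eventually_all_finite (facetNormals_finite f)]
    intro v hv
    simp only [pair_add, pair_smul, pair_sub]
    by_cases hvu : v = u₀
    · subst hvu
      filter_upwards [self_mem_nhdsWithin] with ε hε
      have hε' : (0 : ℝ) < ε := hε
      rw [hp.2]
      nlinarith
    · have h1 : Continuous fun ε : ℝ =>
          pair p (toReal v) + ε * (pair p (toReal v) - pair x (toReal v)) := by fun_prop
      have h2 := h1.tendsto 0
      simp only [zero_mul, add_zero] at h2
      exact (h2.mono_left nhdsWithin_le_nhds).eventually_const_lt (hpr v hv hvu)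
  obtain ⟨ε, hz, hε⟩ := (hev.and self_mem_nhdsWithin).exists
  have hε' : (0 : ℝ) < ε := hε
  set z := p + ε • (p - x) with hzdef
  let A : (Fin n → ℕ) → ℝ := fun v => pair z (toReal v) - supportFn (newton f) (toReal v)
  let C : (Fin n → ℕ) → ℝ := fun v => supportFn (newton f) (toReal v) - pair x (toReal v)
  have hA : ∀ v ∈ facetNormals f, 0 < A v := fun v hv => sub_pos.2 (hz v hv)
  have hpA : ∀ v, (1 + ε) * (pair p (toReal v) - supportFn (newton f) (toReal v)) =
      A v - ε * C v := by
    intro v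
    simp only [A, C, hzdef, pair_add, pair_smul, pair_sub]
    ring
  by_contra! hbad
  obtain ⟨u₁, hu₁, hu₁x, hu₁Q⟩ := hbad
  obtain ⟨u, ⟨hu, hux, huQ⟩, humax⟩ := Set.exists_max_image
    {u | u ∈ facetNormals f ∧ pair x (toReal u) < supportFn (newton f) (toReal u) ∧ ¬ Q u}
    (fun u => C u / A u) ((facetNormals_finite f).subset fun u hu => hu.1) ⟨u₁, hu₁, hu₁x, hu₁Q⟩
  have huu₀ : u ≠ u₀ := by
    rintro rfl
    exact huQ hQ₀
  have hAu := hA u hu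
  have hCu : 0 < C u := sub_pos.2 hux
  -- the point where the line through `z` and `x` crosses the hyperplane of `u`
  let κ := C u / A u
  have hκ : 0 < κ := div_pos hCu hAu
  have hκA : κ * A u = C u := div_mul_cancel₀ _ hAu.ne'
  let y := (1 + κ)⁻¹ • (κ • z + x)
  have hy : ∀ v, (1 + κ) * (pair y (toReal v) - supportFn (newton f) (toReal v)) =
      κ * A v - C v := by
    intro v
    have h1 : (1 + κ) * pair y (toReal v) = κ * pair z (toReal v) + pair x (toReal v) := by
      simp only [y, pair_smul, pair_add]
      rw [mul_inv_cancel_left₀ (by positivity)]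
    simp only [A, C]
    linear_combination h1
  have hκ1 : 0 < 1 + κ := by linarith
  have hyu : pair y (toReal u) = supportFn (newton f) (toReal u) := by
    have h1 := hy u
    rw [hκA, sub_self] at h1
    rcases mul_eq_zero.1 h1 with h | h <;> linarith
  have hlt : ∀ v, κ * A v < C v → pair y (toReal v) < supportFn (newton f) (toReal v) := by
    intro v hv
    have h1 := hy v
    by_contra! hcon
    nlinarith
  have hyP : y ∉ newton f := by
    intro hyP
    have h1 := hlt u₀ (by
      have h2 := hpA u₀
      rw [hp.2, sub_self, mul_zero] at h2
      have h3 := hpA u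
      have h4 := hpr u hu huu₀
      have h5 : ε * C u < A u := by nlinarith
      have h6 : ε * κ < 1 := by
        by_contra! hcon
        have h7 : ε * κ * A u = ε * C u := by rw [mul_assoc, hκA]
        nlinarith
      have h7 := hA u₀ hu₀
      have h8 : A u₀ = ε * C u₀ := by linarith
      have hC₀ : 0 < C u₀ := sub_pos.2 hx₀
      rw [h8, ← mul_assoc, mul_comm κ ε]
      nlinarith)
    exact absurd (supportFn_newton_le (toReal_nonneg u₀) hyP) (not_le.2 h1)
  obtain ⟨v, hv, hadj, hyv⟩ := exists_adjacent_pair_lt hf hu hyu hyP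
  have hCv : κ * A v < C v := by
    have h1 := hy v
    nlinarith
  have hvx : pair x (toReal v) < supportFn (newton f) (toReal v) := by
    have : 0 < C v := lt_trans (mul_pos hκ (hA v hv)) hCv
    exact sub_pos.1 this
  have hvQ : Q v := by
    by_contra hvQ
    have h1 := humax v ⟨hv, hvx, hvQ⟩
    have h2 : κ < C v / A v := (lt_div_iff₀ (hA v hv)).2 hCv
    exact absurd h1 (not_le.2 h2)
  exact huQ (hstep v hv hvx u hu hux hadj.symm hvQ)

end Visible

/-! ### The structure of `B₁`-facets -/

section BOne

variable {n : ℕ} {K : Type*} [Field K] {f : MvPolynomial (Fin n) K}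

/-- A `B₁`-facet is compact in its base direction, so the corresponding coordinate of its normal
vector is positive. -/
theorem IsB1With.normal_pos {u : Fin n → ℕ} {v : Fin n → ℝ} {i : Fin n}
    (h : IsB1With (meetLocus (newton f) (toReal u)) v i) : 0 < u i := by
  by_contra h0
  refine h.2.2.2 fun a ha t ht => ⟨newton_add ha.1 (smul_nonneg ht
    (by rw [Pi.single_nonneg]; exact zero_le_one)), ?_⟩
  have : u i = 0 := by omega
  rw [pair_add, pair_smul, pair_single, ha.2]
  simp [toReal, this]

/-- A `B₁`-facet with apex `v` and base direction `i` is a pyramid of height `1` over its base, which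
lies in the hyperplane `x_i = 0`. -/
theorem IsB1With.decomp {u : Fin n → ℕ} {v : Fin n → ℝ} {i : Fin n}
    (h : IsB1With (meetLocus (newton f) (toReal u)) v i) {c : Fin n → ℝ}
    (hc : c ∈ meetLocus (newton f) (toReal u)) :
    c i ≤ 1 ∧ (c i = 1 → v ≤ c) ∧ (c i < 1 → ∃ y ∈ meetLocus (newton f) (toReal u), y i = 0 ∧
      c = c i • v + (1 - c i) • y) := by
  classical
  have hu := toReal_nonneg u
  obtain ⟨T, d, hT, hd0, hd1, hd⟩ := exists_vertices_sum_le hu hc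
  have hTP : ∀ s ∈ T, toReal s ∈ newton f := fun s hs => (hT s hs).1.1
  have h2 := (mem_meetLocus_of_sum_le hu hTP hd0 hd1 hc hd).2
  have h3 : pair (c - ∑ s ∈ T, d s • toReal s) (toReal u) = 0 := by
    rw [pair_sub, hc.2, h2, sub_self]
  have h4 := (Finset.sum_eq_zero_iff_of_nonneg fun j _ =>
    mul_nonneg (sub_nonneg.2 (hd j)) (hu j)).1 h3 i (Finset.mem_univ i)
  have hui : toReal u i ≠ 0 := Nat.cast_ne_zero.2 h.normal_pos.ne'
  have hci : c i = ∑ s ∈ T, d s * s i := by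
    have := (mul_eq_zero.1 h4).resolve_right hui
    have h5 := sub_eq_zero.1 this
    rw [h5, Finset.sum_apply]
    rfl
  have hsi : ∀ s ∈ T, (s i : ℝ) = if toReal s = v then 1 else 0 := by
    intro s hs
    split_ifs with hsv
    · rw [← h.2.1, ← hsv]; rfl
    · exact h.2.2.1 _ (hT s hs) hsv
  have hci' : c i = ∑ s ∈ T.filter (fun s : Fin n →₀ ℕ => toReal s = v), d s := by
    rw [hci, Finset.sum_filter]
    refine Finset.sum_congr rfl fun s hs => ?_
    rw [hsi s hs]; split_ifs <;> simp
  have hrest : ∑ s ∈ T.filter (fun s : Fin n →₀ ℕ => ¬ toReal s = v), d s = 1 - c i := by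
    rw [hci', ← hd1, ← Finset.sum_filter_add_sum_filter_not T (fun s : Fin n →₀ ℕ => toReal s = v)]
    ring
  have hd0' : ∀ s ∈ T.filter fun s : Fin n →₀ ℕ => ¬ toReal s = v, 0 ≤ d s := fun s hs =>
    hd0 s (Finset.mem_filter.1 hs).1
  have hsum : c i • v + ∑ s ∈ T.filter (fun s : Fin n →₀ ℕ => ¬ toReal s = v), d s • toReal s ≤ c := by
    refine le_trans (le_of_eq ?_) hd
    rw [← Finset.sum_filter_add_sum_filter_not T (fun s : Fin n →₀ ℕ => toReal s = v), hci', Finset.sum_smul]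
    congr 1
    refine Finset.sum_congr rfl fun s hs => ?_
    rw [(Finset.mem_filter.1 hs).2]
  have hle : c i ≤ 1 := by
    have := Finset.sum_nonneg hd0'
    linarith
  refine ⟨hle, fun h1 => ?_, fun h1 => ?_⟩
  · rw [h1, sub_self, Finset.sum_eq_zero_iff_of_nonneg hd0'] at hrest
    rw [Finset.sum_eq_zero fun s hs => by rw [hrest s hs, zero_smul], h1, one_smul,
      add_zero] at hsum
    exact hsum
  · have hpos : 0 < 1 - c i := by linarith
    let y := (1 - c i)⁻¹ • (c - c i • v)
    have hcy : c = c i • v + (1 - c i) • y := by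
      simp only [y]
      rw [smul_inv_smul₀ hpos.ne']; abel
    refine ⟨y, ⟨?_, ?_⟩, ?_, hcy⟩
    · have hmem := (convex_newton f).sum_mem (t := T.filter fun s : Fin n →₀ ℕ => ¬ toReal s = v)
        (w := fun s => (1 - c i)⁻¹ * d s) (z := fun s => toReal s)
        (fun s hs => mul_nonneg (inv_nonneg.2 hpos.le) (hd0' s hs))
        (by rw [← Finset.mul_sum, hrest, inv_mul_cancel₀ hpos.ne'])
        (fun s hs => hTP s (Finset.mem_filter.1 hs).1)
      refine mem_newton_of_le hmem ?_
      simp only [mul_smul]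
      rw [← Finset.smul_sum]
      refine smul_le_smul_of_nonneg_left ?_ (inv_nonneg.2 hpos.le)
      rwa [le_sub_iff_add_le, add_comm]
    · simp only [y]
      rw [pair_smul, pair_sub, pair_smul, hc.2, h.1.1.2, inv_mul_eq_iff_eq_mul₀ hpos.ne']
      ring
    · simp only [y, Pi.smul_apply, Pi.sub_apply, smul_eq_mul, h.2.1]
      ring

theorem IsB1With.exists_base {u : Fin n → ℕ} {v : Fin n → ℝ} {i : Fin n}
    (h : IsB1With (meetLocus (newton f) (toReal u)) v i)
    (hne : ¬ meetLocus (newton f) (toReal u) ⊆ {a | a i = 1}) :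
    ∃ y ∈ meetLocus (newton f) (toReal u), y i = 0 := by
  obtain ⟨c, hc, hc1⟩ := Set.not_subset.1 hne
  obtain ⟨y, hy, hyi, -⟩ := (h.decomp hc).2.2 (lt_of_le_of_ne (h.decomp hc).1 hc1)
  exact ⟨y, hy, hyi⟩

theorem supportFn_single_eq_zero {i : Fin n} {y : Fin n → ℝ} (hy : y ∈ newton f) (hyi : y i = 0) :
    supportFn (newton f) (toReal (Pi.single i 1 : Fin n → ℕ)) = 0 := by
  refine le_antisymm ?_ ?_
  · have := supportFn_newton_le (toReal_nonneg (Pi.single i 1 : Fin n → ℕ)) hy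
    rwa [toReal_single, pair_single_right, hyi, ← toReal_single] at this
  · refine le_csInf ⟨_, _, hy, rfl⟩ ?_
    rintro _ ⟨a, ha, rfl⟩
    exact pair_nonneg (newton_nonneg ha) (toReal_nonneg _)

/-- The facets adjacent to a `B₁`-facet pass through its apex, with the exception of the coordinate
hyperplane which contains its base: a ridge avoiding the apex lies in the base, and at most two
facets contain a given ridge. -/
theorem IsB1With.adjacent (hf : f ≠ 0) {u w : Fin n → ℕ} {v : Fin n → ℝ} {i : Fin n}
    (h : IsB1With (meetLocus (newton f) (toReal u)) v i)
    (hne : ¬ meetLocus (newton f) (toReal u) ⊆ {a | a i = 1})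
    (hu : u ∈ facetNormals f) (hw : w ∈ facetNormals f)
    (hadj : Adjacent (meetLocus (newton f) (toReal u)) (meetLocus (newton f) (toReal w))) :
    v ∈ meetLocus (newton f) (toReal w) ∨ w = Pi.single i 1 := by
  by_contra! hcon
  obtain ⟨hvw, hwi⟩ := hcon
  have hvP : v ∈ newton f := h.1.1.1
  have hvlt : supportFn (newton f) (toReal w) < pair v (toReal w) :=
    lt_of_le_of_ne (supportFn_newton_le (toReal_nonneg w) hvP) fun h' => hvw ⟨hvP, h'.symm⟩
  have hzero : ∀ c ∈ meetLocus (newton f) (toReal u) ∩ meetLocus (newton f) (toReal w),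
      c i = 0 := by
    rintro c ⟨hcu, hcw⟩
    obtain ⟨hc1, hc2, hc3⟩ := h.decomp hcu
    rcases hc1.eq_or_lt with h1 | h1
    · have := pair_mono (toReal_nonneg w) (hc2 h1)
      rw [hcw.2] at this
      linarith
    · obtain ⟨y, hy, -, hcy⟩ := hc3 h1
      have h4 := hcw.2
      rw [hcy, pair_add, pair_smul, pair_smul] at h4
      have h5 := supportFn_newton_le (toReal_nonneg w) hy.1
      have h6 : 0 ≤ c i := newton_nonneg hcu.1 i
      by_contra hne0
      have h7 : 0 < c i := lt_of_le_of_ne h6 (Ne.symm hne0)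
      nlinarith
  obtain ⟨y, hy, hyi⟩ := h.exists_base hne
  have hN := supportFn_single_eq_zero hy.1 hyi
  have hsi := single_mem_facetNormals hf i
  have hui : u ≠ Pi.single i 1 := by
    rintro rfl
    have h1 := h.1.1.2
    rw [hN, toReal_single, pair_single_right, h.2.1] at h1
    exact one_ne_zero h1
  obtain ⟨hadj_ne, hspan⟩ := vectorSpan_inter_of_adjacent hf hu hw hadj
  have hker : LinearMap.ker (pairL (toReal u)) ⊓ LinearMap.ker (pairL (toReal w)) ≤
      LinearMap.ker (pairL (Pi.single i (1 : ℝ))) := by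
    rw [← hspan, vectorSpan, Submodule.span_le]
    rintro _ ⟨a, ha, b, hb, rfl⟩
    simp only [vsub_eq_sub, SetLike.mem_coe, LinearMap.mem_ker, pairL_apply,
      pair_single_right, Pi.sub_apply, hzero a ha, hzero b hb, sub_self]
  -- otherwise `e_i = α u + β w`, where `α` and `β` turn out to be positive; but on the facet in the
  -- hyperplane `x_i = 0` the forms `u` and `w` would then have to be minimal simultaneously
  have hmem := mem_span_of_iInf_ker_le_ker (𝕜 := ℝ) (L := ![pairL (toReal u), pairL (toReal w)])
    (K := pairL (Pi.single i (1 : ℝ))) (by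
      refine le_trans (le_of_eq ?_) hker
      refine le_antisymm (le_inf (iInf_le _ 0) (iInf_le _ 1)) (le_iInf fun j => ?_)
      fin_cases j
      · exact inf_le_left
      · exact inf_le_right)
  rw [Matrix.range_cons, Matrix.range_cons, Matrix.range_empty, Set.union_empty,
    Set.singleton_union, Submodule.mem_span_pair] at hmem
  obtain ⟨α, β, hαβ⟩ := hmem
  have hlin : ∀ x, α * pair x (toReal u) + β * pair x (toReal w) = x i := fun x => by
    have := LinearMap.congr_fun hαβ x
    simpa [pair_single_right] using this
  obtain ⟨⟨g, hgu, hgw⟩, -⟩ := hadj.1.1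
  have hg := hlin g
  rw [hgu.2, hgw.2, hzero g ⟨hgu, hgw⟩] at hg
  have hv := hlin v
  rw [h.1.1.2, h.2.1] at hv
  have hβ : 0 < β := by
    have : β * (pair v (toReal w) - supportFn (newton f) (toReal w)) = 1 := by linarith
    by_contra! hneg
    nlinarith
  obtain ⟨q, hq, hqr⟩ := exists_relint hf hw
  have hq1 := hqr _ hsi (Ne.symm hwi)
  rw [hN, toReal_single, pair_single_right] at hq1
  have hq2 := hqr u hu hadj_ne
  have hq3 := hlin q
  rw [hq.2] at hq3
  have hα : 0 < α := by
    have : α * (pair q (toReal u) - supportFn (newton f) (toReal u)) = q i := by linarith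
    by_contra! hneg
    nlinarith
  obtain ⟨z, hz, hzr⟩ := exists_relint hf hsi
  have hz1 := hzr u hu hui
  have hz2 := hzr w hw hwi
  have hz3 := hlin z
  have hz4 := hz.2
  rw [hN, toReal_single, pair_single_right] at hz4
  rw [hz4] at hz3
  nlinarith

/-- Two `B₁`-facets with the same base direction have the same apex if the apex of one lies on the
other: it is then a vertex of both, at height `1`. -/
theorem IsB1With.apex_unique {u w : Fin n → ℕ} {v v' : Fin n → ℝ} {i : Fin n}
    (h : IsB1With (meetLocus (newton f) (toReal u)) v i)
    (h' : IsB1With (meetLocus (newton f) (toReal w)) v' i)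
    (hv : v ∈ meetLocus (newton f) (toReal w)) : v' = v := by
  by_contra hne
  have h1 : v ∈ (newton f).extremePoints ℝ :=
    ((isExposed_meetLocus (fun _ => newton_nonneg) (toReal_nonneg u)).isExtreme
      (A := newton f)).extremePoints_subset_extremePoints h.1
  have h2 : v ∈ (meetLocus (newton f) (toReal w)).extremePoints ℝ :=
    inter_extremePoints_subset_extremePoints_of_subset (fun a ha => ha.1) ⟨hv, h1⟩
  have h3 := h'.2.2.1 v h2 (Ne.symm hne)
  rw [h.2.1] at h3
  exact one_ne_zero h3

end BOne

/-! ### Points of the cut outside the Newton polyhedron -/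

section Cut

variable {n : ℕ} {K : Type*} [Field K] {f : MvPolynomial (Fin n) K} {B : Set (Set (Fin n → ℝ))}

theorem mem_keptNormals_iff {u : Fin n → ℕ} : u ∈ keptNormals (newton f) B ↔
    u ∈ facetNormals f ∧ meetLocus (newton f) (toReal u) ∉ B :=
  ⟨fun h => ⟨⟨h.1, h.2.1⟩, h.2.2⟩, fun h => ⟨h.1.1, h.1.2, h.2⟩⟩

theorem newton_subset_cut : newton f ⊆ cut (newton f) B :=
  fun _ ha => ⟨newton_nonneg ha, fun u _ => supportFn_newton_le (toReal_nonneg u) ha⟩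

theorem convex_cut (P : Set (Fin n → ℝ)) (B : Set (Set (Fin n → ℝ))) : Convex ℝ (cut P B) := by
  rintro a ⟨ha0, ha⟩ b ⟨hb0, hb⟩ x y hx hy hxy
  refine ⟨add_nonneg (smul_nonneg hx ha0) (smul_nonneg hy hb0), fun u hu => ?_⟩
  rw [pair_add, pair_smul, pair_smul]
  have h1 := ha u hu
  have h2 := hb u hu
  have : x = 1 - y := by linarith
  subst this
  nlinarith

theorem single_mem_keptNormals (hf : f ≠ 0)
    (hB' : ∀ τ ∈ B, ∀ (i : Fin n) (m : ℝ), ¬ τ ⊆ {a | a i = m}) (i : Fin n) :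
    (Pi.single i 1 : Fin n → ℕ) ∈ keptNormals (newton f) B := by
  refine mem_keptNormals_iff.2 ⟨single_mem_facetNormals hf i, fun h => hB' _ h i
    (supportFn (newton f) (toReal (Pi.single i 1 : Fin n → ℕ))) fun a ha => ?_⟩
  have := ha.2
  rwa [toReal_single, pair_single_right, ← toReal_single] at this

/-- The nonnegativity of the coordinates is implied by the inequalities of the coordinate facets, as
these are not removed. -/
theorem mem_cut_of_forall (hf : f ≠ 0)
    (hB' : ∀ τ ∈ B, ∀ (i : Fin n) (m : ℝ), ¬ τ ⊆ {a | a i = m}) {a : Fin n → ℝ}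
    (h : ∀ u ∈ keptNormals (newton f) B, supportFn (newton f) (toReal u) ≤ pair a (toReal u)) :
    a ∈ cut (newton f) B := by
  refine ⟨fun i => ?_, h⟩
  have h1 := h _ (single_mem_keptNormals hf hB' i)
  rw [toReal_single, pair_single_right] at h1
  refine le_trans ?_ h1
  obtain ⟨s, -, hs⟩ := exists_mem_meetLocus hf
    (by rw [Pi.single_nonneg]; exact zero_le_one : (0 : Fin n → ℝ) ≤ Pi.single i 1)
  rw [← hs.2, pair_single_right]
  exact toReal_nonneg s i

/-- A point `a` of the cut which violates the inequality of a removed facet: all the facets that it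
violates are pyramids with the same apex `v` and the same base direction `i`; the point lies below
the apex, and its projection from `v` to the hyperplane `x_i = 0` lies in the cut. -/
theorem cut_violating (hf : f ≠ 0) (hB' : ∀ τ ∈ B, ∀ (i : Fin n) (m : ℝ), ¬ τ ⊆ {a | a i = m})
    {b : Set (Fin n → ℝ) → Fin n} (hb : ∀ τ ∈ B, ∃ v, IsB1With τ v (b τ))
    (hbadj : ∀ τ₁ ∈ B, ∀ τ₂ ∈ B, Adjacent τ₁ τ₂ → b τ₁ = b τ₂)
    {a : Fin n → ℝ} (ha : a ∈ cut (newton f) B) {u₀ : Fin n → ℕ} (hu₀ : u₀ ∈ facetNormals f)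
    (hau₀ : pair a (toReal u₀) < supportFn (newton f) (toReal u₀)) {v : Fin n → ℝ} {i : Fin n}
    (hi : b (meetLocus (newton f) (toReal u₀)) = i)
    (hv : IsB1With (meetLocus (newton f) (toReal u₀)) v i) :
    (∀ u ∈ facetNormals f, pair a (toReal u) < supportFn (newton f) (toReal u) →
      IsB1With (meetLocus (newton f) (toReal u)) v i) ∧
    a i < 1 ∧ (1 - a i)⁻¹ • (a - a i • v) ∈ cut (newton f) B := by
  have hin : ∀ {a : Fin n → ℝ}, a ∈ cut (newton f) B → ∀ u ∈ facetNormals f,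
      pair a (toReal u) < supportFn (newton f) (toReal u) →
      meetLocus (newton f) (toReal u) ∈ B := by
    intro a ha u hu hau
    by_contra h
    exact absurd (ha.2 u (mem_keptNormals_iff.2 ⟨hu, h⟩)) (not_le.2 hau)
  -- `Good` is the property that is carried from one visible facet to the next
  let Good : (Fin n → ℕ) → Prop := fun u => meetLocus (newton f) (toReal u) ∈ B ∧
    b (meetLocus (newton f) (toReal u)) = i ∧ IsB1With (meetLocus (newton f) (toReal u)) v i
  have hgood₀ : Good u₀ := ⟨hin ha u₀ hu₀ hau₀, hi, hv⟩
  have hadj : ∀ u ∈ facetNormals f, Good u → ∀ w ∈ facetNormals f,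
      Adjacent (meetLocus (newton f) (toReal u)) (meetLocus (newton f) (toReal w)) →
      v ∈ meetLocus (newton f) (toReal w) ∨ w = Pi.single i 1 := fun u hu hgu w hw h =>
    hgu.2.2.adjacent hf (hB' _ hgu.1 i 1) hu hw h
  have hstep : ∀ u ∈ facetNormals f, Good u → ∀ w ∈ facetNormals f,
      meetLocus (newton f) (toReal w) ∈ B →
      Adjacent (meetLocus (newton f) (toReal u)) (meetLocus (newton f) (toReal w)) → Good w := by
    intro u hu hgu w hw hwB h
    have hbw : b (meetLocus (newton f) (toReal w)) = i := by
      rw [← hgu.2.1]; exact (hbadj _ hgu.1 _ hwB h).symm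
    obtain ⟨v', hv'⟩ := hb _ hwB
    rw [hbw] at hv'
    rcases hadj u hu hgu w hw h with hvw | rfl
    · rw [hgu.2.2.apex_unique hv' hvw] at hv'
      exact ⟨hwB, hbw, hv'⟩
    · exact absurd hwB (mem_keptNormals_iff.1 (single_mem_keptNormals hf hB' i)).2
  have hall := visible_induction hf hu₀ hau₀ Good hgood₀ fun u hu _ w hw haw h hgu =>
    hstep u hu hgu w hw (hin ha w hw haw) h
  have hlt : a i < 1 := by
    -- the last hyperplane crossed by the ray from `a` in the direction `e_i`
    obtain ⟨u, ⟨hu, hau⟩, hmax⟩ := Set.exists_max_image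
      {u | u ∈ facetNormals f ∧ pair a (toReal u) < supportFn (newton f) (toReal u)}
      (fun u => (supportFn (newton f) (toReal u) - pair a (toReal u)) / toReal u i)
      ((facetNormals_finite f).subset fun u hu => hu.1) ⟨u₀, hu₀, hau₀⟩
    have hpos : ∀ w ∈ facetNormals f, pair a (toReal w) < supportFn (newton f) (toReal w) →
        0 < toReal w i := fun w hw haw => Nat.cast_pos.2 (hall w hw haw).2.2.normal_pos
    set t := (supportFn (newton f) (toReal u) - pair a (toReal u)) / toReal u i with ht
    have ht0 : 0 < t := div_pos (sub_pos.2 hau) (hpos u hu hau)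
    have hc : ∀ w, pair (a + t • Pi.single i 1) w = pair a w + t * w i := fun w => by
      rw [pair_add, pair_smul, pair_single]
    have hcP : a + t • Pi.single i 1 ∈ newton f := by
      refine (mem_newton_iff hf).2 fun w hw => ?_
      rw [hc]
      by_cases haw : pair a (toReal w) < supportFn (newton f) (toReal w)
      · have h1 := (div_le_iff₀ (hpos w hw haw)).1 (hmax w ⟨hw, haw⟩)
        linarith
      · push Not at haw
        have := mul_nonneg ht0.le (toReal_nonneg w i)
        linarith
    have hcu : pair (a + t • Pi.single i 1) (toReal u) = supportFn (newton f) (toReal u) := by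
      rw [hc, ht, div_mul_cancel₀ _ (hpos u hu hau).ne']; ring
    have := ((hall u hu hau).2.2.decomp ⟨hcP, hcu⟩).1
    simp only [Pi.add_apply, Pi.smul_apply, Pi.single_eq_same, smul_eq_mul, mul_one] at this
    linarith
  refine ⟨fun u hu hau => (hall u hu hau).2.2, hlt, ?_⟩
  have hpos : 0 < 1 - a i := by linarith
  -- a facet that is kept and passes through `v` is satisfied by `y` as it is satisfied by `a`, so
  -- starting at `u₀` one only meets removed facets among those violated by `y`
  set y := (1 - a i)⁻¹ • (a - a i • v) with hy
  have hyw : ∀ w, v ∈ meetLocus (newton f) w →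
      (1 - a i) * (pair y w - supportFn (newton f) w) = pair a w - supportFn (newton f) w := by
    intro w hvw
    rw [hy, pair_smul, pair_sub, pair_smul, hvw.2, mul_sub, mul_inv_cancel_left₀ hpos.ne']
    ring
  have hyi : y i = 0 := by
    simp only [hy, Pi.smul_apply, Pi.sub_apply, smul_eq_mul, hv.2.1]
    ring
  obtain ⟨q, hq, hqi⟩ := hv.exists_base (hB' _ hgood₀.1 i 1)
  have hNi := supportFn_single_eq_zero hq.1 hqi
  have hyu₀ : pair y (toReal u₀) < supportFn (newton f) (toReal u₀) := by
    have h1 := hyw _ hv.1.1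
    by_contra! h2
    nlinarith
  have hall' := visible_induction hf hu₀ hyu₀ Good hgood₀ fun u hu _ w hw hyw' h hgu => by
    by_cases hwB : meetLocus (newton f) (toReal w) ∈ B
    · exact hstep u hu hgu w hw hwB h
    · exfalso
      rcases hadj u hu hgu w hw h with hvw | rfl
      · have h1 := hyw _ hvw
        have h2 := ha.2 w (mem_keptNormals_iff.2 ⟨hw, hwB⟩)
        nlinarith
      · rw [hNi, toReal_single, pair_single_right, hyi] at hyw'
        exact lt_irrefl _ hyw'
  refine mem_cut_of_forall hf hB' fun w hw => ?_
  by_contra! hlt'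
  exact (mem_keptNormals_iff.1 hw).2 (hall' w (mem_keptNormals_iff.1 hw).1 hlt').1

/-- The combinatorial heart of the desingularization. Let `I` be a set of facet normals of the cut
which are tight at a point `a` of the cut, and whose sum is strictly positive. Either the normals
in `I` are tight at a common point of the Newton polyhedron, or `I` contains the coordinate vector
`e_i` of a base direction, and the other elements of `I` are tight at an apex `s` with base
direction `i`, which is then the only exponent of `f` with `i`-th coordinate at most `1` where they
are tight. -/
theorem tight_dichotomy (hf : f ≠ 0) (hB : IsConsistentB1 (newton f) B)
    (hB' : ∀ τ ∈ B, ∀ (i : Fin n) (m : ℝ), ¬ τ ⊆ {a | a i = m})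
    {I : Set (Fin n → ℕ)} (hI : I ⊆ keptNormals (newton f) B) {a : Fin n → ℝ}
    (ha : a ∈ cut (newton f) B)
    (haI : ∀ r ∈ I, pair a (toReal r) = supportFn (newton f) (toReal r))
    (hcov : ∀ j, ∃ r ∈ I, 0 < r j) :
    (∃ x ∈ newton f, ∀ r ∈ I, pair x (toReal r) = supportFn (newton f) (toReal r)) ∨
    ∃ i, (Pi.single i 1 : Fin n → ℕ) ∈ I ∧
      supportFn (newton f) (toReal (Pi.single i 1 : Fin n → ℕ)) = 0 ∧
      ∃ s ∈ f.support, s i = 1 ∧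
        (∀ r ∈ I, r ≠ Pi.single i 1 →
          pair (toReal s) (toReal r) = supportFn (newton f) (toReal r)) ∧
        ∀ t ∈ f.support, t i ≤ 1 → (∀ r ∈ I, r ≠ Pi.single i 1 →
          pair (toReal t) (toReal r) = supportFn (newton f) (toReal r)) → t = s := by
  refine or_iff_not_imp_left.2 fun hA => ?_
  push Not at hA
  have hIF : ∀ r ∈ I, r ∈ facetNormals f := fun r hr => (mem_keptNormals_iff.1 (hI hr)).1
  have haP : a ∉ newton f := fun haP => by
    obtain ⟨r, hr, hne⟩ := hA a haP
    exact hne (haI r hr)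
  obtain ⟨u₀, hu₀, hau₀⟩ := exists_facetNormal_pair_lt hf haP
  obtain ⟨-, b, hb, hbadj⟩ := hB
  have hu₀B : meetLocus (newton f) (toReal u₀) ∈ B := by
    by_contra h
    exact absurd (ha.2 u₀ (mem_keptNormals_iff.2 ⟨hu₀, h⟩)) (not_le.2 hau₀)
  obtain ⟨v, hv⟩ := hb _ hu₀B
  obtain ⟨i, hi⟩ : ∃ i, b (meetLocus (newton f) (toReal u₀)) = i := ⟨_, rfl⟩
  rw [hi] at hv
  have hcut : ∀ x ∈ cut (newton f) B, pair x (toReal u₀) < supportFn (newton f) (toReal u₀) → _ :=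
    fun x hx hxu => cut_violating hf hB' hb hbadj hx hu₀ hxu hi hv
  obtain ⟨hviol, hai1, hy⟩ := hcut a ha hau₀
  have hvP : v ∈ newton f := hv.1.1.1
  have hpos : 0 < 1 - a i := by linarith
  have hai0 : 0 ≤ a i := ha.1 i
  obtain ⟨q₀, hq₀, hq₀i⟩ := hv.exists_base (hB' _ hu₀B i 1)
  have hNi := supportFn_single_eq_zero hq₀.1 hq₀i
  have hproj : ∀ (x : Fin n → ℝ) (w : Fin n → ℝ), 0 < 1 - x i →
      pair x w = (1 - x i) * pair ((1 - x i)⁻¹ • (x - x i • v)) w + x i * pair v w := by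
    intro x w hx
    rw [pair_smul, pair_sub, pair_smul, mul_inv_cancel_left₀ hx.ne']
    ring
  -- `a` is a combination of `v` and its projection; if `v` had a positive weight in it, all normals
  -- in `I` would be tight at `v`
  have hai : a i = 0 := by
    by_contra hne
    have hapos : 0 < a i := lt_of_le_of_ne hai0 (Ne.symm hne)
    obtain ⟨r, hr, hrv⟩ := hA v hvP
    have h1 := hproj a (toReal r) hpos
    have h2 := hy.2 r (hI hr)
    have h3 := lt_of_le_of_ne (supportFn_newton_le (toReal_nonneg r) hvP) (Ne.symm hrv)
    rw [haI r hr] at h1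
    nlinarith
  -- the same argument for the points `(1 - ε) a + ε q`, where `q` is a point of the facet of `r` off
  -- the hyperplane `x_i = 0`
  have htight : ∀ r ∈ I, r ≠ Pi.single i 1 →
      pair v (toReal r) = supportFn (newton f) (toReal r) := by
    intro r hr hri
    by_contra hne
    have hδ := lt_of_le_of_ne (supportFn_newton_le (toReal_nonneg r) hvP) (Ne.symm hne)
    obtain ⟨q, hq, hqr⟩ := exists_relint hf (hIF r hr)
    have hqi := hqr _ (single_mem_facetNormals hf i) (Ne.symm hri)
    rw [hNi, toReal_single, pair_single_right] at hqi
    have hx : ∀ (ε : ℝ) (w : Fin n → ℝ), pair ((1 - ε) • a + ε • q) w =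
        (1 - ε) * pair a w + ε * pair q w := fun ε w => by
      rw [pair_add, pair_smul, pair_smul]
    have hev : ∀ᶠ ε : ℝ in nhdsWithin 0 (Set.Ioi 0),
        (1 - ε) * pair a (toReal u₀) + ε * pair q (toReal u₀) <
          supportFn (newton f) (toReal u₀) := by
      have h1 : Continuous fun ε : ℝ =>
        (1 - ε) * pair a (toReal u₀) + ε * pair q (toReal u₀) := by fun_prop
      have h2 := h1.tendsto 0
      simp only [sub_zero, one_mul, zero_mul, add_zero] at h2
      exact (h2.mono_left nhdsWithin_le_nhds).eventually_lt_const hau₀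
    have hev2 : ∀ᶠ ε : ℝ in nhdsWithin 0 (Set.Ioi 0), ε < 1 :=
      nhdsWithin_le_nhds (eventually_lt_nhds zero_lt_one)
    obtain ⟨ε, ⟨hε1, hε2⟩, hε0⟩ := ((hev.and hev2).and self_mem_nhdsWithin).exists
    have hε0' : (0 : ℝ) < ε := hε0
    have hxcut : (1 - ε) • a + ε • q ∈ cut (newton f) B :=
      convex_cut _ _ ha (newton_subset_cut hq.1) (by linarith) hε0'.le (by ring)
    obtain ⟨-, hxi, hxy⟩ := hcut _ hxcut (by rw [hx]; exact hε1)
    have hxi' : ((1 - ε) • a + ε • q) i = ε * q i := by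
      simp [hai]
    have h1 := hproj _ (toReal r) (sub_pos.2 hxi)
    have h2 := hxy.2 r (hI hr)
    rw [hx, haI r hr, hq.2, hxi'] at h1
    rw [hxi'] at hxi h2
    have h3 : 0 < ε * q i := mul_pos hε0' hqi
    nlinarith
  have hei : (Pi.single i 1 : Fin n → ℕ) ∈ I := by
    by_contra hnot
    obtain ⟨r, hr, hrv⟩ := hA v hvP
    exact hrv (htight r hr fun h => hnot (h ▸ hr))
  have hvext : v ∈ (newton f).extremePoints ℝ :=
    ((isExposed_meetLocus (fun _ => newton_nonneg) (toReal_nonneg u₀)).isExtreme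
      (A := newton f)).extremePoints_subset_extremePoints hv.1
  obtain ⟨s, hs, rfl⟩ := extremePoints_newton_subset hvext
  have hsi : (s i : ℝ) = 1 := hv.2.1
  refine ⟨i, hei, hNi, s, hs, by exact_mod_cast hsi, htight, fun t ht hti htI => ?_⟩
  have htP := toReal_mem_newton (n := n) ht
  have hti1 : (t i : ℝ) = 1 := by
    rcases Nat.le_one_iff_eq_zero_or_eq_one.1 hti with h0 | h1
    · exfalso
      obtain ⟨r, hr, hrt⟩ := hA _ htP
      by_cases hri : r = Pi.single i 1
      · apply hrt
        rw [hri, hNi, toReal_single, pair_single_right]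
        simp [toReal, h0]
      · exact hrt (htI r hr hri)
    · exact_mod_cast h1
  -- the point `c` where the segment from `a` to `t` enters the Newton polyhedron
  obtain ⟨u, ⟨hu, hau⟩, hmax⟩ := Set.exists_max_image
    {u | u ∈ facetNormals f ∧ pair a (toReal u) < supportFn (newton f) (toReal u)}
    (fun u => (supportFn (newton f) (toReal u) - pair a (toReal u)) /
      (pair (toReal t) (toReal u) - pair a (toReal u)))
    ((facetNormals_finite f).subset fun u hu => hu.1) ⟨u₀, hu₀, hau₀⟩
  have hden : ∀ w, pair a (toReal w) < supportFn (newton f) (toReal w) →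
      0 < pair (toReal t) (toReal w) - pair a (toReal w) := fun w haw => by
    linarith [supportFn_newton_le (toReal_nonneg w) htP]
  set θ := (supportFn (newton f) (toReal u) - pair a (toReal u)) /
    (pair (toReal t) (toReal u) - pair a (toReal u)) with hθ
  have hθ0 : 0 < θ := div_pos (sub_pos.2 hau) (hden u hau)
  have hθ1 : θ ≤ 1 := (div_le_one (hden u hau)).2 (by
    linarith [supportFn_newton_le (toReal_nonneg u) htP])
  have hc : ∀ w, pair ((1 - θ) • a + θ • toReal t) w =
      (1 - θ) * pair a w + θ * pair (toReal t) w := fun w => by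
    rw [pair_add, pair_smul, pair_smul]
  have hcP : (1 - θ) • a + θ • toReal t ∈ newton f := by
    refine (mem_newton_iff hf).2 fun w hw => ?_
    rw [hc]
    by_cases haw : pair a (toReal w) < supportFn (newton f) (toReal w)
    · have h1 := (div_le_iff₀ (hden w haw)).1 (hmax w ⟨hw, haw⟩)
      nlinarith
    · push Not at haw
      have := supportFn_newton_le (toReal_nonneg w) htP
      nlinarith
  have hcu : pair ((1 - θ) • a + θ • toReal t) (toReal u) = supportFn (newton f) (toReal u) := by
    have h1 : θ * (pair (toReal t) (toReal u) - pair a (toReal u)) =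
      supportFn (newton f) (toReal u) - pair a (toReal u) := div_mul_cancel₀ _ (hden u hau).ne'
    rw [hc]; linarith
  have hci : ((1 - θ) • a + θ • toReal t) i = θ := by
    simp [hai, toReal, hti1]
  have hcI : ∀ r ∈ I, r ≠ Pi.single i 1 → pair ((1 - θ) • a + θ • toReal t) (toReal r) =
      supportFn (newton f) (toReal r) := fun r hr hri => by
    rw [hc, haI r hr, htI r hr hri]; ring
  obtain ⟨-, hdec1, hdec2⟩ := (hviol u hu hau).decomp ⟨hcP, hcu⟩
  rw [hci] at hdec1 hdec2
  rcases hθ1.eq_or_lt with h1 | h1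
  · have hle := hdec1 h1
    rw [h1, sub_self, zero_smul, one_smul, zero_add] at hle
    ext j
    by_contra hne
    have hlt : (s j : ℝ) < t j := lt_of_le_of_ne (hle j) fun h => hne (by
      have : (s j : ℝ) = t j := h
      exact_mod_cast this.symm)
    obtain ⟨r, hr, hrj⟩ := hcov j
    have hri : r ≠ Pi.single i 1 := by
      rintro rfl
      by_cases hji : j = i
      · subst hji; linarith
      · simp [hji] at hrj
    have h2 := htI r hr hri
    have h3 := htight r hr hri
    have h4 : pair (toReal s) (toReal r) < pair (toReal t) (toReal r) :=
      Finset.sum_lt_sum (fun k _ => mul_le_mul_of_nonneg_right (hle k) (toReal_nonneg r k))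
        ⟨j, Finset.mem_univ j, mul_lt_mul_of_pos_right hlt (Nat.cast_pos.2 hrj)⟩
    linarith
  · exfalso
    obtain ⟨y, hyu, hyi, hcy⟩ := hdec2 h1
    obtain ⟨r, hr, hry⟩ := hA y hyu.1
    by_cases hri : r = Pi.single i 1
    · apply hry
      rw [hri, hNi, toReal_single, pair_single_right, hyi]
    · have h2 := hcI r hr hri
      rw [hcy, pair_add, pair_smul, pair_smul, htight r hr hri] at h2
      have h3 := lt_of_le_of_ne (supportFn_newton_le (toReal_nonneg r) hyu.1) (Ne.symm hry)
      nlinarith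

end Cut

/-! ### The rays of the normal fan of the cut -/

section Rays

variable {n : ℕ} {K : Type*} [Field K] {f : MvPolynomial (Fin n) K}
  {B : Set (Set (Fin n → ℝ))}

theorem supportFn_cut (hf : f ≠ 0) {r : Fin n → ℕ} (hr : r ∈ keptNormals (newton f) B) :
    supportFn (cut (newton f) B) (toReal r) = supportFn (newton f) (toReal r) := by
  obtain ⟨s, -, hs⟩ := exists_mem_meetLocus hf (toReal_nonneg r)
  have hsc := newton_subset_cut (B := B) hs.1
  refine le_antisymm ?_ (le_csInf ⟨_, _, hsc, rfl⟩ ?_)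
  · rw [← hs.2]
    exact supportFn_le (fun _ hx => hx.1) (toReal_nonneg r) hsc
  · rintro _ ⟨a, ha, rfl⟩
    exact ha.2 r hr

/-- The rays of the normal fan of the cut are spanned by the normal vectors of the facets that are
kept: at a point `a` of the cut where the inequality of no such facet is tight one can move a little
in every direction, so the normal cone of `a` is zero. -/
theorem Ray.gen_mem_keptNormals (hf : f ≠ 0)
    (hB' : ∀ τ ∈ B, ∀ (i : Fin n) (m : ℝ), ¬ τ ⊆ {a | a i = m}) (ρ : Ray (cut (newton f) B)) :
    ρ.gen ∈ keptNormals (newton f) B := by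
  obtain ⟨u, hu, a, ha, hau⟩ := ρ
  change u ∈ _
  have hmem : toReal u ∈ normalCone (cut (newton f) B) a := by
    rw [hau]; exact ⟨1, zero_le_one, by simp⟩
  by_cases hex : ∃ r ∈ keptNormals (newton f) B,
      supportFn (newton f) (toReal r) = pair a (toReal r)
  · obtain ⟨r, hr, hra⟩ := hex
    have h1 : toReal r ∈ normalCone (cut (newton f) B) a :=
      ⟨toReal_nonneg r, by rw [supportFn_cut hf hr, hra]⟩
    rw [hau] at h1
    obtain ⟨t, -, ht⟩ := h1
    have ht' : ∀ i, (r i : ℝ) = t * u i := fun i => congrFun ht i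
    have hur : u = r := eq_of_cross hu hr.1 fun i j => by
      have : (u i : ℝ) * r j = r i * u j := by rw [ht' i, ht' j]; ring
      exact_mod_cast this
    exact hur ▸ hr
  · exfalso
    push Not at hex
    have hpu : ∀ (ε : ℝ) w, pair (a - ε • toReal u) w = pair a w - ε * pair (toReal u) w :=
      fun ε w => by rw [pair_sub, pair_smul]
    have hev : ∀ᶠ ε : ℝ in nhdsWithin 0 (Set.Ioi 0), ∀ w ∈ keptNormals (newton f) B,
        supportFn (newton f) (toReal w) < pair (a - ε • toReal u) (toReal w) := by
      rw [Filter.eventually_all_finite (keptNormals_finite f B)]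
      intro w hw
      have h1 : Continuous fun ε : ℝ => pair (a - ε • toReal u) (toReal w) := by
        simp only [hpu]; fun_prop
      have h2 := h1.tendsto 0
      simp only [zero_smul, sub_zero] at h2
      exact (h2.mono_left nhdsWithin_le_nhds).eventually_const_lt
        (lt_of_le_of_ne (ha.2 w hw) (hex w hw))
    obtain ⟨ε, hε, hε0⟩ := (hev.and self_mem_nhdsWithin).exists
    have hε0' : (0 : ℝ) < ε := hε0
    have h3 := supportFn_le (fun _ hx => hx.1) hmem.1
      (mem_cut_of_forall hf hB' fun w hw => (hε w hw).le)
    rw [hmem.2, hpu] at h3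
    have h4 : 0 < pair (toReal u) (toReal u) := by
      obtain ⟨i, hi⟩ := Function.ne_iff.1 hu.ne_zero
      have hi' : (0 : ℝ) < u i := Nat.cast_pos.2 (Nat.pos_of_ne_zero fun h0 => hi (by simp [toReal, h0]))
      exact Finset.sum_pos' (fun j _ => mul_nonneg (toReal_nonneg u j) (toReal_nonneg u j))
        ⟨i, Finset.mem_univ i, mul_pos hi' hi'⟩
    nlinarith

/-- The coordinate vectors span rays of the normal fan of the cut. -/
theorem exists_ray_single (hf : f ≠ 0)
    (hB' : ∀ τ ∈ B, ∀ (i : Fin n) (m : ℝ), ¬ τ ⊆ {a | a i = m}) (i : Fin n) :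
    ∃ ρ : Ray (cut (newton f) B), ρ.gen = Pi.single i 1 := by
  have hk := single_mem_keptNormals hf hB' i
  obtain ⟨s, -, hs⟩ := exists_mem_meetLocus hf
    (toReal_nonneg (Pi.single i 1 : Fin n → ℕ))
  have hsi := hs.2
  rw [toReal_single, pair_single_right] at hsi
  -- a point of the facet in direction `e_i` which is interior in all other directions
  let r : Fin n → ℝ := fun j => if j = i then 0 else 1
  have hr : (0 : Fin n → ℝ) ≤ r := fun j => by
    simp only [r]; split_ifs <;> simp
  have ha : toReal s + r ∈ cut (newton f) B := newton_subset_cut (newton_add hs.1 hr)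
  refine ⟨⟨Pi.single i 1, hk.1, toReal s + r, ha, Set.ext fun w => ⟨?_, ?_⟩⟩, rfl⟩
  · rintro ⟨hw0, hw⟩
    have h1 := supportFn_le (fun _ hx => hx.1) hw0 (newton_subset_cut (B := B) hs.1)
    rw [hw, pair_add] at h1
    have h2 : ∀ j ∈ Finset.univ, 0 ≤ r j * w j := fun j _ => mul_nonneg (hr j) (hw0 j)
    have h3 : pair r w = 0 := le_antisymm (by linarith) (Finset.sum_nonneg h2)
    have h4 := (Finset.sum_eq_zero_iff_of_nonneg h2).1 h3
    refine ⟨w i, hw0 i, ?_⟩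
    ext j
    by_cases hj : j = i
    · subst hj; simp [toReal]
    · simpa [r, hj, toReal] using h4 j (Finset.mem_univ j)
  · rintro ⟨t, ht, rfl⟩
    have hN : ∀ x, pair x (t • toReal (Pi.single i 1 : Fin n → ℕ)) = t * x i := fun x => by
      rw [toReal_single, pair_smul_right, pair_single_right]
    refine ⟨smul_nonneg ht (toReal_nonneg _), le_antisymm
      (supportFn_le (fun _ hx => hx.1) (smul_nonneg ht (toReal_nonneg _)) ha)
      (le_csInf ⟨_, _, ha, rfl⟩ ?_)⟩
    rintro _ ⟨x, hx, rfl⟩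
    have h1 := hx.2 _ hk
    rw [toReal_single, pair_single_right, ← hsi] at h1
    simp only [hN, Pi.add_apply, r, if_true, add_zero]
    exact mul_le_mul_of_nonneg_left h1 ht

/-- The rays whose coordinates vanish at a point of the atlas lie in a common cone, that is, their
inequalities are tight at a common point of the cut. -/
theorem AtlasPoint.exists_tight (hf : f ≠ 0)
    (hB' : ∀ τ ∈ B, ∀ (i : Fin n) (m : ℝ), ¬ τ ⊆ {a | a i = m})
    (p : AtlasPoint K (normalFan (cut (newton f) B)) (Ray.gen (P := cut (newton f) B))) :
    ∃ a ∈ cut (newton f) B, ∀ ρ : Ray (cut (newton f) B), X ρ ∈ p.1.asIdeal →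
      pair a (toReal ρ.gen) = supportFn (newton f) (toReal ρ.gen) := by
  classical
  obtain ⟨_, ⟨_, ⟨a, ha, rfl⟩, rfl⟩, hm⟩ := Set.not_subset.1 fun h => p.2 (Ideal.span_le.2 h)
  refine ⟨a, ha, fun ρ hρ => ?_⟩
  have hmem : toReal ρ.gen ∈ normalCone (cut (newton f) B) a := by
    by_contra hn
    exact hm (Ideal.mem_of_dvd _ (Finset.dvd_prod_of_mem _ (by simpa using hn)) hρ)
  rw [← hmem.2, supportFn_cut hf (ρ.gen_mem_keptNormals hf hB')]

/-- At a point over the origin, every coordinate direction is involved in some ray whose coordinate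
vanishes. -/
theorem exists_mem_of_comap_eq_origin {ι : Type} [Fintype ι] {u : ι → Fin n → ℕ}
    {p : PrimeSpectrum (MvPolynomial ι K)}
    (hp : p.comap (blowHom K u).toRingHom = origin K n) (i : Fin n) :
    ∃ ρ, X ρ ∈ p.asIdeal ∧ 0 < u ρ i := by
  have h1 : (X i : MvPolynomial (Fin n) K) ∈ (origin K n).asIdeal := by
    simp [origin, RingHom.mem_ker]
  rw [← hp] at h1
  have h2 : ∏ ρ, (X ρ : MvPolynomial ι K) ^ u ρ i ∈ p.asIdeal := by
    have : blowHom K u (X i) ∈ p.asIdeal := h1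
    simpa [blowHom] using this
  obtain ⟨ρ, -, hρ⟩ := (Ideal.IsPrime.prod_mem_iff (hp := p.2)).1 h2
  refine ⟨ρ, p.2.mem_of_pow_mem _ hρ, Nat.pos_of_ne_zero fun h0 => ?_⟩
  rw [h0, pow_zero] at hρ
  exact p.2.ne_top ((Ideal.eq_top_iff_one _).2 hρ)

end Rays

/-! ### The proper transform -/

section ProperTransform

variable {n : ℕ} {K : Type*} [Field K] {ι : Type} [Fintype ι]

/-- The exponent of the monomial of the proper transform that comes from the exponent `a` of `f`. The
subtraction does not truncate when `a` is in the support of `f`, see `transformExp_add`. -/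
noncomputable def transformExp (u : ι → Fin n → ℕ) (f : MvPolynomial (Fin n) K)
    (a : Fin n →₀ ℕ) : ι →₀ ℕ :=
  Finsupp.equivFunOnFinite.symm fun ρ => ∑ i, a i * u ρ i - ordAlong f (u ρ)

theorem ordAlong_le {f : MvPolynomial (Fin n) K} {a : Fin n →₀ ℕ} (ha : a ∈ f.support)
    (v : Fin n → ℕ) : ordAlong f v ≤ ∑ i, a i * v i :=
  Nat.sInf_le ⟨a, ha, rfl⟩

theorem transformExp_add {u : ι → Fin n → ℕ} {f : MvPolynomial (Fin n) K} {a : Fin n →₀ ℕ}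
    (ha : a ∈ f.support) (ρ : ι) :
    transformExp u f a ρ + ordAlong f (u ρ) = ∑ i, a i * u ρ i :=
  Nat.sub_add_cancel (ordAlong_le ha (u ρ))

theorem transformExp_eq_zero_iff {u : ι → Fin n → ℕ} {f : MvPolynomial (Fin n) K} (hf : f ≠ 0)
    {a : Fin n →₀ ℕ} (ha : a ∈ f.support) (ρ : ι) :
    transformExp u f a ρ = 0 ↔
      pair (toReal a) (toReal (u ρ)) = supportFn (newton f) (toReal (u ρ)) := by
  rw [pair_toReal, ← ordAlong_eq_supportFn hf, Nat.cast_inj, ← transformExp_add ha ρ]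
  omega

theorem sum_mul_single (a : Fin n → ℕ) (i : Fin n) :
    ∑ j, a j * (Pi.single i 1 : Fin n → ℕ) j = a i := by
  simp [Pi.single_apply]

theorem properTransform_eq (u : ι → Fin n → ℕ) (f : MvPolynomial (Fin n) K) :
    properTransform u f = ∑ a ∈ f.support, monomial (transformExp u f a) (coeff a f) := rfl

theorem monomial_eq_C_mul_prod (m : ι →₀ ℕ) (c : K) :
    monomial m c = C c * ∏ ρ, X ρ ^ m ρ := by
  rw [monomial_eq, Finsupp.prod_fintype _ _ fun _ => pow_zero _]

theorem blowHom_monomial (u : ι → Fin n → ℕ) (a : Fin n →₀ ℕ) (c : K) :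
    blowHom K u (monomial a c) = C c * ∏ ρ, X ρ ^ ∑ i, a i * u ρ i := by
  rw [blowHom, monomial_eq_C_mul_prod, map_mul, algHom_C, map_prod]
  simp only [map_pow, aeval_X, ← Finset.prod_pow, algebraMap_eq]
  rw [Finset.prod_comm]
  congr 1
  refine Finset.prod_congr rfl fun ρ _ => ?_
  rw [← Finset.prod_pow_eq_pow_sum]
  exact Finset.prod_congr rfl fun i _ => by rw [← pow_mul, mul_comm]

/-- The total transform is the proper transform times the exceptional monomial. -/
theorem blowHom_eq_properTransform_mul (u : ι → Fin n → ℕ) (f : MvPolynomial (Fin n) K) :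
    blowHom K u f = properTransform u f * ∏ ρ, X ρ ^ ordAlong f (u ρ) := by
  conv_lhs => rw [f.as_sum]
  rw [map_sum, properTransform_eq, Finset.sum_mul]
  refine Finset.sum_congr rfl fun a ha => ?_
  rw [blowHom_monomial, monomial_eq_C_mul_prod, mul_assoc, ← Finset.prod_mul_distrib]
  simp only [← pow_add, transformExp_add ha]

/-- The rays spanned by the coordinate vectors make the map from the exponents of `f` to those of the
proper transform injective. -/
theorem properTransform_ne_zero {u : ι → Fin n → ℕ} (hu : ∀ i, ∃ ρ, u ρ = Pi.single i 1)
    {f : MvPolynomial (Fin n) K} (hf : f ≠ 0) : properTransform u f ≠ 0 := by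
  obtain ⟨s, hs⟩ := Finset.nonempty_of_ne_empty (fun h => hf (support_eq_empty.1 h))
  have hinj : ∀ a ∈ f.support, transformExp u f a = transformExp u f s → a = s := by
    intro a ha h
    ext i
    obtain ⟨ρ, hρ⟩ := hu i
    have h1 := transformExp_add (u := u) ha ρ
    rw [h, transformExp_add hs ρ, hρ, sum_mul_single, sum_mul_single] at h1
    exact h1.symm
  intro h0
  have h1 : coeff (transformExp u f s) (properTransform u f) = coeff s f := by
    classical
    rw [properTransform_eq, coeff_sum, Finset.sum_eq_single s]
    · rw [coeff_monomial, if_pos rfl]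
    · intro a ha hne
      rw [coeff_monomial, if_neg fun h => hne (hinj a ha h)]
    · exact fun h => absurd hs h
  rw [h0, coeff_zero] at h1
  exact (mem_support_iff.1 hs) h1.symm

theorem coaction_monomial (u : ι → Fin n → ℕ) (m : ι →₀ ℕ) (c : K) :
    coaction K u (monomial m c) =
      AddMonoidAlgebra.single (∑ ρ, m ρ • weight u ρ) (monomial m c) := by
  rw [monomial_eq_C_mul_prod, map_mul, algHom_C, map_prod]
  simp only [map_pow, coaction, aeval_X, AddMonoidAlgebra.single_pow, AddMonoidAlgebra.prod_single]
  simp [AddMonoidAlgebra.coe_algebraMap, AddMonoidAlgebra.single_mul_single, algebraMap_eq]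

/-- The pull-backs of monomials of `𝔸ⁿ` are invariant. -/
theorem sum_smul_weight (u : ι → Fin n → ℕ) (m : Fin n → ℕ) :
    ∑ ρ, (∑ i, m i * u ρ i) • weight u ρ = 0 := by
  classical
  have : ∑ ρ, (∑ i, m i * u ρ i) • weight u ρ = QuotientAddGroup.mk' (betaDual u).range
      (∑ ρ, (∑ i, m i * u ρ i) • (Pi.single ρ 1 : ι → ℤ)) := by
    rw [map_sum]
    refine Finset.sum_congr rfl fun ρ _ => ?_
    rw [map_nsmul]
    congr 1
  rw [this, QuotientAddGroup.mk'_apply, QuotientAddGroup.eq_zero_iff]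
  refine ⟨fun i => m i, ?_⟩
  ext ρ
  simp [betaDual, Finset.sum_apply, Pi.single_apply]

theorem isDivisorEq_properTransform {u : ι → Fin n → ℕ} (hu : ∀ i, ∃ ρ, u ρ = Pi.single i 1)
    {f : MvPolynomial (Fin n) K} (hf : f ≠ 0) : IsDivisorEq u (properTransform u f) := by
  refine ⟨properTransform_ne_zero hu hf, -∑ ρ, ordAlong f (u ρ) • weight u ρ, ?_⟩
  rw [properTransform_eq, map_sum, ← AddMonoidAlgebra.singleAddHom_apply, map_sum]
  refine Finset.sum_congr rfl fun a ha => ?_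
  rw [coaction_monomial, AddMonoidAlgebra.singleAddHom_apply]
  congr 1
  rw [eq_neg_iff_add_eq_zero, ← Finset.sum_add_distrib, ← sum_smul_weight u a]
  exact Finset.sum_congr rfl fun ρ _ => by rw [← add_smul, transformExp_add ha]

omit [Fintype ι] in
theorem isDivisorEq_X (u : ι → Fin n → ℕ) (ρ : ι) : IsDivisorEq u (X ρ : MvPolynomial ι K) :=
  ⟨X_ne_zero ρ, weight u ρ, by simp [coaction]⟩

theorem monomial_mem_iff {p : Ideal (MvPolynomial ι K)} [hp : p.IsPrime] {m : ι →₀ ℕ} {c : K}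
    (hc : c ≠ 0) : monomial m c ∈ p ↔ ∃ ρ, X ρ ∈ p ∧ m ρ ≠ 0 := by
  have hC : IsUnit (C c : MvPolynomial ι K) := (isUnit_iff_ne_zero.2 hc).map C
  rw [monomial_eq_C_mul_prod, Ideal.unit_mul_mem_iff_mem _ hC, Ideal.IsPrime.prod_mem_iff]
  simp only [Finset.mem_univ, true_and]
  refine exists_congr fun ρ => ⟨fun h => ?_, fun h => Ideal.pow_mem_of_mem _ h.1 _
    (Nat.pos_of_ne_zero h.2)⟩
  refine ⟨hp.mem_of_pow_mem _ h, fun h0 => ?_⟩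
  rw [h0, pow_zero] at h
  exact hp.ne_top ((Ideal.eq_top_iff_one _).2 h)

end ProperTransform

/-! ### Smoothness of the proper transform -/

section Local

variable {n : ℕ} {K : Type*} [Field K] {ι : Type} [Fintype ι] {u : ι → Fin n → ℕ}
  {f : MvPolynomial (Fin n) K} {p : PrimeSpectrum (MvPolynomial ι K)}

/-- The values of the coordinates at `p`, in the coordinate ring of its closure, with the vanishing
ones replaced by `1`. -/
noncomputable def torusCoord (p : PrimeSpectrum (MvPolynomial ι K)) (ρ : ι) :
    MvPolynomial ι K ⧸ p.asIdeal :=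
  open Classical in if X ρ ∈ p.asIdeal then 1 else Ideal.Quotient.mk _ (X ρ)

omit [Fintype ι] in
theorem torusCoord_ne_zero (p : PrimeSpectrum (MvPolynomial ι K)) (ρ : ι) :
    torusCoord p ρ ≠ 0 := by
  have := Ideal.Quotient.isDomain p.asIdeal
  rw [torusCoord]
  split_ifs with h
  · exact one_ne_zero
  · rwa [Ne, Ideal.Quotient.eq_zero_iff_mem]

/-- The image in `𝔸ⁿ` of the point with coordinates `torusCoord`; it lies in the torus. -/
noncomputable def torusHom (u : ι → Fin n → ℕ) (p : PrimeSpectrum (MvPolynomial ι K)) :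
    MvPolynomial (Fin n) K →ₐ[K] MvPolynomial ι K ⧸ p.asIdeal :=
  aeval fun i => ∏ ρ, torusCoord p ρ ^ u ρ i

open Classical in
/-- At `p`, a polynomial with the exponents of the proper transform takes, up to a nonzero factor, the
value at `torusHom` of its restriction to the exponents of `f` where the rays whose coordinates
vanish at `p` are tight. -/
theorem mk_sum_monomial_transformExp {S : Finset (Fin n →₀ ℕ)}
    (hS : S = f.support.filter fun a => ∀ ρ, X ρ ∈ p.asIdeal → transformExp u f a ρ = 0)
    (c : (Fin n →₀ ℕ) → K) :
    (∏ ρ, torusCoord p ρ ^ ordAlong f (u ρ)) *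
        Ideal.Quotient.mk _ (∑ a ∈ f.support, monomial (transformExp u f a) (c a)) =
      torusHom u p (∑ a ∈ S, monomial a (c a)) := by
  subst hS
  rw [map_sum, map_sum, Finset.mul_sum, Finset.sum_filter]
  refine Finset.sum_congr rfl fun a ha => ?_
  split_ifs with h
  · have h1 : ∀ ρ, (Ideal.Quotient.mk p.asIdeal (X ρ)) ^ transformExp u f a ρ =
        torusCoord p ρ ^ transformExp u f a ρ := by
      intro ρ
      rw [torusCoord]
      split_ifs with hρ
      · rw [h ρ hρ, pow_zero, pow_zero]
      · rfl
    rw [monomial_eq_C_mul_prod, map_mul, map_prod]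
    simp only [map_pow, h1]
    rw [mul_left_comm, ← Finset.prod_mul_distrib, torusHom, monomial_eq_C_mul_prod, map_mul,
      map_prod, algHom_C]
    simp only [map_pow, aeval_X, ← Finset.prod_pow]
    rw [Finset.prod_comm]
    congr 1
    refine Finset.prod_congr rfl fun ρ _ => ?_
    rw [← pow_add, add_comm, transformExp_add ha, ← Finset.prod_pow_eq_pow_sum]
    exact Finset.prod_congr rfl fun i _ => by rw [← pow_mul, mul_comm]
  · push Not at h
    obtain ⟨ρ, hρ, hne⟩ := h
    have : monomial (transformExp u f a) (c a) ∈ p.asIdeal := by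
      by_cases hc : c a = 0
      · rw [hc, monomial_zero]; exact p.asIdeal.zero_mem
      · exact (monomial_mem_iff (hp := p.2) hc).2 ⟨ρ, hρ, hne⟩
    rw [Ideal.Quotient.eq_zero_iff_mem.2 this, mul_zero]

open Classical in
/-- If the rays whose coordinates vanish at `p` are tight along a face of the Newton polyhedron whose
face polynomial is non-singular in the torus, then some derivative of the proper transform along
the torus orbit of `p` does not vanish at `p`. -/
theorem exists_pderiv_notMem_of_face (hu : ∀ i, ∃ ρ, u ρ = Pi.single i 1)
    {F : Set (Fin n → ℝ)} (hF : ∀ a ∈ f.support, toReal a ∈ F ↔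
      ∀ ρ, X ρ ∈ p.asIdeal → transformExp u f a ρ = 0)
    (hne : ∃ a ∈ f.support, toReal a ∈ F)
    (hsm : ∀ q : PrimeSpectrum (MvPolynomial (Fin n) K), (∀ i, X i ∉ q.asIdeal) →
      SmoothAt (facePart f F) q)
    (hfp : properTransform u f ∈ p.asIdeal) :
    ∃ ρ, X ρ ∉ p.asIdeal ∧ pderiv ρ (properTransform u f) ∉ p.asIdeal := by
  have := Ideal.Quotient.isDomain p.asIdeal
  by_contra! hall
  set S := f.support.filter fun a : Fin n →₀ ℕ => toReal a ∈ F with hSdef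
  have hS : S = f.support.filter fun a => ∀ ρ, X ρ ∈ p.asIdeal → transformExp u f a ρ = 0 :=
    Finset.filter_congr hF
  have hface : facePart f F = ∑ a ∈ S, monomial a (coeff a f) := rfl
  have hmem : torusHom u p (facePart f F) = 0 := by
    rw [hface, ← mk_sum_monomial_transformExp hS, ← properTransform_eq,
      Ideal.Quotient.eq_zero_iff_mem.2 hfp, mul_zero]
  let q : PrimeSpectrum (MvPolynomial (Fin n) K) :=
    ⟨RingHom.ker (torusHom u p).toRingHom, RingHom.ker_isPrime _⟩
  have hq : ∀ g, g ∈ q.asIdeal ↔ torusHom u p g = 0 := fun g => Iff.rfl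
  have hX : ∀ i, torusHom u p (X i) ≠ 0 := by
    intro i
    rw [torusHom, aeval_X]
    exact Finset.prod_ne_zero_iff.2 fun ρ _ => pow_ne_zero _ (torusCoord_ne_zero p ρ)
  have hface0 : facePart f F ≠ 0 := by
    obtain ⟨s, hs, hsF⟩ := hne
    intro h0
    have h1 : coeff s (facePart f F) = coeff s f := by
      rw [hface, coeff_sum, Finset.sum_eq_single s]
      · rw [coeff_monomial, if_pos rfl]
      · intro a _ hne
        rw [coeff_monomial, if_neg hne]
      · exact fun h => absurd (Finset.mem_filter.2 ⟨hs, hsF⟩) h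
    rw [h0, coeff_zero] at h1
    exact (mem_support_iff.1 hs) h1.symm
  obtain ⟨i, hi⟩ := exists_pderiv_notMem_of_smoothAt hface0 ((hq _).2 hmem)
    (hsm q fun i => (hq _).not.2 (hX i))
  obtain ⟨ρ, hρ⟩ := hu i
  -- the Euler derivations `x'_ρ ∂_ρ` and `x_i ∂_i` correspond to each other
  have hE : torusHom u p (∑ a ∈ S, monomial a ((transformExp u f a ρ : K) * coeff a f)) = 0 := by
    by_cases hρp : X ρ ∈ p.asIdeal
    · rw [Finset.sum_eq_zero, map_zero]
      intro a ha
      rw [hS] at ha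
      rw [(Finset.mem_filter.1 ha).2 ρ hρp, Nat.cast_zero, zero_mul, monomial_zero]
    · rw [← mk_sum_monomial_transformExp hS]
      have h1 : ∑ a ∈ f.support, monomial (transformExp u f a)
          ((transformExp u f a ρ : K) * coeff a f) = X ρ * pderiv ρ (properTransform u f) := by
        rw [properTransform_eq, map_sum, Finset.mul_sum]
        refine Finset.sum_congr rfl fun a _ => ?_
        rw [X_mul_pderiv_monomial, ← nsmul_eq_mul, map_nsmul]
      rw [h1, Ideal.Quotient.eq_zero_iff_mem.2 (Ideal.mul_mem_left _ _ (hall ρ hρp)), mul_zero]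
  have h2 : X i * pderiv i (facePart f F) =
      ∑ a ∈ S, monomial a ((transformExp u f a ρ : K) * coeff a f) +
        ordAlong f (u ρ) • facePart f F := by
    rw [hface, map_sum, Finset.mul_sum, Finset.smul_sum, ← Finset.sum_add_distrib]
    refine Finset.sum_congr rfl fun a ha => ?_
    have h3 := transformExp_add (u := u) (Finset.mem_filter.1 ha).1 ρ
    rw [show ∑ j, a j * u ρ j = a i by rw [hρ, sum_mul_single]] at h3
    rw [X_mul_pderiv_monomial, ← h3, ← nsmul_eq_mul, map_nsmul, add_smul]
  have h4 : torusHom u p (X i * pderiv i (facePart f F)) = 0 := by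
    rw [h2, map_add, hE, map_nsmul, hmem, smul_zero, add_zero]
  rw [map_mul] at h4
  exact hi ((hq _).2 ((mul_eq_zero.1 h4).resolve_left (hX i)))

/-- If the monomial of the exponent `s` is linear in `x'_ρ₀` and does not involve the other
coordinates that vanish at `p`, and `s` is the only such exponent, then the derivative of the proper
transform in the direction of `ρ₀` does not vanish at `p`. -/
theorem pderiv_notMem_of_apex {ρ₀ : ι} (hρ₀ : X ρ₀ ∈ p.asIdeal) {s : Fin n →₀ ℕ}
    (hs : s ∈ f.support) (hs1 : transformExp u f s ρ₀ = 1)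
    (hs0 : ∀ ρ, X ρ ∈ p.asIdeal → ρ ≠ ρ₀ → transformExp u f s ρ = 0)
    (huniq : ∀ t ∈ f.support, transformExp u f t ρ₀ ≤ 1 →
      (∀ ρ, X ρ ∈ p.asIdeal → ρ ≠ ρ₀ → transformExp u f t ρ = 0) → t = s) :
    pderiv ρ₀ (properTransform u f) ∉ p.asIdeal := by
  classical
  have hterm : ∀ t ∈ f.support, t ≠ s →
      pderiv ρ₀ (monomial (transformExp u f t) (coeff t f)) ∈ p.asIdeal := by
    intro t ht hts
    rw [pderiv_monomial]
    by_cases hc : coeff t f * (transformExp u f t ρ₀ : K) = 0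
    · rw [hc, monomial_zero]; exact p.asIdeal.zero_mem
    rw [monomial_mem_iff (hp := p.2) hc]
    by_contra! h
    refine hts (huniq t ht ?_ fun ρ hρ hne => ?_)
    · have := h ρ₀ hρ₀
      simp only [Finsupp.coe_tsub, Pi.sub_apply, Finsupp.single_eq_same] at this
      omega
    · have := h ρ hρ
      simpa [Finsupp.single_apply, hne.symm] using this
  rw [properTransform_eq, map_sum, ← Finset.add_sum_erase _ _ hs, Ideal.add_mem_iff_left _
    (Ideal.sum_mem _ fun t ht => hterm t (Finset.mem_of_mem_erase ht) (Finset.ne_of_mem_erase ht)),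
    pderiv_monomial, hs1, Nat.cast_one, mul_one,
    monomial_mem_iff (hp := p.2) (mem_support_iff.1 hs)]
  rintro ⟨ρ, hρ, hne⟩
  by_cases h : ρ = ρ₀
  · subst h; simp [hs1] at hne
  · simp [hs0 ρ hρ h] at hne

end Local

/-! ### Points over the origin -/

section Origin

variable {n : ℕ} {K : Type*} [Field K] {f : MvPolynomial (Fin n) K}
  {B : Set (Set (Fin n → ℝ))}

/-- At a point of the proper transform over the origin, some partial derivative of its equation in a
direction transverse to the exceptional divisors through the point does not vanish. -/
theorem exists_pderiv_properTransform_notMem (hf : f ≠ 0) (hnd : IsNondegenerate f)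
    (hB : IsConsistentB1 (newton f) B)
    (hB' : ∀ τ ∈ B, ∀ (i : Fin n) (m : ℝ), ¬ τ ⊆ {a | a i = m})
    (p : AtlasPoint K (normalFan (cut (newton f) B)) (Ray.gen (P := cut (newton f) B)))
    (hp : p.1.comap (blowHom K (Ray.gen (P := cut (newton f) B))).toRingHom = origin K n)
    (hfp : properTransform (Ray.gen (P := cut (newton f) B)) f ∈ p.1.asIdeal) :
    ∃ ρ : Ray (cut (newton f) B),
      pderiv ρ (properTransform (Ray.gen (P := cut (newton f) B)) f) ∉ p.1.asIdeal ∧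
        (X ρ ∈ p.1.asIdeal → ¬ 0 < ordAlong f ρ.gen) := by
  classical
  obtain ⟨a, ha, hat⟩ := p.exists_tight hf hB'
  have hcov := exists_mem_of_comap_eq_origin hp
  have hinj : ∀ ρ ρ' : Ray (cut (newton f) B), ρ.gen = ρ'.gen → ρ = ρ' := fun _ _ h =>
    Subtype.ext h
  rcases tight_dichotomy hf hB hB'
    (I := {r | ∃ ρ : Ray (cut (newton f) B), X ρ ∈ p.1.asIdeal ∧ ρ.gen = r})
    (by rintro _ ⟨ρ, -, rfl⟩; exact ρ.gen_mem_keptNormals hf hB') ha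
    (by rintro _ ⟨ρ, hρ, rfl⟩; exact hat ρ hρ)
    (fun j => (hcov j).elim fun ρ h => ⟨_, ⟨ρ, h.1, rfl⟩, h.2⟩) with
    ⟨x, hx, hxI⟩ | ⟨i, ⟨ρ₀, hρ₀, hgen⟩, hN, s, hs, hsi, hst, huniq⟩
  · replace hxI : ∀ ρ : Ray (cut (newton f) B), X ρ ∈ p.1.asIdeal →
        pair x (toReal ρ.gen) = supportFn (newton f) (toReal ρ.gen) :=
      fun ρ hρ => hxI _ ⟨ρ, hρ, rfl⟩
    -- the face where the tight normals are minimal is the meet locus of their sum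
    let T : Finset (Ray (cut (newton f) B)) := Finset.univ.filter fun ρ => X ρ ∈ p.1.asIdeal
    have hT : ∀ ρ, ρ ∈ T ↔ X ρ ∈ p.1.asIdeal := fun ρ => by simp [T]
    let w : Fin n → ℝ := ∑ ρ ∈ T, toReal ρ.gen
    have hw : ∀ j, 0 < w j := by
      intro j
      obtain ⟨ρ, hρ, hj⟩ := hcov j
      simp only [w, Finset.sum_apply]
      exact Finset.sum_pos' (fun ρ _ => toReal_nonneg _ j)
        ⟨ρ, (hT ρ).2 hρ, Nat.cast_pos.2 hj⟩
    have hw0 : 0 ≤ w := fun j => (hw j).le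
    have hmeet : ∀ y ∈ newton f, y ∈ meetLocus (newton f) w ↔ ∀ ρ : Ray (cut (newton f) B),
        X ρ ∈ p.1.asIdeal → pair y (toReal ρ.gen) = supportFn (newton f) (toReal ρ.gen) := by
      intro y hy
      have hle : ∀ z ∈ newton f, ∀ ρ ∈ T, pair x (toReal ρ.gen) ≤ pair z (toReal ρ.gen) :=
        fun z hz ρ hρ => by
          rw [hxI ρ ((hT ρ).1 hρ)]; exact supportFn_newton_le (toReal_nonneg _) hz
      rw [mem_meetLocus_iff hf hw0]
      simp only [w, pair_sum_right]
      refine ⟨fun h ρ hρ => ?_, fun h => ⟨hy, fun z hz => ?_⟩⟩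
      · have h1 := (Finset.sum_eq_sum_iff_of_le (hle y hy)).1
          (le_antisymm (Finset.sum_le_sum (hle y hy)) (h.2 x hx)) ρ ((hT ρ).2 hρ)
        rw [← h1, hxI ρ hρ]
      · refine Finset.sum_le_sum fun ρ hρ => ?_
        rw [h ρ ((hT ρ).1 hρ)]
        exact supportFn_newton_le (toReal_nonneg _) hz
    obtain ⟨s, hs, hsw⟩ := exists_mem_meetLocus hf hw0
    obtain ⟨ρ, hρ, hd⟩ := exists_pderiv_notMem_of_face (exists_ray_single hf hB')
      (fun a ha => (hmeet _ (toReal_mem_newton ha)).trans (forall₂_congr fun ρ _ =>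
        (transformExp_eq_zero_iff hf ha ρ).symm)) ⟨s, hs, hsw⟩
      (hnd _ (isFace_meetLocus hf hw0) (isCompact_meetLocus hw)) hfp
    exact ⟨ρ, hd, fun h => absurd h hρ⟩
  · have hord : ordAlong f ρ₀.gen = 0 := by
      rw [← hgen, ← ordAlong_eq_supportFn hf] at hN
      exact_mod_cast hN
    have hexp : ∀ t ∈ f.support, transformExp Ray.gen f t ρ₀ = t i := by
      intro t ht
      have h1 := transformExp_add (u := Ray.gen) ht ρ₀
      rwa [hord, add_zero, hgen, sum_mul_single] at h1
    have hiff : ∀ t ∈ f.support,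
        (∀ r, (∃ ρ : Ray (cut (newton f) B), X ρ ∈ p.1.asIdeal ∧ ρ.gen = r) →
          r ≠ Pi.single i 1 →
          pair (toReal t) (toReal r) = supportFn (newton f) (toReal r)) ↔
        ∀ ρ : Ray (cut (newton f) B), X ρ ∈ p.1.asIdeal → ρ ≠ ρ₀ →
          transformExp Ray.gen f t ρ = 0 := by
      intro t ht
      refine ⟨fun h ρ hρ hne => ?_, ?_⟩
      · exact (transformExp_eq_zero_iff hf ht ρ).2
          (h _ ⟨ρ, hρ, rfl⟩ fun he => hne (hinj _ _ (he.trans hgen.symm)))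
      · rintro h _ ⟨ρ, hρ, rfl⟩ hne
        exact (transformExp_eq_zero_iff hf ht ρ).1 (h ρ hρ fun he => hne (he ▸ hgen))
    refine ⟨ρ₀, pderiv_notMem_of_apex hρ₀ hs (by rw [hexp s hs, hsi]) ((hiff s hs).1 hst)
      fun t ht ht1 ht0 => huniq t ht (by rwa [hexp t ht] at ht1) ((hiff t ht).2 ht0), fun _ => ?_⟩
    rw [hord]
    exact lt_irrefl 0

/-- The proper transform and the exceptional divisors are smooth and transverse at the points over
the origin. -/
theorem smoothAt_and_transverseAt (hf : f ≠ 0) (hnd : IsNondegenerate f)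
    (hB : IsConsistentB1 (newton f) B)
    (hB' : ∀ τ ∈ B, ∀ (i : Fin n) (m : ℝ), ¬ τ ⊆ {a | a i = m})
    (p : AtlasPoint K (normalFan (cut (newton f) B)) (Ray.gen (P := cut (newton f) B)))
    (hp : p.1.comap (blowHom K (Ray.gen (P := cut (newton f) B))).toRingHom = origin K n) :
    SmoothAt (properTransform (Ray.gen (P := cut (newton f) B)) f) p.1 ∧
      TransverseAt (fun j : Option {ρ : Ray (cut (newton f) B) // 0 < ordAlong f ρ.gen} =>
        j.elim (properTransform (Ray.gen (P := cut (newton f) B)) f) fun ρ => X ρ.1) p.1 := by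
  have key := exists_pderiv_properTransform_notMem hf hnd hB hB' p hp
  refine ⟨fun q hq => ?_, transverseAt_option_elim key⟩
  have hmem : properTransform (Ray.gen (P := cut (newton f) B)) f ∈ p.1.asIdeal := by
    rw [← hq]
    change Ideal.Quotient.mk _ _ ∈ q.asIdeal
    rw [Ideal.Quotient.eq_zero_iff_mem.2 (Ideal.mem_span_singleton_self _)]
    exact q.asIdeal.zero_mem
  obtain ⟨ρ, hρ, -⟩ := key hmem
  exact smoothAt_of_pderiv_notMem hρ q hq

end Origin

end BCut

theorem theoremT (k : Subfield ℂ) (n : ℕ) (f : MvPolynomial (Fin n) k)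
    (hf : f ≠ 0) (hf0 : MvPolynomial.constantCoeff f = 0)
    (hnd : BCut.IsNondegenerate f)
    (B : Set (Set (Fin n → ℝ)))
    (hB : BCut.IsConsistentB1 (BCut.newton f) B)
    (hB' : ∀ τ ∈ B, ∀ (i : Fin n) (m : ℝ), ¬ τ ⊆ {a | a i = m}) :
    let u : BCut.Ray (BCut.cut (BCut.newton f) B) → Fin n → ℕ := BCut.Ray.gen
    let f' := BCut.properTransform u f
    BCut.blowHom k u f = f' * ∏ ρ, MvPolynomial.X ρ ^ BCut.ordAlong f (u ρ) ∧
    BCut.IsDivisorEq u f' ∧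
    ∀ P : BCut.StackPoint k (BCut.normalFan (BCut.cut (BCut.newton f) B)) u,
      BCut.blowDown k _ u P = BCut.origin k n →
        BCut.StackSmoothAt f' P ∧
        BCut.StackTransverseAt
          (fun j : Option {ρ // 0 < BCut.ordAlong f (u ρ)} =>
            j.elim f' fun ρ => MvPolynomial.X ρ.1) P ∧
        BCut.IsSNCAt (BCut.blowHom k u f) P := by
  intro u f'
  have hrel := BCut.blowHom_eq_properTransform_mul u f
  have hdiv : BCut.IsDivisorEq u f' :=
    BCut.isDivisorEq_properTransform (BCut.exists_ray_single hf hB') hf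
  refine ⟨hrel, hdiv, fun P hP => ?_⟩
  have hloc : ∀ p : BCut.AtlasPoint k _ u, Quot.mk _ p = P → _ := fun p hp =>
    BCut.smoothAt_and_transverseAt hf hnd hB hB' p (by rw [← hp] at hP; exact hP)
  have hsm : BCut.StackSmoothAt f' P := fun p hp => (hloc p hp).1
  have htr : BCut.StackTransverseAt
      (fun j : Option {ρ // 0 < BCut.ordAlong f (u ρ)} =>
        j.elim f' fun ρ => MvPolynomial.X ρ.1) P := fun p hp => (hloc p hp).2
  refine ⟨hsm, htr, Option {ρ // 0 < BCut.ordAlong f (u ρ)}, inferInstance, _,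
    fun j => j.elim 1 fun ρ => BCut.ordAlong f (u ρ.1), ?_, htr, fun p _ => ⟨1, ?_⟩⟩
  · rintro (_ | ρ)
    · exact ⟨hdiv, Nat.one_pos, hsm⟩
    · exact ⟨BCut.isDivisorEq_X u ρ.1, ρ.2, fun p _ => BCut.smoothAt_X ρ.1 p.1⟩
  · rw [Units.val_one, one_mul, hrel, Fintype.prod_option]
    congr 1
    simp only [Option.elim_none, Option.elim_some, pow_one]
    congr 1
    -- the coordinates with exponent zero do not contribute
    rw [← Finset.prod_filter_of_ne (p := fun ρ => 0 < BCut.ordAlong f (u ρ)) fun ρ _ hne =>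
      Nat.pos_of_ne_zero fun h0 => hne (by rw [h0, pow_zero])]
    exact Finset.prod_subtype _ (by simp) _
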